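/- **Setting.** Let $\mathcal H$ be a separable infinite-dimensional real Hilbert space with orthonormal basis $(\phi_k)_{k\ge1}$, let $(N_\ell)_{\ell\ge0}$ be a nondecreasing sequence of integers, $\mathcal H_\ell=\mathrm{span}\{\phi_1,\dots,\phi_{N_\ell}\}$, and $\mathcal P_\ell$ the orthogonal projection onto $\mathcal H_\ell$; put $\mathcal P_{-1}=0$. Let $\Psi$ and $\Psi^\ell$ ($\ell\ge 0$) be jointly measurable random maps $u\mapsto\Psi(u,\xi)$, $u\mapsto\Psi^\ell(u,\xi)$ of $\mathcal H$ into itself, where the model noise $\xi$ has a fixed law; in $\Psi(u)$, $\Psi^\ell(u)$ the noise is independent of $u$. Let $u_0$ be an $\mathcal H$-valued random variable, $H:\mathcal H\to\mathbb R^m$ bounded and linear, $\Gamma\in\mathbb R^{m\times m}$ symmetric positive definite, and $y_1,y_2,\dots\in\mathbb R^m$ given observations (of $u_{n+1}=\Psi(u_n)$, $y_n=Hu_n+\eta_n$, $\eta_n\sim N(0,\Gamma)$ i.i.d.). Write $\|\cdot\|_p$ for the norm of $L^p(\Omega;\mathcal H)$ (or of $L^p(\Omega;\mathbb R)$ for real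 random variables). Write $f\lesssim g$ if $f\le Cg$ and $f\eqsim g$ if $f\lesssim g\lesssim f$; in the hypotheses the implied constants do not depend on $\ell$. **Assumptions.** Let $d\ge1$ be an integer, $\kappa>1$, $\beta,\gamma>0$. 1. For every $p\ge2$ there is $c<\infty$ such that $\|\Psi^\ell(u)-\Psi^\ell(v)\|_p\le c\|u-v\|_p$ and $\|\Psi^\ell(u)\|_p^p\le c(1+\|u\|_p^p)$ for all $\ell\ge0$ and $u,v\in L^p(\Omega;\mathcal H)$. 2. $N_\ell\eqsim\kappa^\ell$, $h_\ell\eqsim N_\ell^{-1/d}$, $\Psi^\ell$ takes values in $\mathcal H_\ell$, and, for all $p\ge2$: $u_0\in L^p(\Omega;\mathcal H)$; $\|\Psi^\ell(u)-\Psi(u)\|_p\lesssim h_\ell^{\beta/2}$ for each $u\in L^p(\Omega;\mathcal H)$; $\|(I-\mathcal P_\ell)u_0\|_p\lesssim h_\ell^{\beta/2}$. Moreover $\mathrm{Cost}(\Psi^\ell)\lesssim h_\ell^{-d\gamma}$, where $\mathrm{Cost}(\Psi^\ell)$ is the cost of one evaluation of $\Psi^\ell$. **Mean-field EnKF.** Let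 $\hat{\bar v}_0=u_0$ and, for $n\ge0$, $\bar v_{n+1}=\Psi(\hat{\bar v}_n)$, $\bar C_{n+1}=\mathrm{Cov}[\bar v_{n+1}]$, $\bar K_{n+1}=\bar C_{n+1}H^*(H\bar C_{n+1}H^*+\Gamma)^{-1}$ and $\hat{\bar v}_{n+1}=(I-\bar K_{n+1}H)\bar v_{n+1}+\bar K_{n+1}(y_{n+1}+\eta_{n+1})$, with fresh model noise and fresh independent $\eta_{n+1}\sim N(0,\Gamma)$. Let $\hat{\bar\mu}_n$ be the law of $\hat{\bar v}_n$. **Multilevel EnKF (MLEnKF).** For each level $0\le\ell\le L$ there are $M_\ell\ge2$ particle pairs $(\hat v^{\ell}_n,\hat v^{\ell-1}_n)(\omega_{\ell,i})$, $1\le i\le M_\ell$, where $\omega_{\ell,i}$ are i.i.d. and each consists of a copy of $u_0$, model noises for the successive steps, and perturbations $\eta_{n,i}^{\ell}\sim N(0,\Gamma)$, all independent. For each $j\in\{\ell,\ell-1\}$ put $\hat v^j_0=\mathcal P_ju_0$ and $v^j_{n+1}=\Psi^j(\hat v^j_n)$, with the same noise in both states of a pair and with every state on level $-1$ equal to $0$.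 Let $$C^{\rm ML}_{n+1}=\sum_{\ell=0}^L\Big(\mathrm{Cov}_{M_\ell}[v^\ell_{n+1}(\omega_{\ell,\cdot})]-\mathrm{Cov}_{M_\ell}[v^{\ell-1}_{n+1}(\omega_{\ell,\cdot})]\Big),\qquad R=C^{\rm ML}_{n+1}H^*,\qquad K^{\rm ML}_{n+1}=R\,\big((HR)_++\Gamma\big)^{-1},$$ where $\mathrm{Cov}_M$ is the unbiased sample covariance and $(HR)_+=\sum_{\lambda_i\ge0}\lambda_iq_iq_i^{\top}$ for the eigenpairs $(\lambda_i,q_i)$ of $HR$. Finally, for both $j\in\{\ell,\ell-1\}$, $$\hat v^j_{n+1}(\omega_{\ell,i})=(I-\mathcal P_jK^{\rm ML}_{n+1}H)v^j_{n+1}(\omega_{\ell,i})+\mathcal P_jK^{\rm ML}_{n+1}(y_{n+1}+\eta^\ell_{n+1,i}).$$ For $\varphi:\mathcal H\to\mathbb R$ put $$\hat\mu^{\rm ML}_n(\varphi)=\frac1{M_0}\sum_{i=1}^{M_0}\varphi(\hat v^0_n(\omega_{0,i}))+\sum_{\ell=1}^L\frac1{M_\ell}\sum_{i=1}^{M_\ell}\big(\varphi(\hat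 v^\ell_n(\omega_{\ell,i}))-\varphi(\hat v^{\ell-1}_n(\omega_{\ell,i}))\big).$$ **Cost.** The cost of MLEnKF is the number of elementary operations: generation of the initial ensemble, evaluation of the maps $\Psi^\ell$ at cost $\mathrm{Cost}(\Psi^\ell)$ each, arithmetic of $\mathcal O(mN_\ell)$ operations per state and time step for observation, sample moments and update, $\mathcal O(m^2N_L+m^3)$ operations per time step for the gain, and the final summation (reading each state once). **Theorem 3.1 (MLEnKF accuracy vs. cost).** Let $\varphi:\mathcal H\to\mathbb R$ be globally Lipschitz and let Assumptions 1 and 2 hold. Fix $\varepsilon_0\in(0,1)$. For $0<\varepsilon\le\varepsilon_0$ let $L=\lceil 2d\log_\kappa(\varepsilon^{-1})/\beta\rceil$ and let the integers $M_\ell\ge2$, $0\le\ell\le L$, satisfy, with constants independent of $\varepsilon$ and $\ell$, $$M_\ell\eqsim\begin{cases}h_\ell^{(\beta+d\gamma)/2}h_L^{-\beta},&\beta>d\gamma,\\ h_\ell^{(\beta+d\gamma)/2}L^2h_L^{-\beta},&\beta=d\gamma,\\ h_\ell^{(\beta+d\gamma)/2}h_L^{-(\beta+d\gamma)/2},&\beta<d\gamma.\end{cases}$$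 Then, with implied constants that do not depend on $\varepsilon$ or on the choice of the $M_\ell$ within these bounds: * $\varphi$ is $\hat{\bar\mu}_n$-integrable for every $n\ge0$, and for all $p\ge2$ and $n\ge0$ $$\|\hat\mu^{\rm ML}_n(\varphi)-\hat{\bar\mu}_n(\varphi)\|_{p}\lesssim|\log\varepsilon|^n\,\varepsilon .$$ * In the linear Gaussian case, where $u_0$ is Gaussian and $\Psi(u)=Au+b$ with $A$ bounded and linear and $b$ a Gaussian noise in $\mathcal H$, $\hat{\bar\mu}_n$ is Gaussian and equals the filtering distribution of $u_n$ given $y_1,\dots,y_n$, that is, the one obtained from the law of $u_0$ by alternately applying the Markov transition of $\Psi$ and reweighting (with normalization) by the likelihood $\exp(-\tfrac12|\Gamma^{-1/2}(y_k-Hu)|^2)$. * If $\gamma\ge1$, the total cost of MLEnKF over the times $0,\dots,n$ satisfies $$\mathrm{Cost(MLEnKF)}\lesssim\begin{cases}\varepsilon^{-2},&\beta>d\gamma,\\ \varepsilon^{-2}|\log\varepsilon|^3,&\beta=d\gamma,\\ \varepsilon^{-2d\gamma/\beta},&\beta<d\gamma.\end{cases}$$ -/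

import Mathlib

open MeasureTheory ProbabilityTheory
open scoped NNReal ENNReal

namespace MLEnKF

/-- The observation space `ℝ^m` with the Euclidean norm. -/
abbrev Obs (m : ℕ) : Type := EuclideanSpace ℝ (Fin m)

/-- `f` and `g` are comparable up to multiplicative constants: `f ≂ g`. -/
def Comparable (f g : ℕ → ℝ) : Prop :=
  ∃ c₁ > 0, ∃ c₂ > 0, ∀ l, c₁ * g l ≤ f l ∧ f l ≤ c₂ * g l

/-- The object one level below `l`, with the convention that it vanishes at level `-1`. -/
def prev {α : Type*} [Zero α] (f : ℕ → α) : ℕ → α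
  | 0 => 0
  | l + 1 => f l

/-- The data of the filtering problem and of its multilevel discretization: state space `𝓗`,
model noise space `Ξ`, observations in `ℝ^m`. A random map `Ψ` on `𝓗` is a jointly measurable
function of the state and of a noise variable with law `ν`, which is drawn independently of the
state. -/
structure FilterModel (𝓗 Ξ : Type*) [NormedAddCommGroup 𝓗] [InnerProductSpace ℝ 𝓗]
    [MeasurableSpace 𝓗] [MeasurableSpace Ξ] (m : ℕ) where
  /-- law of the initial state `u₀` -/
  μ₀ : Measure 𝓗
  isProb_μ₀ : IsProbabilityMeasure μ₀
  /-- law of the model noise of one transition -/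
  ν : Measure Ξ
  isProb_ν : IsProbabilityMeasure ν
  /-- the exact random transition map -/
  Ψ : 𝓗 → Ξ → 𝓗
  measurable_Ψ : Measurable (Function.uncurry Ψ)
  /-- the approximate random transition maps, by level -/
  Ψlev : ℕ → 𝓗 → Ξ → 𝓗
  measurable_Ψlev : ∀ l, Measurable (Function.uncurry (Ψlev l))
  /-- the observation operator `H` -/
  H : 𝓗 →L[ℝ] Obs m
  /-- the covariance of the observation noise -/
  Γ : Matrix (Fin m) (Fin m) ℝ
  posDef_Γ : Γ.PosDef
  /-- the given observations `y n`, `n ≥ 1` (the value `y 0` is never used) -/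
  y : ℕ → Obs m
  /-- the orthonormal basis of `𝓗` -/
  basis : HilbertBasis ℕ ℝ 𝓗
  /-- the dimension of the level `l` space, spanned by the first `N l` basis vectors -/
  N : ℕ → ℕ
  monotone_N : Monotone N

section Moments

variable {𝓗 : Type*} [NormedAddCommGroup 𝓗] [InnerProductSpace ℝ 𝓗]

/-- The sample average `E_M[v]`. -/
noncomputable def sampleMean {F : Type*} [AddCommGroup F] [Module ℝ F] (M : ℕ) (v : ℕ → F) : F :=
  (M : ℝ)⁻¹ • ∑ i ∈ Finset.range M, v i

/-- The unbiased sample covariance `Cov_M[v]`, as an operator on `𝓗`; the tensor `u ⊗ v` is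
identified with the operator `x ↦ ⟪v, x⟫ u`. -/
noncomputable def sampleCov (M : ℕ) (v : ℕ → 𝓗) : 𝓗 →L[ℝ] 𝓗 :=
  ((M : ℝ) / ((M : ℝ) - 1)) •
    (sampleMean M (fun i => InnerProductSpace.rankOne ℝ (v i) (v i)) -
      InnerProductSpace.rankOne ℝ (sampleMean M v) (sampleMean M v))

/-- The covariance operator `E[(v - E v) ⊗ (v - E v)]` of a random variable with law `π`. -/
noncomputable def covOp [MeasurableSpace 𝓗] (π : Measure 𝓗) : 𝓗 →L[ℝ] 𝓗 :=
  ∫ x, InnerProductSpace.rankOne ℝ (x - ∫ z, z ∂π) (x - ∫ z, z ∂π) ∂π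

end Moments

/-- For a symmetric matrix with eigenpairs `(λᵢ, qᵢ)`, the matrix `∑_{λᵢ ≥ 0} λᵢ qᵢ qᵢᵀ`. -/
noncomputable def posPartMatrix {m : ℕ} (A : Matrix (Fin m) (Fin m) ℝ) :
    Matrix (Fin m) (Fin m) ℝ :=
  open Classical in
  if hA : A.IsHermitian then
    ∑ i, (if 0 ≤ hA.eigenvalues i then hA.eigenvalues i else 0) •
      Matrix.vecMulVec (hA.eigenvectorBasis i) (hA.eigenvectorBasis i)
  else 0

namespace FilterModel

variable {𝓗 Ξ : Type*} [NormedAddCommGroup 𝓗] [InnerProductSpace ℝ 𝓗] [CompleteSpace 𝓗]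
  [MeasurableSpace 𝓗] [MeasurableSpace Ξ] {m : ℕ}

/-- The law `N(0, Γ)` of the observation noise. -/
noncomputable def obsNoise (S : FilterModel 𝓗 Ξ m) : Measure (Obs m) :=
  multivariateGaussian 0 S.Γ

/-- The orthogonal projection onto the span of the first `N l` basis vectors. -/
noncomputable def P (S : FilterModel 𝓗 Ξ m) (l : ℕ) : 𝓗 →L[ℝ] 𝓗 :=
  ∑ k ∈ Finset.range (S.N l), InnerProductSpace.rankOne ℝ (S.basis k) (S.basis k)

/-- The `m × m` matrix of `H R` for an operator `R : ℝ^m → 𝓗`. -/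
noncomputable def obsMatrix (S : FilterModel 𝓗 Ξ m) (R : Obs m →L[ℝ] 𝓗) :
    Matrix (Fin m) (Fin m) ℝ :=
  Matrix.of fun i j => S.H (R (EuclideanSpace.single j 1)) i

/-- The operator `R = C H*`. -/
noncomputable def crossCov (S : FilterModel 𝓗 Ξ m) (C : 𝓗 →L[ℝ] 𝓗) : Obs m →L[ℝ] 𝓗 :=
  C ∘L ContinuousLinearMap.adjoint S.H

/-! ### The mean-field EnKF -/

/-- The law of `Ψ(u)` when `u` has law `π` and is independent of the model noise. -/
noncomputable def predictLaw (S : FilterModel 𝓗 Ξ m) (π : Measure 𝓗) : Measure 𝓗 :=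
  (π.prod S.ν).map (fun z => S.Ψ z.1 z.2)

/-- The mean-field Kalman gain `C H* (H C H* + Γ)⁻¹`, where `C` is the covariance of `π`. -/
noncomputable def meanFieldGain (S : FilterModel 𝓗 Ξ m) (π : Measure 𝓗) : Obs m →L[ℝ] 𝓗 :=
  S.crossCov (covOp π) ∘L
    Matrix.toEuclideanCLM (𝕜 := ℝ) (S.obsMatrix (S.crossCov (covOp π)) + S.Γ)⁻¹

/-- The law of `(I - K H) v + K (y + η)`, where `v` has law `π`, `K` is the mean-field gain for
`π`, and `η ~ N(0, Γ)` is independent of `v`. -/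
noncomputable def updateLaw (S : FilterModel 𝓗 Ξ m) (y : Obs m) (π : Measure 𝓗) : Measure 𝓗 :=
  (π.prod S.obsNoise).map fun z =>
    z.1 - S.meanFieldGain π (S.H z.1) + S.meanFieldGain π (y + z.2)

/-- The law of the updated mean-field EnKF process at time `n`. -/
noncomputable def meanFieldLaw (S : FilterModel 𝓗 Ξ m) : ℕ → Measure 𝓗
  | 0 => S.μ₀
  | n + 1 => S.updateLaw (S.y (n + 1)) (S.predictLaw (S.meanFieldLaw n))

/-! ### The filtering distribution and the linear Gaussian case -/

/-- The likelihood `exp(-|Γ^{-1/2} (y - H u)|² / 2)`. -/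
noncomputable def likelihood (S : FilterModel 𝓗 Ξ m) (y : Obs m) (u : 𝓗) : ℝ :=
  Real.exp (-(1 / 2) * inner ℝ (y - S.H u) (Matrix.toEuclideanCLM (𝕜 := ℝ) S.Γ⁻¹ (y - S.H u)))

/-- The filtering distribution of `u_n` given `y 1, …, y n`: the law `μ₀` at time `0`, then
prediction by `Ψ`, reweighting by the likelihood, and normalization. -/
noncomputable def filterLaw (S : FilterModel 𝓗 Ξ m) : ℕ → Measure 𝓗
  | 0 => S.μ₀
  | n + 1 =>
    (∫⁻ u, ENNReal.ofReal (S.likelihood (S.y (n + 1)) u) ∂(S.predictLaw (S.filterLaw n)))⁻¹ •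
      (S.predictLaw (S.filterLaw n)).withDensity
        (fun u => ENNReal.ofReal (S.likelihood (S.y (n + 1)) u))

/-- The linear Gaussian case: `u₀` is Gaussian, and `Ψ(u) = A u + b` with a bounded linear `A` and
a Gaussian random element `b` of `𝓗`. -/
def IsLinearGaussian (S : FilterModel 𝓗 Ξ m) : Prop :=
  IsGaussian S.μ₀ ∧ ∃ (A : 𝓗 →L[ℝ] 𝓗) (b : Ξ → 𝓗),
    IsGaussian (S.ν.map b) ∧ ∀ x, ∀ᵐ ξ ∂S.ν, S.Ψ x ξ = A x + b ξ

/-! ### The multilevel EnKF -/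

/-- The randomness attached to one particle (or coupled pair): its initial state and, for each
transition, one draw of the model noise and one perturbation of the observation. -/
abbrev Noise (𝓗 Ξ : Type*) (m : ℕ) : Type _ := 𝓗 × (ℕ → Ξ × Obs m)

/-- The law of the randomness of one particle: all components are independent, with
`u₀ ~ μ₀`, model noise `~ ν`, observation perturbations `~ N(0, Γ)`. -/
noncomputable def noiseLaw (S : FilterModel 𝓗 Ξ m) : Measure (Noise 𝓗 Ξ m) :=
  S.μ₀.prod (Measure.infinitePi fun _ : ℕ => S.ν.prod S.obsNoise)

/-- The multilevel sample covariance of an ensemble. The entry `v l i` is the pair of the states on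
the levels `l` and `l - 1` of the particle `i` of level `l`. -/
noncomputable def mlCov (L : ℕ) (M : ℕ → ℕ) (v : ℕ → ℕ → 𝓗 × 𝓗) : 𝓗 →L[ℝ] 𝓗 :=
  ∑ l ∈ Finset.range (L + 1),
    (sampleCov (M l) (fun i => (v l i).1) - sampleCov (M l) (fun i => (v l i).2))

/-- The multilevel Kalman gain `R (H R̃ + Γ)⁻¹`, where `R = C H*` for the multilevel sample
covariance `C`, and `H R̃` is the positive semidefinite part of `H R`. -/
noncomputable def mlGain (S : FilterModel 𝓗 Ξ m) (L : ℕ) (M : ℕ → ℕ) (v : ℕ → ℕ → 𝓗 × 𝓗) :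
    Obs m →L[ℝ] 𝓗 :=
  S.crossCov (mlCov L M v) ∘L
    Matrix.toEuclideanCLM (𝕜 := ℝ)
      (posPartMatrix (S.obsMatrix (S.crossCov (mlCov L M v))) + S.Γ)⁻¹

/-- The multilevel prediction: both states of a pair are propagated with the same noise. -/
def mlPredict (S : FilterModel 𝓗 Ξ m) (ξ : ℕ → ℕ → Ξ) (v : ℕ → ℕ → 𝓗 × 𝓗) :
    ℕ → ℕ → 𝓗 × 𝓗 :=
  fun l i => (S.Ψlev l (v l i).1 (ξ l i), prev S.Ψlev l (v l i).2 (ξ l i))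

/-- The update `(I - Q K H) v + Q K ỹ` of one state, with projection `Q` and gain `K`. -/
noncomputable def updateState (S : FilterModel 𝓗 Ξ m) (Q : 𝓗 →L[ℝ] 𝓗) (K : Obs m →L[ℝ] 𝓗)
    (ytilde : Obs m) (v : 𝓗) : 𝓗 :=
  v - Q (K (S.H v)) + Q (K ytilde)

/-- The multilevel update: both states of a pair use the same perturbed observation. -/
noncomputable def mlUpdate (S : FilterModel 𝓗 Ξ m) (K : Obs m →L[ℝ] 𝓗) (y : Obs m)
    (η : ℕ → ℕ → Obs m) (v : ℕ → ℕ → 𝓗 × 𝓗) : ℕ → ℕ → 𝓗 × 𝓗 :=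
  fun l i => (S.updateState (S.P l) K (y + η l i) (v l i).1,
    S.updateState (prev S.P l) K (y + η l i) (v l i).2)

/-- The updated multilevel ensemble at time `n`, as a function of the randomness `w l i` of the
particle `i` on level `l`. Only the levels `l ≤ L` and the particles `i < M l` are used. -/
noncomputable def ensemble (S : FilterModel 𝓗 Ξ m) (L : ℕ) (M : ℕ → ℕ)
    (w : ℕ → ℕ → Noise 𝓗 Ξ m) : ℕ → ℕ → ℕ → 𝓗 × 𝓗
  | 0 => fun l i => (S.P l (w l i).1, prev S.P l (w l i).1)
  | n + 1 =>
    let v := S.mlPredict (fun l i => ((w l i).2 n).1) (S.ensemble L M w n)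
    S.mlUpdate (S.mlGain L M v) (S.y (n + 1)) (fun l i => ((w l i).2 n).2) v

/-- The multilevel estimator `μ̂ₙᴹᴸ(φ)`: the integral of `φ` against the signed multilevel
empirical measure of the ensemble. -/
noncomputable def mlEstimator (S : FilterModel 𝓗 Ξ m) (L : ℕ) (M : ℕ → ℕ) (n : ℕ) (φ : 𝓗 → ℝ)
    (w : ℕ → ℕ → Noise 𝓗 Ξ m) : ℝ :=
  ∑ l ∈ Finset.range (L + 1), sampleMean (M l) fun i =>
    φ (S.ensemble L M w n l i).1 - (if l = 0 then 0 else φ (S.ensemble L M w n l i).2)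

/-! ### Computational cost

Operation counts. A state on level `l` is stored through its `N l` coefficients; an arithmetic
operation on real numbers and a draw of a real random number have cost `1`; one evaluation of
`Ψlev l` has cost `costΨ l`. The operator `R : ℝ^m → 𝓗` is stored through `m` coefficient
vectors, and the full covariance is never formed. -/

/-- The cost of moving one state with `N` coefficients through one transition, when its forward map
costs `c`: forward map, observation `H v` (`2 m N`), its share of the sample means of `v` and `H v`
and centering (`2 (N + m)`), its share of the cross covariance of `v` and `H v` (`2 m N`),
innovation (`m`), product with the projected gain (`2 m N`), and correction (`N`). -/
def stateCost (m N : ℕ) (c : ℝ) : ℝ :=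
  c + 2 * m * N + 2 * (N + m) + 2 * m * N + m + 2 * m * N + N

/-- The cost of scaling the sample moments of one family of states with `N` coefficients and adding
them to the multilevel sum. -/
def accumulateCost (m N : ℕ) : ℝ := N + m + 2 * m * N

/-- The one-time cost of a gain on `N` coefficients: `H R` (`2 m² N`), addition of `Γ` (`m²`),
dense linear algebra for the eigenvalue decomposition, its truncation and the inverse (`m³` each),
and the product `R (H R̃ + Γ)⁻¹` (`2 m² N`). -/
def gainCost (m N : ℕ) : ℝ := 2 * m ^ 2 * N + m ^ 2 + 3 * m ^ 3 + 2 * m ^ 2 * N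

/-- The cost of one predict-update transition of the multilevel ensemble; drawing and adding the
perturbations of the observation costs `2 m` for each pair. -/
noncomputable def transitionCost (S : FilterModel 𝓗 Ξ m) (costΨ : ℕ → ℝ) (L : ℕ) (M : ℕ → ℕ) : ℝ :=
  (∑ l ∈ Finset.range (L + 1),
    ((M l : ℝ) * (2 * m + stateCost m (S.N l) (costΨ l)
        + stateCost m (prev S.N l) (prev costΨ l))
      + (accumulateCost m (S.N l) + accumulateCost m (prev S.N l))))
  + gainCost m (S.N L)

/-- The total cost of the multilevel estimator at time `n`: generation of the initial ensemble,
`n` transitions, and the final summation over the ensemble (each state is read once). -/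
noncomputable def mlCost (S : FilterModel 𝓗 Ξ m) (costΨ : ℕ → ℝ) (L : ℕ) (M : ℕ → ℕ) (n : ℕ) : ℝ :=
  (∑ l ∈ Finset.range (L + 1), (M l : ℝ) * (S.N l + prev S.N l))
  + n * S.transitionCost costΨ L M
  + ∑ l ∈ Finset.range (L + 1), ((M l : ℝ) * (S.N l + prev S.N l + 2) + 2)

/-! ### Assumptions -/

variable {Ω : Type*} [MeasurableSpace Ω]

/-- Stability of the solvers, uniformly over the levels. Since `u` and `v` live on `Ω` and the model
noise is the second coordinate of `Ω × Ξ`, they are independent of the noise. -/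
structure SolverBounds (S : FilterModel 𝓗 Ξ m) (Pr : Measure Ω) : Prop where
  bounds : ∀ p : ℝ, 2 ≤ p → ∃ c : ℝ≥0,
    (∀ (l : ℕ) (u v : Ω → 𝓗), MemLp u (ENNReal.ofReal p) Pr → MemLp v (ENNReal.ofReal p) Pr →
      eLpNorm (fun z : Ω × Ξ => S.Ψlev l (u z.1) z.2 - S.Ψlev l (v z.1) z.2)
          (ENNReal.ofReal p) (Pr.prod S.ν)
        ≤ c * eLpNorm (fun ω => u ω - v ω) (ENNReal.ofReal p) Pr) ∧
    (∀ (l : ℕ) (u : Ω → 𝓗), MemLp u (ENNReal.ofReal p) Pr →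
      eLpNorm (fun z : Ω × Ξ => S.Ψlev l (u z.1) z.2) (ENNReal.ofReal p) (Pr.prod S.ν) ^ p
        ≤ c * (1 + eLpNorm u (ENNReal.ofReal p) Pr ^ p))

/-- The multilevel rates, with resolution `h l` and cost `costΨ l` of one evaluation of `Ψlev l`.
-/
structure MultilevelRates (S : FilterModel 𝓗 Ξ m) (Pr : Measure Ω) (h costΨ : ℕ → ℝ)
    (d : ℕ) (κ β γ : ℝ) : Prop where
  initial_memLp : ∀ p : ℝ, 2 ≤ p → MemLp (fun x : 𝓗 => x) (ENNReal.ofReal p) S.μ₀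
  dim_growth : Comparable (fun l => (S.N l : ℝ)) (fun l => κ ^ l)
  resolution : Comparable h (fun l => (S.N l : ℝ) ^ (-(1 / (d : ℝ))))
  /-- the solver on level `l` takes its values in the space of level `l` -/
  range_Ψlev : ∀ l x, ∀ᵐ ξ ∂S.ν, S.P l (S.Ψlev l x ξ) = S.Ψlev l x ξ
  solver_rate : ∀ p : ℝ, 2 ≤ p → ∀ u : Ω → 𝓗, MemLp u (ENNReal.ofReal p) Pr → ∃ C : ℝ, ∀ l,
    eLpNorm (fun z : Ω × Ξ => S.Ψlev l (u z.1) z.2 - S.Ψ (u z.1) z.2)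
      (ENNReal.ofReal p) (Pr.prod S.ν) ≤ ENNReal.ofReal (C * h l ^ (β / 2))
  initial_rate : ∀ p : ℝ, 2 ≤ p → ∃ C : ℝ, ∀ l,
    eLpNorm (fun x : 𝓗 => x - S.P l x) (ENNReal.ofReal p) S.μ₀ ≤ ENNReal.ofReal (C * h l ^ (β / 2))
  cost_rate : ∃ C : ℝ, ∀ l, costΨ l ≤ C * h l ^ (-((d : ℝ) * γ))

end FilterModel

/-! ### The choice of the parameters -/

/-- The finest level `L = ⌈2 d log_κ(ε⁻¹) / β⌉`. -/
noncomputable def finestLevel (d : ℕ) (κ β ε : ℝ) : ℕ :=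
  ⌈2 * (d : ℝ) * Real.logb κ ε⁻¹ / β⌉₊

/-- The prescribed order of magnitude of the sample size on level `l`. -/
noncomputable def sampleRate (h : ℕ → ℝ) (d : ℕ) (β γ : ℝ) (L l : ℕ) : ℝ :=
  if (d : ℝ) * γ < β then h l ^ ((β + d * γ) / 2) * h L ^ (-β)
  else if β = d * γ then h l ^ ((β + d * γ) / 2) * (L : ℝ) ^ 2 * h L ^ (-β)
  else h l ^ ((β + d * γ) / 2) * h L ^ (-((β + d * γ) / 2))

/-- The sample sizes are of the prescribed order with constants `c₁, c₂`, and at least two, so that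
the unbiased sample covariances are defined. -/
def AdmissibleSizes (h : ℕ → ℝ) (d : ℕ) (β γ c₁ c₂ : ℝ) (L : ℕ) (M : ℕ → ℕ) : Prop :=
  ∀ l ≤ L, 2 ≤ M l ∧ c₁ * sampleRate h d β γ L l ≤ M l ∧ M l ≤ c₂ * sampleRate h d β γ L l

/-- The bound on the total cost as a function of the accuracy. -/
noncomputable def costRate (d : ℕ) (β γ ε : ℝ) : ℝ :=
  if (d : ℝ) * γ < β then ε ^ (-2 : ℝ)
  else if β = d * γ then ε ^ (-2 : ℝ) * |Real.log ε| ^ 3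
  else ε ^ (-(2 * d * γ / β))

end MLEnKF

/-! The multilevel ensemble is compared with particles driven by the same noise but updated with the
deterministic mean-field gains (`particle`). For each level these particles are i.i.d. in the
particle index, and the limiting particle (exact map `Ψ`, no projection) has exactly the mean-field
law. With s = κ^(-1/d), so that h_l is comparable to s^l, and r = s^(β/2), stability and consistency
of the solvers place the level l particle within O(r^l) of the limiting one in every L^p
(`exists_particle_sub_le`). The two members of a coupled pair therefore also differ by O(r^l), and
the usual multilevel Monte Carlo analysis applies to the i.i.d. system: the fluctuation is of order
∑ r^l / √(M l) and the bias of order r^L. The choice of `M` and `L` makes both O(ε).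

It remains to compare the interacting ensemble with the i.i.d. one. Let D_n be the distance at time
n. Prediction multiplies it by a stability constant. The multilevel covariance inherits the ensemble
error once per level, plus fluctuation and bias (`EnsembleClose.exists_mlCov_sub_le`, resting on
`exists_sampleCov_sub_sub_le`). The gain is Lipschitz at the mean-field cross covariance
(`exists_norm_symGain_sub_le`), because the positive part is nonexpansive in the Frobenius norm and
inverses of A + Γ are uniformly bounded for A ≥ 0. Hence D_0 = 0 and D_{n+1} ≲ (L+1) D_n + ε
(`ensembleClose_particlePair`). Summing φ over the levels costs one more factor L+1, and L+1 ≲ |log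
ε| gives |log ε|^n ε (`exists_mlEstimator_sub_le`). Products are handled by Hölder's inequality with
doubled exponents, so the induction runs over all p simultaneously.

In the linear Gaussian case the Kalman gain K is exactly the operator for which v - K(Hv - η) is
uncorrelated with, hence independent of, Hv - η. Conditioning v on Hv - η = y thus gives the law of
the residual shifted by K y, which is the mean-field update, while disintegrating the joint law
gives Bayes' formula (`updateLaw_eq_reweight`).

For the cost, γ ≥ 1 makes all arithmetic on a level no dearer than the order h_l^(-dγ), and the
remaining sum over levels is geometric, or constant in l in the critical case (`exists_mlCost_le`,
`exists_work_le`). -/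

set_option linter.unusedSectionVars false

namespace MLEnKF

/-! ### Quantitative `L^p` bounds -/

/-- `f` is almost everywhere strongly measurable with `L^p` norm at most `B`. -/
structure LpLE {α E : Type*} [MeasurableSpace α] [NormedAddCommGroup E] (μ : Measure α) (p : ℝ)
    (f : α → E) (B : ℝ) : Prop where
  nonneg : 0 ≤ B
  aesm : AEStronglyMeasurable f μ
  le : eLpNorm f (ENNReal.ofReal p) μ ≤ ENNReal.ofReal B

namespace LpLE

variable {α α' E F G : Type*} [MeasurableSpace α] [MeasurableSpace α'] [NormedAddCommGroup E]
  [NormedAddCommGroup F] [NormedAddCommGroup G] {μ : Measure α} {ν : Measure α'}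
  {p q A B : ℝ} {f g : α → E}

lemma memLp (h : LpLE μ p f B) : MemLp f (ENNReal.ofReal p) μ :=
  ⟨h.aesm, h.le.trans_lt ENNReal.ofReal_lt_top⟩

lemma mono (h : LpLE μ p f A) (hAB : A ≤ B) : LpLE μ p f B :=
  ⟨h.nonneg.trans hAB, h.aesm, h.le.trans (ENNReal.ofReal_le_ofReal hAB)⟩

lemma _root_.MeasureTheory.MemLp.exists_lpLE (h : MemLp f (ENNReal.ofReal p) μ) :
    ∃ B, LpLE μ p f B :=
  ⟨(eLpNorm f (ENNReal.ofReal p) μ).toReal, ENNReal.toReal_nonneg, h.1,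
    (ENNReal.ofReal_toReal h.2.ne).ge⟩

lemma add (hp : 1 ≤ p) (hf : LpLE μ p f A) (hg : LpLE μ p g B) :
    LpLE μ p (fun x => f x + g x) (A + B) :=
  ⟨add_nonneg hf.nonneg hg.nonneg, hf.aesm.add hg.aesm,
    (eLpNorm_add_le hf.aesm hg.aesm (by simpa using hp)).trans (by
      rw [ENNReal.ofReal_add hf.nonneg hg.nonneg]; exact add_le_add hf.le hg.le)⟩

lemma neg (hf : LpLE μ p f A) : LpLE μ p (fun x => -f x) A :=
  ⟨hf.nonneg, hf.aesm.neg, by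
    have := eLpNorm_neg f (ENNReal.ofReal p) μ
    exact (le_of_eq this).trans hf.le⟩

lemma sub (hp : 1 ≤ p) (hf : LpLE μ p f A) (hg : LpLE μ p g B) :
    LpLE μ p (fun x => f x - g x) (A + B) := by
  simpa [sub_eq_add_neg] using hf.add hp hg.neg

lemma zero : LpLE μ p (fun _ => (0 : E)) 0 :=
  ⟨le_rfl, aestronglyMeasurable_const, by simp⟩

lemma sum {ι : Type*} (hp : 1 ≤ p) (s : Finset ι) {f : ι → α → E} {B : ι → ℝ}
    (h : ∀ i ∈ s, LpLE μ p (f i) (B i)) :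
    LpLE μ p (fun x => ∑ i ∈ s, f i x) (∑ i ∈ s, B i) := by
  classical
  induction s using Finset.induction_on with
  | empty => simpa using zero
  | insert i s hi ih =>
    simp only [Finset.sum_insert hi]
    exact (h i (by simp)).add hp (ih fun j hj => h j (by simp [hj]))

lemma congr (hf : LpLE μ p f A) (h : f =ᵐ[μ] g) : LpLE μ p g A :=
  ⟨hf.nonneg, hf.aesm.congr h, (eLpNorm_congr_ae h).ge.trans hf.le⟩

lemma of_norm_le {f : α → E} {g : α → F} (hg : LpLE μ p g A) (hf : AEStronglyMeasurable f μ)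
    (h : ∀ x, ‖f x‖ ≤ ‖g x‖) : LpLE μ p f A :=
  ⟨hg.nonneg, hf, (eLpNorm_mono h).trans hg.le⟩

lemma norm (hf : LpLE μ p f A) : LpLE μ p (fun x => ‖f x‖) A :=
  hf.of_norm_le hf.aesm.norm fun x => by simp

lemma of_norm_le_mul {f : α → E} {g : α → F} {c : ℝ} (hg : LpLE μ p g A)
    (hf : AEStronglyMeasurable f μ) (h : ∀ x, ‖f x‖ ≤ c * ‖g x‖) (hc : 0 ≤ c) :
    LpLE μ p f (c * A) := by
  refine ⟨mul_nonneg hc hg.nonneg, hf, ?_⟩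
  rw [ENNReal.ofReal_mul hc]
  exact (eLpNorm_le_mul_eLpNorm_of_ae_le_mul (ae_of_all _ h) _).trans (by gcongr; exact hg.le)

lemma const_smul [NormedSpace ℝ E] (c : ℝ) (hf : LpLE μ p f A) :
    LpLE μ p (fun x => c • f x) (|c| * A) :=
  hf.of_norm_le_mul (hf.aesm.const_smul c) (fun x => by simp [norm_smul]) (abs_nonneg c)

lemma clm [NormedSpace ℝ E] [NormedSpace ℝ F] (T : E →L[ℝ] F) (hf : LpLE μ p f A) :
    LpLE μ p (fun x => T (f x)) (‖T‖ * A) :=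
  hf.of_norm_le_mul (T.continuous.comp_aestronglyMeasurable hf.aesm) (fun _ => T.le_opNorm _)
    (norm_nonneg T)

lemma mono_exp [IsProbabilityMeasure μ] (hf : LpLE μ q f A) (h : p ≤ q) : LpLE μ p f A :=
  ⟨hf.nonneg, hf.aesm,
    (eLpNorm_le_eLpNorm_of_exponent_le (ENNReal.ofReal_le_ofReal h) hf.aesm).trans hf.le⟩

lemma const [IsProbabilityMeasure μ] (hp : 0 < p) (c : E) : LpLE μ p (fun _ => c) ‖c‖ := by
  refine ⟨norm_nonneg c, aestronglyMeasurable_const, ?_⟩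
  rw [eLpNorm_const _ (by simpa using hp) (IsProbabilityMeasure.ne_zero μ)]
  simp

/-- Hölder's inequality with 1/p = 1/(2p) + 1/(2p). The doubling of the exponent is harmless as long
as the factors are controlled in every L^p. -/
lemma mul {F' : α → G} {f : α → E} {g : α → F} (hf : LpLE μ (2 * p) f A)
    (hg : LpLE μ (2 * p) g B) (hF : AEStronglyMeasurable F' μ)
    (h : ∀ x, ‖F' x‖ ≤ ‖f x‖ * ‖g x‖) : LpLE μ p F' (A * B) := by
  refine ⟨mul_nonneg hf.nonneg hg.nonneg, hF, ?_⟩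
  have hH : ENNReal.HolderTriple (ENNReal.ofReal (2 * p)) (ENNReal.ofReal (2 * p))
      (ENNReal.ofReal p) := by
    refine ⟨?_⟩
    rw [← two_mul, ENNReal.ofReal_mul (by norm_num), ENNReal.mul_inv (by simp) (by simp),
      ← mul_assoc]
    simp [ENNReal.mul_inv_cancel]
  have h1 := eLpNorm_le_eLpNorm_mul_eLpNorm'_of_norm (p := ENNReal.ofReal (2 * p))
    (q := ENNReal.ofReal (2 * p)) (r := ENNReal.ofReal p) hf.aesm.norm hg.aesm.norm
    (fun a b : ℝ => a * b) 1 (ae_of_all _ fun x => by simp)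
  have h2 : eLpNorm F' (ENNReal.ofReal p) μ ≤
      eLpNorm (fun x => ‖f x‖ * ‖g x‖) (ENNReal.ofReal p) μ :=
    eLpNorm_mono fun x => (h x).trans (by simp)
  refine h2.trans (h1.trans ?_)
  rw [ENNReal.ofReal_mul hf.nonneg, eLpNorm_norm, eLpNorm_norm]
  simpa using mul_le_mul' hf.le hg.le

lemma comp {T : α → α'} {f : α' → E} (hT : MeasurePreserving T μ ν) (hf : LpLE ν p f A) :
    LpLE μ p (fun x => f (T x)) A :=
  ⟨hf.nonneg, hf.aesm.comp_measurePreserving hT,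
    (eLpNorm_comp_measurePreserving hf.aesm hT).le.trans hf.le⟩

lemma of_comp {T : α → α'} {f : α' → E} (hT : MeasurePreserving T μ ν)
    (hfm : AEStronglyMeasurable f ν) (hf : LpLE μ p (fun x => f (T x)) A) : LpLE ν p f A :=
  ⟨hf.nonneg, hfm, (eLpNorm_comp_measurePreserving hfm hT).ge.trans hf.le⟩

lemma integrable [IsProbabilityMeasure μ] (hp : 1 ≤ p) (hf : LpLE μ p f A) : Integrable f μ :=
  hf.memLp.integrable (by simpa using hp)

lemma integral_norm_le [IsProbabilityMeasure μ] (hp : 1 ≤ p) (hf : LpLE μ p f A) :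
    ∫ x, ‖f x‖ ∂μ ≤ A := by
  have h1 := (hf.mono_exp hp).le
  rw [ENNReal.ofReal_one, eLpNorm_one_eq_lintegral_enorm] at h1
  rw [integral_norm_eq_lintegral_enorm hf.aesm]
  exact ENNReal.toReal_le_of_le_ofReal hf.nonneg h1

lemma norm_integral_le [IsProbabilityMeasure μ] [NormedSpace ℝ E] (hp : 1 ≤ p)
    (hf : LpLE μ p f A) : ‖∫ x, f x ∂μ‖ ≤ A :=
  (norm_integral_le_integral_norm f).trans (hf.integral_norm_le hp)

/-- Bounds of even order in terms of moments. -/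
lemma of_integral_pow_le {k : ℕ} (hk : 0 < k) (hf : AEStronglyMeasurable f μ)
    (hi : Integrable (fun x => ‖f x‖ ^ (2 * k)) μ) (hB : 0 ≤ B)
    (h : ∫ x, ‖f x‖ ^ (2 * k) ∂μ ≤ B ^ (2 * k)) : LpLE μ (2 * k : ℕ) f B := by
  have h0 : (ENNReal.ofReal ((2 * k : ℕ) : ℝ)) ≠ 0 := by
    simp; omega
  have hr : (ENNReal.ofReal ((2 * k : ℕ) : ℝ)).toReal = ((2 * k : ℕ) : ℝ) :=
    ENNReal.toReal_ofReal (by positivity)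
  have hm : MemLp f (ENNReal.ofReal ((2 * k : ℕ) : ℝ)) μ := by
    refine (integrable_norm_rpow_iff hf h0 ENNReal.ofReal_ne_top).1 ?_
    rw [hr]
    simpa only [Real.rpow_natCast] using hi
  refine ⟨hB, hf, ?_⟩
  rw [hm.eLpNorm_eq_integral_rpow_norm h0 ENNReal.ofReal_ne_top, hr]
  refine ENNReal.ofReal_le_ofReal ?_
  simp only [Real.rpow_natCast]
  calc (∫ x, ‖f x‖ ^ (2 * k) ∂μ) ^ (((2 * k : ℕ) : ℝ))⁻¹
      ≤ (B ^ (2 * k)) ^ (((2 * k : ℕ) : ℝ))⁻¹ := by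
        refine Real.rpow_le_rpow (integral_nonneg fun x => by positivity) h (by positivity)
    _ = B := Real.pow_rpow_inv_natCast hB (by omega)

lemma integrable_pow {k : ℕ} (hk : 0 < k) (hf : LpLE μ (k : ℝ) f A) :
    Integrable (fun x => ‖f x‖ ^ k) μ := by
  have := (integrable_norm_rpow_iff hf.aesm (by simpa using hk.ne') ENNReal.ofReal_ne_top).2 hf.memLp
  rw [ENNReal.toReal_ofReal (by positivity)] at this
  simpa only [Real.rpow_natCast] using this

lemma integral_pow_le {k : ℕ} (hk : 0 < k) (hf : LpLE μ (k : ℝ) f A) :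
    ∫ x, ‖f x‖ ^ k ∂μ ≤ A ^ k := by
  have h1 := hf.le
  rw [hf.memLp.eLpNorm_eq_integral_rpow_norm (by simpa using hk.ne') ENNReal.ofReal_ne_top,
    ENNReal.toReal_ofReal (by positivity), ENNReal.ofReal_le_ofReal_iff hf.nonneg] at h1
  simp only [Real.rpow_natCast] at h1
  have h2 := pow_le_pow_left₀ (Real.rpow_nonneg (integral_nonneg fun x => by positivity) _) h1 k
  rwa [Real.rpow_inv_natCast_pow (integral_nonneg fun x => by positivity) hk.ne'] at h2

end LpLE

end MLEnKF

namespace MLEnKF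

/-! ### The positive part of a symmetric matrix -/

section PosPart

open Matrix

variable {m : ℕ} {A B : Matrix (Fin m) (Fin m) ℝ}

/-- The Frobenius inner product. -/
def frob (A B : Matrix (Fin m) (Fin m) ℝ) : ℝ := ∑ i, ∑ j, A i j * B i j

lemma frob_comm (A B : Matrix (Fin m) (Fin m) ℝ) : frob A B = frob B A := by
  simp [frob, mul_comm]

lemma frob_sub_left (A B C : Matrix (Fin m) (Fin m) ℝ) :
    frob (A - B) C = frob A C - frob B C := by
  simp [frob, sub_mul]

lemma frob_sub_right (A B C : Matrix (Fin m) (Fin m) ℝ) :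
    frob A (B - C) = frob A B - frob A C := by
  simp [frob, mul_sub]

lemma frob_self_nonneg (A : Matrix (Fin m) (Fin m) ℝ) : 0 ≤ frob A A :=
  Finset.sum_nonneg fun _ _ => Finset.sum_nonneg fun _ _ => mul_self_nonneg _

lemma frob_sq_le (A B : Matrix (Fin m) (Fin m) ℝ) : frob A B ^ 2 ≤ frob A A * frob B B := by
  have := Finset.sum_mul_sq_le_sq_mul_sq (Finset.univ : Finset (Fin m × Fin m))
    (fun q => A q.1 q.2) (fun q => B q.1 q.2)
  simpa [Fintype.sum_prod_type, frob, sq] using this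

/-- The combination of the eigenprojections of a symmetric matrix with coefficients `c`. -/
noncomputable def spectralSum (hA : A.IsHermitian) (c : Fin m → ℝ) : Matrix (Fin m) (Fin m) ℝ :=
  ∑ i, c i • Matrix.vecMulVec (hA.eigenvectorBasis i) (hA.eigenvectorBasis i)

lemma spectralSum_apply (hA : A.IsHermitian) (c : Fin m → ℝ) (i j : Fin m) :
    spectralSum hA c i j = ∑ k, c k * (hA.eigenvectorBasis k i * hA.eigenvectorBasis k j) := by
  simp [spectralSum, Matrix.sum_apply, vecMulVec_apply]

lemma spectralSum_eigenvalues (hA : A.IsHermitian) : spectralSum hA hA.eigenvalues = A := by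
  ext i j
  rw [spectralSum_apply]
  conv_rhs => rw [hA.spectral_theorem]
  simp only [Unitary.conjStarAlgAut_apply, Matrix.mul_apply, Matrix.diagonal_apply, mul_ite,
    mul_zero, Finset.sum_ite_eq', Finset.mem_univ, if_true, Matrix.star_apply,
    Matrix.IsHermitian.eigenvectorUnitary_apply, Function.comp]
  refine Finset.sum_congr rfl fun k _ => ?_
  simp
  ring

lemma frob_spectralSum (hA : A.IsHermitian) (c : Fin m → ℝ) (B : Matrix (Fin m) (Fin m) ℝ) :
    frob (spectralSum hA c) B
      = ∑ k, c k * (hA.eigenvectorBasis k ⬝ᵥ B *ᵥ hA.eigenvectorBasis k) := by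
  simp only [frob, spectralSum_apply, dotProduct, mulVec, Finset.sum_mul, Finset.mul_sum]
  rw [Finset.sum_comm' (t' := Finset.univ) (s' := fun _ => Finset.univ) (by simp)]
  refine (Finset.sum_congr rfl fun j _ => Finset.sum_comm).trans ?_
  rw [Finset.sum_comm]
  refine Finset.sum_congr rfl fun k _ => ?_
  rw [Finset.sum_comm]
  refine Finset.sum_congr rfl fun i _ => Finset.sum_congr rfl fun j _ => ?_
  ring

lemma spectralSum_mulVec (hA : A.IsHermitian) (c : Fin m → ℝ) (k : Fin m) :
    spectralSum hA c *ᵥ hA.eigenvectorBasis k = c k • (hA.eigenvectorBasis k : Fin m → ℝ) := by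
  have ho : ∀ l, (hA.eigenvectorBasis l : Fin m → ℝ) ⬝ᵥ hA.eigenvectorBasis k
      = if k = l then 1 else 0 := by
    intro l
    have := orthonormal_iff_ite.1 hA.eigenvectorBasis.orthonormal k l
    simpa [EuclideanSpace.inner_eq_star_dotProduct] using this
  ext i
  simp only [mulVec, dotProduct, spectralSum_apply, Finset.sum_mul, Pi.smul_apply, smul_eq_mul]
  rw [Finset.sum_comm]
  have : ∀ l, ∑ x, c l * (hA.eigenvectorBasis l i * hA.eigenvectorBasis l x)
        * hA.eigenvectorBasis k x
      = c l * hA.eigenvectorBasis l i * (if k = l then 1 else 0) := by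
    intro l
    rw [← ho l, dotProduct, Finset.mul_sum]
    exact Finset.sum_congr rfl fun x _ => by ring
  simp [this]

lemma posSemidef_spectralSum (hA : A.IsHermitian) {c : Fin m → ℝ} (hc : ∀ k, 0 ≤ c k) :
    (spectralSum hA c).PosSemidef :=
  posSemidef_sum _ fun k _ => by
    have := posSemidef_vecMulVec_self_star (hA.eigenvectorBasis k : Fin m → ℝ)
    simpa using this.smul (hc k)

/-- Expanded in eigenprojections, the Frobenius product becomes a nonnegative combination of values
of the quadratic form of `B`. -/
lemma frob_nonneg_of_posSemidef (hA : A.IsHermitian) {c : Fin m → ℝ} (hc : ∀ k, 0 ≤ c k)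
    (hB : B.PosSemidef) : 0 ≤ frob (spectralSum hA c) B := by
  rw [frob_spectralSum]
  refine Finset.sum_nonneg fun k _ => mul_nonneg (hc k) ?_
  simpa using hB.dotProduct_mulVec_nonneg (hA.eigenvectorBasis k)

lemma posPartMatrix_eq (hA : A.IsHermitian) :
    posPartMatrix A = spectralSum hA (fun i => max (hA.eigenvalues i) 0) := by
  rw [posPartMatrix, dif_pos hA, spectralSum]
  refine Finset.sum_congr rfl fun i _ => ?_
  congr 1
  split_ifs with h
  · rw [max_eq_left h]
  · rw [max_eq_right (not_le.1 h).le]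

lemma posSemidef_posPartMatrix (A : Matrix (Fin m) (Fin m) ℝ) : (posPartMatrix A).PosSemidef := by
  by_cases hA : A.IsHermitian
  · rw [posPartMatrix_eq hA]
    exact posSemidef_spectralSum hA fun _ => le_max_right _ _
  · rw [posPartMatrix, dif_neg hA]
    exact PosSemidef.zero

lemma posPartMatrix_of_posSemidef (hA : A.PosSemidef) : posPartMatrix A = A := by
  rw [posPartMatrix_eq hA.isHermitian]
  conv_rhs => rw [← spectralSum_eigenvalues hA.isHermitian]
  congr 1
  ext i
  exact max_eq_left (hA.eigenvalues_nonneg i)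

/-- The negative part of a symmetric matrix. -/
noncomputable def negPart (hA : A.IsHermitian) : Matrix (Fin m) (Fin m) ℝ :=
  spectralSum hA (fun i => max (-hA.eigenvalues i) 0)

lemma posPart_sub_negPart (hA : A.IsHermitian) : posPartMatrix A - negPart hA = A := by
  conv_rhs => rw [← spectralSum_eigenvalues hA]
  rw [posPartMatrix_eq hA, negPart]
  ext i j
  simp only [Matrix.sub_apply, spectralSum_apply, ← Finset.sum_sub_distrib, ← sub_mul]
  refine Finset.sum_congr rfl fun k _ => ?_
  congr 1
  rcases le_total (hA.eigenvalues k) 0 with h | h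
  · rw [max_eq_right h, max_eq_left (neg_nonneg.2 h)]; ring
  · rw [max_eq_left h, max_eq_right (neg_nonpos.2 h)]; ring

lemma frob_posPart_negPart (hA : A.IsHermitian) : frob (posPartMatrix A) (negPart hA) = 0 := by
  rw [posPartMatrix_eq hA, frob_spectralSum]
  refine Finset.sum_eq_zero fun k _ => ?_
  rw [negPart, spectralSum_mulVec, dotProduct_smul, smul_eq_mul, ← mul_assoc]
  rcases le_total (hA.eigenvalues k) 0 with h | h
  · rw [max_eq_right h]; ring
  · rw [max_eq_right (neg_nonpos.2 h)]; ring

/-- The positive part is nonexpansive for the Frobenius norm. -/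
lemma frob_posPart_sub_le (hA : A.IsHermitian) (hB : B.IsHermitian) :
    frob (posPartMatrix A - posPartMatrix B) (posPartMatrix A - posPartMatrix B)
      ≤ frob (A - B) (A - B) := by
  set P := posPartMatrix A
  set Q := posPartMatrix B
  -- The variational inequality for projection onto a convex cone. With A = P - A₋ and B = Q - B₋,
  -- orthogonality kills ⟨A₋, P⟩ and ⟨B₋, Q⟩, while ⟨A₋, Q⟩ and ⟨B₋, P⟩ are nonnegative, so ⟨A₋ -
  -- B₋, P - Q⟩ ≤ 0. Cauchy–Schwarz then finishes.
  have h1 : frob (P - Q) (P - Q) ≤ frob (A - B) (P - Q) := by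
    have hPA : 0 ≤ frob (negPart hA) Q :=
      frob_nonneg_of_posSemidef hA (fun _ => le_max_right _ _) (posSemidef_posPartMatrix B)
    have hPB : 0 ≤ frob (negPart hB) P :=
      frob_nonneg_of_posSemidef hB (fun _ => le_max_right _ _) (posSemidef_posPartMatrix A)
    have h1 : frob (negPart hA) P = 0 := by rw [frob_comm]; exact frob_posPart_negPart hA
    have h2 : frob (negPart hB) Q = 0 := by rw [frob_comm]; exact frob_posPart_negPart hB
    have h3 : A - B = (P - Q) - (negPart hA - negPart hB) := by
      conv_lhs => rw [← posPart_sub_negPart hA, ← posPart_sub_negPart hB]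
      abel
    rw [h3, frob_sub_left (P - Q), frob_sub_left (negPart hA), frob_sub_right (negPart hA),
      frob_sub_right (negPart hB)]
    linarith
  have h2 := frob_sq_le (A - B) (P - Q)
  have h3 := frob_self_nonneg (P - Q)
  have h4 := frob_self_nonneg (A - B)
  nlinarith

lemma norm_toEuclideanCLM_le (A : Matrix (Fin m) (Fin m) ℝ) :
    ‖Matrix.toEuclideanCLM (𝕜 := ℝ) A‖ ≤ √(frob A A) := by
  refine ContinuousLinearMap.opNorm_le_bound _ (Real.sqrt_nonneg _) fun x => ?_
  rw [EuclideanSpace.norm_eq, EuclideanSpace.norm_eq, ← Real.sqrt_mul (frob_self_nonneg A)]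
  refine Real.sqrt_le_sqrt ?_
  simp only [ofLp_toEuclideanCLM, Real.norm_eq_abs, sq_abs, mulVec, dotProduct]
  rw [frob, Finset.sum_mul]
  refine Finset.sum_le_sum fun i _ => ?_
  simpa [sq] using Finset.sum_mul_sq_le_sq_mul_sq Finset.univ (A i) x

end PosPart

/-! ### Coercivity of Γ and uniform bounds for inverses. -/

section Inverse

open Matrix
open scoped MatrixOrder

variable {m : ℕ} {Γ : Matrix (Fin m) (Fin m) ℝ}

lemma isUnit_sqrt (hΓ : Γ.PosDef) : IsUnit (CFC.sqrt Γ) := by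
  have h := CFC.sqrt_mul_sqrt_self Γ (nonneg_iff_posSemidef.2 hΓ.posSemidef)
  have h2 : IsUnit (CFC.sqrt Γ * CFC.sqrt Γ) := by rw [h]; exact hΓ.isUnit
  rw [Matrix.isUnit_iff_isUnit_det, Matrix.det_mul] at h2
  rw [Matrix.isUnit_iff_isUnit_det]
  exact isUnit_of_mul_isUnit_left h2

lemma isHermitian_sqrt (Γ : Matrix (Fin m) (Fin m) ℝ) : (CFC.sqrt Γ).IsHermitian :=
  (nonneg_iff_posSemidef.1 (CFC.sqrt_nonneg Γ)).isHermitian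

lemma toEuclideanCLM_inv_apply {A : Matrix (Fin m) (Fin m) ℝ} (hA : IsUnit A) (x : Obs m) :
    toEuclideanCLM (𝕜 := ℝ) A⁻¹ (toEuclideanCLM (𝕜 := ℝ) A x) = x := by
  rw [← mul_apply_eq_comp, ← map_mul, Matrix.nonsing_inv_mul _ ((isUnit_iff_isUnit_det _).1 hA)]
  simp

lemma toEuclideanCLM_apply_inv {A : Matrix (Fin m) (Fin m) ℝ} (hA : IsUnit A) (x : Obs m) :
    toEuclideanCLM (𝕜 := ℝ) A (toEuclideanCLM (𝕜 := ℝ) A⁻¹ x) = x := by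
  rw [← mul_apply_eq_comp, ← map_mul, Matrix.mul_nonsing_inv _ ((isUnit_iff_isUnit_det _).1 hA)]
  simp

lemma inner_toEuclideanCLM_left {A : Matrix (Fin m) (Fin m) ℝ} (hA : A.IsHermitian) (x y : Obs m) :
    inner ℝ (toEuclideanCLM (𝕜 := ℝ) A x) y = inner ℝ x (toEuclideanCLM (𝕜 := ℝ) A y) := by
  have hs : IsSelfAdjoint (toEuclideanCLM (𝕜 := ℝ) A) := by
    have : IsSelfAdjoint A := hA
    exact this.map _
  exact hs.isSymmetric x y

/-- With G = √Γ the quadratic form is ‖G x‖², and x = G⁻¹ G x; the constant is ‖G⁻¹‖². -/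
lemma exists_sq_norm_le_inner (hΓ : Γ.PosDef) :
    ∃ c : ℝ, 0 ≤ c ∧ ∀ x : Obs m, ‖x‖ ^ 2 ≤ c * inner ℝ x (toEuclideanCLM (𝕜 := ℝ) Γ x) := by
  set G := CFC.sqrt Γ
  have hG : G * G = Γ := CFC.sqrt_mul_sqrt_self Γ (nonneg_iff_posSemidef.2 hΓ.posSemidef)
  refine ⟨‖toEuclideanCLM (𝕜 := ℝ) G⁻¹‖ ^ 2, by positivity, fun x => ?_⟩
  have h1 : inner ℝ x (toEuclideanCLM (𝕜 := ℝ) Γ x) = ‖toEuclideanCLM (𝕜 := ℝ) G x‖ ^ 2 := by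
    rw [← hG, map_mul, mul_apply_eq_comp, ← inner_toEuclideanCLM_left
      (isHermitian_sqrt Γ), real_inner_self_eq_norm_sq]
  rw [h1, ← mul_pow]
  refine pow_le_pow_left₀ (norm_nonneg _) ?_ 2
  conv_lhs => rw [← toEuclideanCLM_inv_apply (isUnit_sqrt hΓ) x]
  exact ContinuousLinearMap.le_opNorm _ _

/-- The inverses of `A + Γ` are bounded uniformly in positive semidefinite `A`. -/
lemma exists_norm_inv_le (hΓ : Γ.PosDef) :
    ∃ c : ℝ, 0 ≤ c ∧ ∀ A : Matrix (Fin m) (Fin m) ℝ, A.PosSemidef →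
      ‖toEuclideanCLM (𝕜 := ℝ) (A + Γ)⁻¹‖ ≤ c := by
  obtain ⟨c, hc, h⟩ := exists_sq_norm_le_inner hΓ
  refine ⟨c, hc, fun A hA => ContinuousLinearMap.opNorm_le_bound _ hc fun x => ?_⟩
  have hu : IsUnit (A + Γ) := (PosDef.posSemidef_add hA hΓ).isUnit
  set v := toEuclideanCLM (𝕜 := ℝ) (A + Γ)⁻¹ x
  have hv : toEuclideanCLM (𝕜 := ℝ) (A + Γ) v = x := toEuclideanCLM_apply_inv hu x
  -- Dropping the nonnegative term ⟨v, A v⟩ removes all dependence on `A`; coercivity of Γ then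
  -- bounds ‖v‖² by c ‖v‖ ‖x‖.
  have h1 : inner ℝ v (toEuclideanCLM (𝕜 := ℝ) Γ v) ≤ inner ℝ v x := by
    rw [← hv, map_add, _root_.add_apply, inner_add_right]
    have : 0 ≤ inner ℝ v (toEuclideanCLM (𝕜 := ℝ) A v) := by
      rw [inner_toEuclideanCLM]
      simpa using hA.dotProduct_mulVec_nonneg v.ofLp
    linarith
  have h2 : ‖v‖ * ‖v‖ ≤ ‖v‖ * (c * ‖x‖) := by
    calc ‖v‖ * ‖v‖ = ‖v‖ ^ 2 := (sq _).symm
      _ ≤ c * inner ℝ v x := (h v).trans (by gcongr)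
      _ ≤ c * (‖v‖ * ‖x‖) := by gcongr; exact real_inner_le_norm _ _
      _ = _ := by ring
  rcases (norm_nonneg v).eq_or_lt with h0 | h0
  · rw [← h0]; positivity
  · exact le_of_mul_le_mul_left h2 h0

end Inverse

/-! ### The gain as a function of the cross covariance -/

namespace FilterModel

variable {𝓗 Ξ : Type*} [NormedAddCommGroup 𝓗] [InnerProductSpace ℝ 𝓗]
  [MeasurableSpace 𝓗] [MeasurableSpace Ξ] {m : ℕ}

open Matrix

lemma abs_obsMatrix_sub_le (S : FilterModel 𝓗 Ξ m) (R R' : Obs m →L[ℝ] 𝓗) (i j : Fin m) :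
    |S.obsMatrix R i j - S.obsMatrix R' i j| ≤ ‖S.H‖ * ‖R - R'‖ := by
  have h : S.obsMatrix R i j - S.obsMatrix R' i j
      = S.H ((R - R') (EuclideanSpace.single j 1)) i := by
    simp [obsMatrix]
  rw [h, ← Real.norm_eq_abs]
  calc ‖S.H ((R - R') (EuclideanSpace.single j 1)) i‖
      ≤ ‖S.H ((R - R') (EuclideanSpace.single j 1))‖ := PiLp.norm_apply_le _ i
    _ ≤ ‖S.H‖ * (‖R - R'‖ * ‖EuclideanSpace.single j (1 : ℝ)‖) :=
        (S.H.le_opNorm _).trans (by gcongr; exact ContinuousLinearMap.le_opNorm _ _)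
    _ = _ := by simp

/-- The symmetric part of the matrix of `H R`. -/
noncomputable def symObsMatrix (S : FilterModel 𝓗 Ξ m) (R : Obs m →L[ℝ] 𝓗) :
    Matrix (Fin m) (Fin m) ℝ :=
  (1 / 2 : ℝ) • (S.obsMatrix R + (S.obsMatrix R)ᵀ)

/-- The gain with the symmetric part of `H R` in place of `H R`; it depends continuously on `R`. -/
noncomputable def symGain (S : FilterModel 𝓗 Ξ m) (R : Obs m →L[ℝ] 𝓗) : Obs m →L[ℝ] 𝓗 :=
  R ∘L Matrix.toEuclideanCLM (𝕜 := ℝ) (posPartMatrix (S.symObsMatrix R) + S.Γ)⁻¹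

lemma isHermitian_symObsMatrix (S : FilterModel 𝓗 Ξ m) (R : Obs m →L[ℝ] 𝓗) :
    (S.symObsMatrix R).IsHermitian := by
  ext i j
  simp [symObsMatrix]
  ring

lemma symObsMatrix_of_isHermitian (S : FilterModel 𝓗 Ξ m) {R : Obs m →L[ℝ] 𝓗}
    (h : (S.obsMatrix R).IsHermitian) : S.symObsMatrix R = S.obsMatrix R := by
  have : (S.obsMatrix R)ᵀ = S.obsMatrix R := by simpa using h.eq
  rw [symObsMatrix, this]
  ext i j
  simp
  ring

lemma frob_symObsMatrix_sub_le (S : FilterModel 𝓗 Ξ m) (R R' : Obs m →L[ℝ] 𝓗) :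
    frob (S.symObsMatrix R - S.symObsMatrix R') (S.symObsMatrix R - S.symObsMatrix R')
      ≤ (m * (‖S.H‖ * ‖R - R'‖)) ^ 2 := by
  have h : ∀ i j, (S.symObsMatrix R - S.symObsMatrix R') i j
      * (S.symObsMatrix R - S.symObsMatrix R') i j ≤ (‖S.H‖ * ‖R - R'‖) ^ 2 := by
    intro i j
    rw [← sq]
    refine sq_le_sq' ?_ ?_ <;>
    · have h1 := abs_le.1 (S.abs_obsMatrix_sub_le R R' i j)
      have h2 := abs_le.1 (S.abs_obsMatrix_sub_le R R' j i)
      simp [symObsMatrix]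
      linarith [h1.1, h1.2, h2.1, h2.2]
  calc _ ≤ ∑ _i : Fin m, ∑ _j : Fin m, (‖S.H‖ * ‖R - R'‖) ^ 2 :=
        Finset.sum_le_sum fun i _ => Finset.sum_le_sum fun j _ => h i j
    _ = _ := by simp; ring

/-- Write R X⁻¹ - R' Y⁻¹ = (R - R') X⁻¹ + R' X⁻¹ (Y - X) Y⁻¹; both inverses are bounded uniformly
and Y - X is controlled because the positive part is nonexpansive. The constant grows with `R'`
only. In the application `R'` is the deterministic mean-field cross covariance, so no moments of the
random `R` are needed. -/
lemma exists_norm_symGain_sub_le (S : FilterModel 𝓗 Ξ m) :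
    ∃ c : ℝ, 0 ≤ c ∧ ∀ R R' : Obs m →L[ℝ] 𝓗,
      ‖S.symGain R - S.symGain R'‖ ≤ c * (1 + ‖R'‖) * ‖R - R'‖ := by
  obtain ⟨c, hc, h⟩ := exists_norm_inv_le S.posDef_Γ
  refine ⟨max c (c * (m * ‖S.H‖) * c), le_max_of_le_left hc, fun R R' => ?_⟩
  set X := posPartMatrix (S.symObsMatrix R) + S.Γ with hX
  set Y := posPartMatrix (S.symObsMatrix R') + S.Γ with hY
  set T := toEuclideanCLM (n := Fin m) (𝕜 := ℝ)
  have hXi : ‖T X⁻¹‖ ≤ c := h _ (posSemidef_posPartMatrix _)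
  have hYi : ‖T Y⁻¹‖ ≤ c := h _ (posSemidef_posPartMatrix _)
  have hXu : IsUnit X.det := (isUnit_iff_isUnit_det _).1
    (PosDef.posSemidef_add (posSemidef_posPartMatrix _) S.posDef_Γ).isUnit
  have hYu : IsUnit Y.det := (isUnit_iff_isUnit_det _).1
    (PosDef.posSemidef_add (posSemidef_posPartMatrix _) S.posDef_Γ).isUnit
  have hd : ‖T (Y - X)‖ ≤ m * (‖S.H‖ * ‖R - R'‖) := by
    refine (norm_toEuclideanCLM_le _).trans (Real.sqrt_le_iff.2 ⟨by positivity, ?_⟩)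
    have : Y - X = posPartMatrix (S.symObsMatrix R') - posPartMatrix (S.symObsMatrix R) := by
      rw [hX, hY]; abel
    rw [this]
    refine (frob_posPart_sub_le (S.isHermitian_symObsMatrix _)
      (S.isHermitian_symObsMatrix _)).trans ?_
    rw [norm_sub_rev]
    exact S.frob_symObsMatrix_sub_le R' R
  have hinv : X⁻¹ - Y⁻¹ = X⁻¹ * (Y - X) * Y⁻¹ := by
    rw [mul_sub, sub_mul, mul_assoc X⁻¹ Y, mul_nonsing_inv _ hYu, nonsing_inv_mul _ hXu]
    simp
  have hTi : T X⁻¹ - T Y⁻¹ = (T X⁻¹ ∘L T (Y - X)) ∘L T Y⁻¹ := by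
    rw [← map_sub, hinv, map_mul, map_mul]
    rfl
  have hsplit : S.symGain R - S.symGain R' =
      (R - R') ∘L T X⁻¹ + R' ∘L (T X⁻¹ - T Y⁻¹) := by
    ext x : 1
    simp [symGain, T, X, Y]
  rw [hsplit]
  calc _ ≤ ‖R - R'‖ * c + ‖R'‖ * (c * (m * (‖S.H‖ * ‖R - R'‖)) * c) := by
        refine (norm_add_le _ _).trans (add_le_add ?_ ?_)
        · exact (ContinuousLinearMap.opNorm_comp_le _ _).trans (by gcongr)
        · refine (ContinuousLinearMap.opNorm_comp_le _ _).trans ?_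
          gcongr
          rw [hTi]
          refine (ContinuousLinearMap.opNorm_comp_le _ _).trans ?_
          gcongr
          refine (ContinuousLinearMap.opNorm_comp_le _ _).trans ?_
          gcongr
    _ = (c + c * (m * ‖S.H‖) * c * ‖R'‖) * ‖R - R'‖ := by ring
    _ ≤ _ := by
        refine mul_le_mul_of_nonneg_right ?_ (norm_nonneg _)
        rw [mul_add, mul_one]
        gcongr
        · exact le_max_left _ _
        · exact le_max_right _ _

lemma continuous_symGain (S : FilterModel 𝓗 Ξ m) : Continuous S.symGain := by
  obtain ⟨c, -, h⟩ := S.exists_norm_symGain_sub_le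
  refine continuous_iff_continuousAt.2 fun R' => ?_
  refine tendsto_iff_norm_sub_tendsto_zero.2 ?_
  refine squeeze_zero (fun _ => norm_nonneg _) (fun R => h R R') ?_
  have : Filter.Tendsto (fun R => ‖R - R'‖) (nhds R') (nhds 0) :=
    tendsto_iff_norm_sub_tendsto_zero.1 Filter.tendsto_id
  simpa using this.const_mul (c * (1 + ‖R'‖))

end FilterModel

end MLEnKF

namespace MLEnKF

/-! ### Moments of sums of independent centered random vectors -/

lemma mul_pow_le_add_pow {u v : ℝ} (hu : 0 ≤ u) (hv : 0 ≤ v) (K : ℕ) :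
    u * v ^ K ≤ u ^ (K + 1) + v ^ (K + 1) := by
  rcases le_total u v with h | h
  · calc u * v ^ K ≤ v * v ^ K := by gcongr
      _ = v ^ (K + 1) := by ring
      _ ≤ _ := by linarith [pow_nonneg hu (K + 1)]
  · calc u * v ^ K ≤ u * u ^ K := by gcongr
      _ = u ^ (K + 1) := by ring
      _ ≤ _ := by linarith [pow_nonneg hv (K + 1)]

/-- A first-order Taylor bound, to be used with a = ‖x‖², v = ‖y‖² and a + b = ‖x + y‖²; the last
two assumptions are what Cauchy–Schwarz and (s + t)² ≤ 2s² + 2t² give for these values. -/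
lemma exists_add_pow_le (K : ℕ) : ∃ c : ℝ, 0 ≤ c ∧ ∀ a b v : ℝ, 0 ≤ a → 0 ≤ v → 0 ≤ a + b →
    a + b ≤ 2 * a + 2 * v → b ^ 2 ≤ 8 * (a * v) + 2 * v ^ 2 →
    (a + b) ^ (K + 1) ≤ a ^ (K + 1) + (K + 1) * a ^ K * b + c * (a ^ K * v + v ^ (K + 1)) := by
  induction K with
  | zero => exact ⟨0, le_rfl, fun a b v _ _ _ _ _ => by simp⟩
  | succ K ih =>
    obtain ⟨c, hc, ih⟩ := ih
    -- Multiplying the previous bound by a + b produces a new term (K+1) a^K b², at most 10 (K+1) Z,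
    -- and turns the remainder into at most 8 c Z, with Z as below.
    refine ⟨10 * (K + 1) + 8 * c, by positivity, fun a b v ha hv hab h1 h2 => ?_⟩
    have h := ih a b v ha hv hab h1 h2
    have e1 : v ^ 2 * a ^ K ≤ a ^ (K + 1) * v + v ^ (K + 2) := by
      have := mul_le_mul_of_nonneg_left (mul_pow_le_add_pow hv ha K) hv
      calc v ^ 2 * a ^ K = v * (v * a ^ K) := by ring
        _ ≤ _ := this
        _ = _ := by ring
    have e2 : a * v ^ (K + 1) ≤ a ^ (K + 1) * v + v ^ (K + 2) := by
      have := mul_le_mul_of_nonneg_left (mul_pow_le_add_pow ha hv K) hv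
      calc a * v ^ (K + 1) = v * (a * v ^ K) := by ring
        _ ≤ _ := this
        _ = _ := by ring
    set Z := a ^ (K + 1) * v + v ^ (K + 2)
    have hZ1 : a ^ (K + 1) * v ≤ Z := by linarith [pow_nonneg hv (K + 2)]
    have hZ2 : v ^ (K + 2) ≤ Z := by linarith [mul_nonneg (pow_nonneg ha (K + 1)) hv]
    have e3 : a ^ K * b ^ 2 ≤ 10 * Z := by
      calc a ^ K * b ^ 2 ≤ a ^ K * (8 * (a * v) + 2 * v ^ 2) := by gcongr
        _ = 8 * (a ^ (K + 1) * v) + 2 * (v ^ 2 * a ^ K) := by ring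
        _ ≤ _ := by linarith
    have e4 : (a + b) * (a ^ K * v + v ^ (K + 1)) ≤ 8 * Z := by
      calc (a + b) * (a ^ K * v + v ^ (K + 1)) ≤ (2 * a + 2 * v) * (a ^ K * v + v ^ (K + 1)) := by
            gcongr
        _ = 2 * (a ^ (K + 1) * v) + 2 * (a * v ^ (K + 1)) + 2 * (v ^ 2 * a ^ K)
            + 2 * v ^ (K + 2) := by ring
        _ ≤ _ := by linarith
    calc (a + b) ^ (K + 1 + 1) = (a + b) * (a + b) ^ (K + 1) := by ring
      _ ≤ (a + b) * (a ^ (K + 1) + (K + 1) * a ^ K * b + c * (a ^ K * v + v ^ (K + 1))) := by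
          gcongr
      _ = a ^ (K + 1 + 1) + (K + 1 + 1) * a ^ (K + 1) * b + (K + 1) * (a ^ K * b ^ 2)
          + c * ((a + b) * (a ^ K * v + v ^ (K + 1))) := by ring
      _ ≤ a ^ (K + 1 + 1) + (K + 1 + 1) * a ^ (K + 1) * b + (K + 1) * (10 * Z)
          + c * (8 * Z) := by gcongr
      _ = _ := by push_cast; ring

lemma integral_add_mul_add_mul {α : Type*} [MeasurableSpace α] {μ : Measure α}
    {f g h k : α → ℝ} {a c : ℝ} (hf : Integrable f μ) (hg : Integrable g μ) (hh : Integrable h μ)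
    (hk : Integrable k μ) : ∫ x, (f x + a * g x + c * (h x + k x)) ∂μ
      = ∫ x, f x ∂μ + a * ∫ x, g x ∂μ + c * (∫ x, h x ∂μ + ∫ x, k x ∂μ) := by
  have h1 : Integrable (fun x => a * g x) μ := hg.const_mul a
  have h2 : Integrable (fun x => f x + a * g x) μ := hf.add h1
  have h3 : Integrable (fun x => h x + k x) μ := hh.add hk
  rw [integral_add h2 (h3.const_mul c), integral_add hf h1, integral_const_mul,
    integral_const_mul, integral_add hh hk]

lemma sampleMean_sub {E : Type*} [AddCommGroup E] [Module ℝ E] (M : ℕ) (u v : ℕ → E) :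
    sampleMean M (fun i => u i - v i) = sampleMean M u - sampleMean M v := by
  simp [sampleMean, Finset.sum_sub_distrib, smul_sub]

lemma sampleMean_const {E : Type*} [AddCommGroup E] [Module ℝ E] {M : ℕ} (hM : 0 < M) (v : E) :
    sampleMean M (fun _ => v) = v := by
  simp only [sampleMean, Finset.sum_const, Finset.card_range]
  rw [← Nat.cast_smul_eq_nsmul ℝ, smul_smul, inv_mul_cancel₀ (by positivity), one_smul]

section Hilbert

variable {α E : Type*} [MeasurableSpace α] {μ : Measure α} [IsProbabilityMeasure μ]
  [NormedAddCommGroup E] [InnerProductSpace ℝ E]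

/-- The first-order term is isolated as an inner product linear in `y`, so that it integrates to
zero when `y` is centered and independent of `x`. -/
lemma exists_norm_add_pow_le (K : ℕ) : ∃ c : ℝ, 0 ≤ c ∧ ∀ x y : E,
    ‖x + y‖ ^ (2 * (K + 1)) ≤ ‖x‖ ^ (2 * (K + 1))
      + 2 * (K + 1) * inner ℝ (‖x‖ ^ (2 * K) • x) y
      + c * (‖x‖ ^ (2 * K) * ‖y‖ ^ 2 + ‖y‖ ^ (2 * (K + 1))) := by
  obtain ⟨c, hc, h⟩ := exists_add_pow_le K
  -- The scalar bound has first-order term (K+1) a^K b with b = 2⟨x, y⟩ + ‖y‖²; the part with ‖y‖²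
  -- goes into the remainder and costs K+1.
  refine ⟨c + (K + 1), by positivity, fun x y => ?_⟩
  have h0 := norm_add_sq_real x y
  have hi := abs_le.1 (abs_real_inner_le_norm x y)
  have hx := norm_nonneg x
  have hy := norm_nonneg y
  have h1 := h (‖x‖ ^ 2) (2 * inner ℝ x y + ‖y‖ ^ 2) (‖y‖ ^ 2) (by positivity) (by positivity)
    (by rw [← add_assoc, ← h0]; positivity) (by nlinarith [sq_nonneg (‖x‖ - ‖y‖)]) (by
      have : (inner ℝ x y) ^ 2 ≤ (‖x‖ * ‖y‖) ^ 2 := sq_le_sq' hi.1 hi.2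
      nlinarith [sq_nonneg (2 * inner ℝ x y - ‖y‖ ^ 2)])
  rw [← add_assoc, ← h0] at h1
  have hv : 0 ≤ ‖y‖ ^ (2 * (K + 1)) := by positivity
  rw [real_inner_smul_left]
  simp only [← pow_mul] at h1
  calc _ ≤ _ := h1
    _ = ‖x‖ ^ (2 * (K + 1)) + 2 * (K + 1) * (‖x‖ ^ (2 * K) * inner ℝ x y)
      + (c * (‖x‖ ^ (2 * K) * ‖y‖ ^ 2 + ‖y‖ ^ (2 * (K + 1)))
        + (K + 1) * (‖x‖ ^ (2 * K) * ‖y‖ ^ 2)) := by ring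
    _ ≤ _ := by
      rw [add_mul c]
      gcongr
      linarith

variable [CompleteSpace E] [MeasurableSpace E] [BorelSpace E] [SecondCountableTopology E]

lemma integral_inner_eq_zero {K : ℕ} {X Y : α → E} {A : ℝ} (hXY : IndepFun X Y μ)
    (hX : LpLE μ ((2 * (K + 1) : ℕ) : ℝ) X A) (hXm : Measurable X) (hY : Integrable Y μ)
    (h0 : ∫ x, Y x ∂μ = 0) :
    Integrable (fun x => (inner ℝ (‖X x‖ ^ (2 * K) • X x) (Y x) : ℝ)) μ ∧
    ∫ x, (inner ℝ (‖X x‖ ^ (2 * K) • X x) (Y x) : ℝ) ∂μ = 0 := by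
  have hm : Measurable fun y : E => ‖y‖ ^ (2 * K) • y := by fun_prop
  have hi : IndepFun (fun x => ‖X x‖ ^ (2 * K) • X x) Y μ := hXY.comp hm measurable_id
  have hI : Integrable (fun x => ‖X x‖ ^ (2 * K) • X x) μ := by
    have h1 : Integrable (fun x => ‖X x‖ ^ (2 * K + 1)) μ := by
      refine LpLE.integrable_pow (A := A) (by omega) (hX.mono_exp ?_)
      exact_mod_cast (by omega : 2 * K + 1 ≤ 2 * (K + 1))
    refine h1.mono (hm.comp hXm).aestronglyMeasurable (ae_of_all _ fun x => ?_)
    simp [norm_smul, pow_succ]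
  refine ⟨hi.integrable_bilin hI hY (innerSL ℝ), ?_⟩
  have := hi.integral_bilin hI hY (innerSL ℝ)
  simp only [h0, map_zero] at this
  exact this

/-- Moments of even order of sums of independent centered random vectors. -/
lemma exists_integral_norm_sum_pow_le (k : ℕ) :
    ∃ C : ℝ, 0 ≤ C ∧ ∀ (X : ℕ → α → E) (B : ℝ), iIndepFun X μ → (∀ i, Measurable (X i)) →
      (∀ i, ∫ x, X i x ∂μ = 0) → (∀ i, LpLE μ ((2 * k : ℕ) : ℝ) (X i) B) → ∀ n : ℕ,
      ∫ x, ‖∑ i ∈ Finset.range n, X i x‖ ^ (2 * k) ∂μ ≤ C * n ^ k * B ^ (2 * k) := by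
  induction k with
  | zero => exact ⟨1, zero_le_one, fun X B _ _ _ _ n => by simp⟩
  | succ K ih =>
    obtain ⟨C, hC, ih⟩ := ih
    obtain ⟨c, hc, hadd⟩ := exists_norm_add_pow_le (E := E) K
    -- Adding the summand n costs c (C n^K + 1) B^(2K+2), and (C+1) n^(K+1) + C n^K + 1 ≤ (C+1)
    -- (n+1)^(K+1), so this constant is stable under the inner induction on n.
    refine ⟨c * (C + 1), by positivity, fun X B hind hXm h0 hX n => ?_⟩
    have hB : 0 ≤ B := (hX 0).nonneg
    have hle : ∀ {j : ℕ}, j ≤ 2 * (K + 1) → ∀ i, LpLE μ (j : ℝ) (X i) B := fun hj i =>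
      (hX i).mono_exp (by exact_mod_cast hj)
    have h1 : (1 : ℝ) ≤ ((2 * (K + 1) : ℕ) : ℝ) := by exact_mod_cast (by omega)
    have hS : ∀ n, LpLE μ ((2 * (K + 1) : ℕ) : ℝ) (fun x => ∑ i ∈ Finset.range n, X i x)
        (∑ i ∈ Finset.range n, B) := fun n => LpLE.sum h1 _ fun i _ => hX i
    have hSm : ∀ n, Measurable fun x => ∑ i ∈ Finset.range n, X i x := fun n =>
      Finset.measurable_sum _ fun i _ => hXm i
    induction n with
    | zero => simp
    | succ n ihn =>
      have hi : IndepFun (fun x => ∑ i ∈ Finset.range n, X i x) (X n) μ := by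
        have := hind.indepFun_sum_range_succ hXm n
        convert this using 2
        simp
      have hXint : Integrable (X n) μ := (hX n).integrable h1
      obtain ⟨hI1, hI2⟩ := integral_inner_eq_zero hi (hS n) (hSm n) hXint (h0 n)
      have hSK : Integrable (fun x => ‖∑ i ∈ Finset.range n, X i x‖ ^ (2 * K)) μ := by
        rcases Nat.eq_zero_or_pos K with hK | hK
        · subst hK; simp
        · refine LpLE.integrable_pow (by omega) ((hS n).mono_exp ?_)
          exact_mod_cast (by omega : 2 * K ≤ 2 * (K + 1))
      have hX2 : Integrable (fun x => ‖X n x‖ ^ 2) μ :=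
        LpLE.integrable_pow (by omega) (hle (by omega) n)
      have hXk : Integrable (fun x => ‖X n x‖ ^ (2 * (K + 1))) μ :=
        LpLE.integrable_pow (by omega) (hX n)
      have hSk : ∀ n, Integrable (fun x => ‖∑ i ∈ Finset.range n, X i x‖ ^ (2 * (K + 1))) μ :=
        fun n => LpLE.integrable_pow (by omega) (hS n)
      have hi2 : IndepFun (fun x => ‖∑ i ∈ Finset.range n, X i x‖ ^ (2 * K))
          (fun x => ‖X n x‖ ^ 2) μ :=
        hi.comp (φ := fun y : E => ‖y‖ ^ (2 * K)) (ψ := fun y : E => ‖y‖ ^ 2)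
          (by fun_prop) (by fun_prop)
      have hprod : Integrable (fun x => ‖∑ i ∈ Finset.range n, X i x‖ ^ (2 * K) * ‖X n x‖ ^ 2) μ :=
        hi2.integrable_mul hSK hX2
      have hprodI := hi2.integral_fun_mul_eq_mul_integral hSK.1 hX2.1
      have hXk' : ∫ x, ‖X n x‖ ^ (2 * (K + 1)) ∂μ ≤ B ^ (2 * (K + 1)) :=
        LpLE.integral_pow_le (by omega) (hX n)
      have hX2' : ∫ x, ‖X n x‖ ^ 2 ∂μ ≤ B ^ 2 :=
        LpLE.integral_pow_le (by omega) (hle (by omega) n)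
      have hSK' : ∫ x, ‖∑ i ∈ Finset.range n, X i x‖ ^ (2 * K) ∂μ ≤ C * n ^ K * B ^ (2 * K) :=
        ih X B hind hXm h0 (hle (by omega)) n
      -- The cross term vanishes by independence and centering, and the mixed second-order term
      -- factorizes; its first factor is the moment of the lower order 2K, bounded by the outer
      -- induction.
      have key : ∫ x, ‖∑ i ∈ Finset.range (n + 1), X i x‖ ^ (2 * (K + 1)) ∂μ ≤
          ∫ x, ‖∑ i ∈ Finset.range n, X i x‖ ^ (2 * (K + 1)) ∂μ
          + c * ((∫ x, ‖∑ i ∈ Finset.range n, X i x‖ ^ (2 * K) ∂μ) * (∫ x, ‖X n x‖ ^ 2 ∂μ)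
            + ∫ x, ‖X n x‖ ^ (2 * (K + 1)) ∂μ) := by
        calc _ ≤ ∫ x, (‖∑ i ∈ Finset.range n, X i x‖ ^ (2 * (K + 1))
              + 2 * (K + 1) * inner ℝ (‖∑ i ∈ Finset.range n, X i x‖ ^ (2 * K) •
                (∑ i ∈ Finset.range n, X i x)) (X n x)
              + c * (‖∑ i ∈ Finset.range n, X i x‖ ^ (2 * K) * ‖X n x‖ ^ 2
                + ‖X n x‖ ^ (2 * (K + 1)))) ∂μ := by
              refine integral_mono (hSk (n + 1)) ?_ fun x => ?_
              · exact ((hSk n).add (hI1.const_mul _)).add ((hprod.add hXk).const_mul c)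
              · simp only [Finset.sum_range_succ]
                exact hadd _ _
          _ = _ := by
              rw [integral_add_mul_add_mul (hSk n) hI1 hprod hXk, hI2, hprodI]
              ring
      have hn : (0 : ℝ) ≤ n := Nat.cast_nonneg n
      calc _ ≤ _ := key
        _ ≤ c * (C + 1) * n ^ (K + 1) * B ^ (2 * (K + 1))
            + c * (C * n ^ K * B ^ (2 * K) * B ^ 2 + B ^ (2 * (K + 1))) := by
            have h2 : 0 ≤ ∫ x, ‖X n x‖ ^ 2 ∂μ := integral_nonneg fun x => by positivity
            gcongr
        _ = c * ((C + 1) * n ^ (K + 1) + (C * n ^ K + 1)) * B ^ (2 * (K + 1)) := by ring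
        _ ≤ c * ((C + 1) * (n + 1) ^ (K + 1)) * B ^ (2 * (K + 1)) := by
            gcongr
            have a1 : (n : ℝ) ^ K ≤ (n + 1) ^ K := by gcongr; linarith
            have a2 : (1 : ℝ) ≤ (n + 1) ^ K := one_le_pow₀ (by linarith)
            have a3 : (n : ℝ) ^ (K + 1) + (n + 1) ^ K ≤ (n + 1) ^ (K + 1) := by
              rw [pow_succ, pow_succ, mul_add, mul_one]
              gcongr
            nlinarith [mul_le_mul_of_nonneg_left a1 hC]
        _ = _ := by push_cast; ring

/-- The least even integer bounding `2 p`. -/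
noncomputable def evenExp (p : ℝ) : ℝ := ((2 * ⌈p⌉₊ : ℕ) : ℝ)

lemma le_evenExp (p : ℝ) : 2 * p ≤ evenExp p := by
  have := Nat.le_ceil p
  simp only [evenExp, Nat.cast_mul, Nat.cast_ofNat]
  linarith

/-- Sample means of independent centered random vectors are small in every `L^p`. -/
lemma exists_sampleMean_le (p : ℝ) (hp : 1 ≤ p) :
    ∃ C : ℝ, 0 ≤ C ∧ ∀ (X : ℕ → α → E) (B : ℝ), iIndepFun X μ → (∀ i, Measurable (X i)) →
      (∀ i, ∫ x, X i x ∂μ = 0) → (∀ i, LpLE μ (evenExp p) (X i) B) → ∀ n : ℕ, 0 < n →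
      LpLE μ p (fun x => sampleMean n fun i => X i x) (C * (B / √n)) := by
  set k := ⌈p⌉₊ with hk
  have hkp : 0 < k := Nat.ceil_pos.2 (by linarith)
  obtain ⟨C, hC, h⟩ := exists_integral_norm_sum_pow_le (μ := μ) (E := E) k
  -- Since max C 1 ≥ 1, its power 2k still dominates `C`; this replaces the extraction of a root of
  -- `C`.
  refine ⟨max C 1, by positivity, fun X B hind hXm h0 hX n hn => ?_⟩
  have hB : 0 ≤ B := (hX 0).nonneg
  have hp2 : p ≤ ((2 * k : ℕ) : ℝ) := by
    have := le_evenExp p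
    rw [evenExp, ← hk] at this
    linarith
  have h1 : (1 : ℝ) ≤ ((2 * k : ℕ) : ℝ) := hp.trans hp2
  have hS : LpLE μ ((2 * k : ℕ) : ℝ) (fun x => ∑ i ∈ Finset.range n, X i x)
      (∑ i ∈ Finset.range n, B) := LpLE.sum h1 _ fun i _ => hX i
  have hM : LpLE μ ((2 * k : ℕ) : ℝ) (fun x => ∑ i ∈ Finset.range n, X i x)
      (max C 1 * √n * B) := by
    refine LpLE.of_integral_pow_le hkp hS.aesm (LpLE.integrable_pow (by omega) hS)
      (by positivity) ((h X B hind hXm h0 hX n).trans ?_)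
    rw [mul_pow, mul_pow]
    have a1 : (√(n : ℝ)) ^ (2 * k) = (n : ℝ) ^ k := by
      rw [pow_mul, Real.sq_sqrt (Nat.cast_nonneg n)]
    rw [a1]
    gcongr
    exact (le_max_left C 1).trans (le_self_pow₀ (le_max_right C 1) (by omega))
  have := (hM.const_smul ((n : ℝ)⁻¹)).mono_exp hp2
  refine this.mono (le_of_eq ?_)
  have hs : √(n : ℝ) * √n = n := Real.mul_self_sqrt (Nat.cast_nonneg n)
  have hs0 : (0 : ℝ) < √n := Real.sqrt_pos.2 (by exact_mod_cast hn)
  have hn' : (n : ℝ)⁻¹ = (√n)⁻¹ * (√n)⁻¹ := by rw [← mul_inv, hs]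
  rw [abs_of_nonneg (by positivity), hn']
  field_simp

end Hilbert

end MLEnKF

namespace MLEnKF

/-! ### Sample covariances -/

section SampleCov

variable {α E : Type*} [MeasurableSpace α] {μ : Measure α}
  [NormedAddCommGroup E] [InnerProductSpace ℝ E]

lemma sampleCov_apply (M : ℕ) (v : ℕ → E) (g : E) :
    sampleCov M v g = ((M : ℝ) / (M - 1)) • (sampleMean M (fun i => inner ℝ (v i) g • v i)
      - inner ℝ (sampleMean M v) g • sampleMean M v) := by
  have h : (sampleMean M fun i => InnerProductSpace.rankOne ℝ (v i) (v i)) g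
      = sampleMean M fun i => inner ℝ (v i) g • v i := by
    simp [sampleMean, InnerProductSpace.rankOne_apply]
  rw [sampleCov, _root_.smul_apply, _root_.sub_apply, h, InnerProductSpace.rankOne_apply]

lemma continuous_rankOne : Continuous fun z : E × E => InnerProductSpace.rankOne ℝ z.1 z.2 :=
  ((InnerProductSpace.rankOne ℝ : E →L[ℝ] E →L⋆[ℝ] E →L[ℝ] E).continuous.comp
    continuous_fst).clm_apply continuous_snd

lemma LpLE.inner_smul {p A B : ℝ} {u v : α → E} (g : E) (hu : LpLE μ (2 * p) u A)
    (hv : LpLE μ (2 * p) v B) : LpLE μ p (fun x => inner ℝ (u x) g • v x) (‖g‖ * (A * B)) := by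
  have hm : AEStronglyMeasurable (fun x => inner ℝ (u x) g • v x) μ :=
    (hu.aesm.inner aestronglyMeasurable_const).smul hv.aesm
  have h1 := hu.mul hv (F' := fun x => ‖u x‖ * ‖v x‖) (hu.aesm.norm.mul hv.aesm.norm)
    (fun x => by simp)
  refine h1.of_norm_le_mul hm (fun x => ?_) (norm_nonneg g)
  rw [norm_smul, norm_mul, norm_norm, norm_norm]
  calc ‖(inner ℝ (u x) g : ℝ)‖ * ‖v x‖ ≤ (‖u x‖ * ‖g‖) * ‖v x‖ := by
        gcongr; exact norm_inner_le_norm _ _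
    _ = _ := by ring

lemma LpLE.sampleMean {p B : ℝ} (hp : 1 ≤ p) {M : ℕ} {v : ℕ → α → E}
    (hB : 0 ≤ B) (h : ∀ i < M, LpLE μ p (v i) B) :
    LpLE μ p (fun x => MLEnKF.sampleMean M fun i => v i x) B := by
  have h1 := (LpLE.sum hp (Finset.range M) (f := v) (B := fun _ => B)
    fun i hi => h i (Finset.mem_range.1 hi)).const_smul ((M : ℝ)⁻¹)
  refine h1.mono ?_
  rw [Finset.sum_const, Finset.card_range, nsmul_eq_mul, abs_of_nonneg (by positivity), ← mul_assoc]
  exact mul_le_of_le_one_left hB inv_mul_le_one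

lemma inner_smul_sub_inner_smul (g u v : E) :
    (inner ℝ u g : ℝ) • u - (inner ℝ v g : ℝ) • v
      = (inner ℝ (u - v) g : ℝ) • u + (inner ℝ v g : ℝ) • (u - v) := by
  rw [inner_sub_left, sub_smul, smul_sub]; abel

lemma LpLE.inner_smul_sub {p A D : ℝ} (hp : 1 ≤ p) {u v : α → E} (g : E)
    (hu : LpLE μ (2 * p) u A) (hv : LpLE μ (2 * p) v A)
    (hd : LpLE μ (2 * p) (fun x => u x - v x) D) :
    LpLE μ p (fun x => (inner ℝ (u x) g : ℝ) • u x - (inner ℝ (v x) g : ℝ) • v x)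
      (2 * (‖g‖ * (A * D))) := by
  simp only [inner_smul_sub_inner_smul]
  exact ((LpLE.inner_smul g hd hu).add hp (LpLE.inner_smul g hv hd)).mono (by linarith)

lemma div_sub_one_le_two {M : ℕ} (hM : 2 ≤ M) : |(M : ℝ) / (M - 1)| ≤ 2 := by
  have : (2 : ℝ) ≤ M := by exact_mod_cast hM
  rw [abs_of_nonneg (div_nonneg (by linarith) (by linarith)), div_le_iff₀ (by linarith)]
  linarith

/-- Lipschitz dependence of the sample covariance on the ensemble. -/
lemma LpLE.sampleCov_sub {p A D : ℝ} (hp : 1 ≤ p) {M : ℕ} (hM : 2 ≤ M) {u v : ℕ → α → E} (g : E)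
    (hu : ∀ i < M, LpLE μ (2 * p) (u i) A) (hv : ∀ i < M, LpLE μ (2 * p) (v i) A)
    (hd : ∀ i < M, LpLE μ (2 * p) (fun x => u i x - v i x) D) :
    LpLE μ p (fun x => sampleCov M (fun i => u i x) g - sampleCov M (fun i => v i x) g)
      (8 * ‖g‖ * (A * D)) := by
  have hA : 0 ≤ A := (hu 0 (by omega)).nonneg
  have hD : 0 ≤ D := (hd 0 (by omega)).nonneg
  have h2p : 1 ≤ 2 * p := by linarith
  have e1 : LpLE μ p (fun x => MLEnKF.sampleMean M fun i =>
      (inner ℝ (u i x) g : ℝ) • u i x - (inner ℝ (v i x) g : ℝ) • v i x)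
      (2 * (‖g‖ * (A * D))) :=
    LpLE.sampleMean (v := fun i x => (inner ℝ (u i x) g : ℝ) • u i x
      - (inner ℝ (v i x) g : ℝ) • v i x) hp (by positivity)
      fun i hi => LpLE.inner_smul_sub hp g (hu i hi) (hv i hi) (hd i hi)
  have e2 := LpLE.inner_smul_sub hp g (LpLE.sampleMean h2p hA hu) (LpLE.sampleMean h2p hA hv)
    (D := D) (by
      have := LpLE.sampleMean (v := fun i x => u i x - v i x) h2p hD hd
      simpa only [sampleMean_sub] using this)
  have e3 := (e1.sub hp e2).const_smul ((M : ℝ) / (M - 1))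
  have : ∀ x, sampleCov M (fun i => u i x) g - sampleCov M (fun i => v i x) g
      = ((M : ℝ) / (M - 1)) • ((MLEnKF.sampleMean M fun i =>
      (inner ℝ (u i x) g : ℝ) • u i x - (inner ℝ (v i x) g : ℝ) • v i x) -
      ((inner ℝ (MLEnKF.sampleMean M fun i => u i x) g : ℝ) • (MLEnKF.sampleMean M fun i => u i x)
        - (inner ℝ (MLEnKF.sampleMean M fun i => v i x) g : ℝ) •
          (MLEnKF.sampleMean M fun i => v i x))) := by
    intro x
    rw [sampleCov_apply, sampleCov_apply, ← smul_sub, sampleMean_sub]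
    congr 1
    abel
  simp only [this]
  refine e3.mono ?_
  calc _ ≤ 2 * (2 * (‖g‖ * (A * D)) + 2 * (‖g‖ * (A * D))) := by
        gcongr; exact div_sub_one_le_two hM
    _ = _ := by ring

variable [CompleteSpace E] [MeasurableSpace E] [BorelSpace E] [SecondCountableTopology E]
  [IsProbabilityMeasure μ]

/-- Fluctuation of the sample mean of independent vectors with a common mean. -/
lemma exists_sampleMean_sub_le (p : ℝ) (hp : 1 ≤ p) :
    ∃ C : ℝ, 0 ≤ C ∧ ∀ (X : ℕ → α → E) (e : E) (B : ℝ), iIndepFun X μ → (∀ i, Measurable (X i)) →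
      (∀ i, ∫ x, X i x ∂μ = e) → (∀ i, LpLE μ (evenExp p) (X i) B) → ∀ n : ℕ, 0 < n →
      LpLE μ p (fun x => (sampleMean n fun i => X i x) - e) (C * (B / √n)) := by
  obtain ⟨C, hC, h⟩ := exists_sampleMean_le (μ := μ) (E := E) p hp
  refine ⟨C * 2, by positivity, fun X e B hind hXm h0 hX n hn => ?_⟩
  have h1 : 1 ≤ evenExp p := by linarith [le_evenExp p]
  have hint : ∀ i, Integrable (X i) μ := fun i => (hX i).integrable h1
  have he : ‖e‖ ≤ B := by rw [← h0 0]; exact (hX 0).norm_integral_le h1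
  -- The common mean is itself bounded by `B`, so centering at most doubles the norm.
  have := h (fun i x => X i x - e) (2 * B)
    (hind.comp (fun _ y => y - e) fun _ => by fun_prop) (fun i => (hXm i).sub_const e)
    (fun i => by rw [integral_sub (hint i) (integrable_const e), h0]; simp)
    (fun i => ((hX i).sub h1 (LpLE.const (by linarith) e)).mono (by linarith)) n hn
  simp only [sampleMean_sub, sampleMean_const hn] at this
  refine this.mono (le_of_eq (by ring))

/-- Fluctuation of the difference of the sample covariances of a coupled ensemble. -/
lemma exists_sampleCov_sub_sub_le (p : ℝ) (hp : 1 ≤ p) :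
    ∃ C : ℝ, 0 ≤ C ∧ ∀ (a b : ℕ → α → E) (g ea eb Qa Qb : E) (A D : ℝ),
      iIndepFun (fun i x => (a i x, b i x)) μ → (∀ i, Measurable (a i)) → (∀ i, Measurable (b i)) →
      (∀ i, ∫ x, a i x ∂μ = ea) → (∀ i, ∫ x, b i x ∂μ = eb) →
      (∀ i, ∫ x, (inner ℝ (a i x) g : ℝ) • a i x ∂μ = Qa) →
      (∀ i, ∫ x, (inner ℝ (b i x) g : ℝ) • b i x ∂μ = Qb) →
      (∀ i, LpLE μ (2 * evenExp (2 * p)) (a i) A) → (∀ i, LpLE μ (2 * evenExp (2 * p)) (b i) A) →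
      (∀ i, LpLE μ (2 * evenExp (2 * p)) (fun x => a i x - b i x) D) →
      ∀ M : ℕ, 2 ≤ M →
      LpLE μ p (fun x => sampleCov M (fun i => a i x) g - sampleCov M (fun i => b i x) g
        - ((Qa - (inner ℝ ea g : ℝ) • ea) - (Qb - (inner ℝ eb g : ℝ) • eb)))
        (C * (‖g‖ * (A * D) / √M)) := by
  obtain ⟨C₁, hC₁, h₁⟩ := exists_sampleMean_sub_le (μ := μ) (E := E) p hp
  obtain ⟨C₂, hC₂, h₂⟩ := exists_sampleMean_sub_le (μ := μ) (E := E) (2 * p) (by linarith)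
  refine ⟨2 * (C₁ * 2 + (4 * C₂ + 2 * C₂ ^ 2)) + 8, by positivity,
    fun a b g ea eb Qa Qb A D hind ham hbm hea heb hQa hQb hA hB hD M hM => ?_⟩
  have hA0 : 0 ≤ A := (hA 0).nonneg
  have hD0 : 0 ≤ D := (hD 0).nonneg
  have hpe : 1 ≤ evenExp (2 * p) := by linarith [le_evenExp (2 * p)]
  have hpe' : evenExp p ≤ evenExp (2 * p) := by
    simp only [evenExp, Nat.cast_le]
    have : ⌈p⌉₊ ≤ ⌈2 * p⌉₊ := Nat.ceil_mono (by linarith)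
    omega
  have hpe2 : 2 * p ≤ 2 * evenExp (2 * p) := by linarith [le_evenExp (2 * p)]
  have hM0 : 0 < M := by omega
  set s : ℝ := √(M : ℝ) with hs
  have hMr : (2 : ℝ) ≤ M := by exact_mod_cast hM
  have hss : s * s = M := Real.mul_self_sqrt (by positivity)
  have hs1 : 1 ≤ s := by rw [hs]; exact Real.one_le_sqrt.2 (by linarith)
  have hs0 : 0 < s := by linarith
  have haI : ∀ i, Integrable (a i) μ := fun i => (hA i).integrable (by linarith)
  have hbI : ∀ i, Integrable (b i) μ := fun i => (hB i).integrable (by linarith)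
  have hqa : ∀ i, LpLE μ (evenExp (2 * p)) (fun x => (inner ℝ (a i x) g : ℝ) • a i x)
    (‖g‖ * (A * A)) := fun i => LpLE.inner_smul g (hA i) (hA i)
  have hqb : ∀ i, LpLE μ (evenExp (2 * p)) (fun x => (inner ℝ (b i x) g : ℝ) • b i x)
    (‖g‖ * (A * A)) := fun i => LpLE.inner_smul g (hB i) (hB i)
  have hqd : ∀ i, LpLE μ (evenExp (2 * p)) (fun x => (inner ℝ (a i x) g : ℝ) • a i x
      - (inner ℝ (b i x) g : ℝ) • b i x) (2 * (‖g‖ * (A * D))) := fun i =>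
    LpLE.inner_smul_sub hpe g (hA i) (hB i) (hD i)
  have hQ : ∀ i, ∫ x, ((inner ℝ (a i x) g : ℝ) • a i x - (inner ℝ (b i x) g : ℝ) • b i x) ∂μ
      = Qa - Qb := fun i => by
    rw [integral_sub ((hqa i).integrable hpe) ((hqb i).integrable hpe), hQa, hQb]
  have hed : ∀ i, ∫ x, (a i x - b i x) ∂μ = ea - eb := fun i => by
    rw [integral_sub (haI i) (hbI i), hea, heb]
  have T := h₁ (fun i x => (inner ℝ (a i x) g : ℝ) • a i x - (inner ℝ (b i x) g : ℝ) • b i x)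
    (Qa - Qb) (2 * (‖g‖ * (A * D)))
    (hind.comp (fun _ z => (inner ℝ z.1 g : ℝ) • z.1 - (inner ℝ z.2 g : ℝ) • z.2)
      fun _ => by fun_prop)
    (fun i => by have := ham i; have := hbm i; fun_prop) hQ
    (fun i => (hqd i).mono_exp hpe') M hM0
  have Ta := h₂ a ea A (hind.comp (fun _ z => z.1) fun _ => measurable_fst) ham hea
    (fun i => (hA i).mono_exp (by linarith)) M hM0
  have Tb := h₂ b eb A (hind.comp (fun _ z => z.2) fun _ => measurable_snd) hbm heb
    (fun i => (hB i).mono_exp (by linarith)) M hM0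
  have Td := h₂ (fun i x => a i x - b i x) (ea - eb) D
    (hind.comp (fun _ z => z.1 - z.2) fun _ => by fun_prop)
    (fun i => (ham i).sub (hbm i)) hed
    (fun i => (hD i).mono_exp (by linarith)) M hM0
  simp only [sampleMean_sub] at T Td
  have hδ : LpLE μ (2 * p) (fun _ : α => ea - eb) D :=
    (LpLE.const (by linarith) _).mono (by
      rw [← hed 0]; exact (hD 0).norm_integral_le (by linarith))
  have hbe : LpLE μ (2 * p) (fun _ : α => eb) A :=
    (LpLE.const (by linarith) _).mono (by
      rw [← heb 0]; exact (hB 0).norm_integral_le (by linarith))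
  have hae : LpLE μ (2 * p) (fun _ : α => ea) A :=
    (LpLE.const (by linarith) _).mono (by
      rw [← hea 0]; exact (hA 0).norm_integral_le (by linarith))
  set ah : α → E := fun x => sampleMean M fun i => a i x with hah
  set bh : α → E := fun x => sampleMean M fun i => b i x with hbh
  have hdab : LpLE μ (2 * p) (fun x => (ah x - ea) - (bh x - eb)) (C₂ * (D / s)) := by
    refine Td.congr (ae_of_all _ fun x => ?_)
    simp only [hah, hbh]
    abel
  -- With α = ah - ea, β = bh - eb and δ = ea - eb, the difference of the centered mean products is
  -- ⟨δ,g⟩α + ⟨eb,g⟩(α-β) + ⟨α,g⟩δ + ⟨α-β,g⟩eb + ⟨α-β,g⟩α + ⟨β,g⟩(α-β). Each term carries one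
  -- coupling factor `D` and at least one factor 1/√M.
  have U := ((((LpLE.inner_smul g hδ Ta).add hp (LpLE.inner_smul g hbe hdab)).add hp
    (LpLE.inner_smul g Ta hδ)).add hp (LpLE.inner_smul g hdab hbe)).add hp
    ((LpLE.inner_smul g hdab Ta).add hp (LpLE.inner_smul g Tb hdab))
  -- The deterministic covariance difference enters through the unbiasing factor: it is multiplied
  -- by M/(M-1) - 1 = 1/(M-1), which is at most 2/√M.
  have V : LpLE μ p (fun _ : α => (Qa - Qb) - ((inner ℝ ea g : ℝ) • ea - (inner ℝ eb g : ℝ) • eb))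
      (2 * (‖g‖ * (A * D)) + 2 * (‖g‖ * (A * D))) := by
    refine LpLE.sub hp ?_ (LpLE.inner_smul_sub hp g hae hbe hδ)
    refine (LpLE.const (by linarith) _).mono ?_
    rw [← hQ 0]
    exact (hqd 0).norm_integral_le hpe
  have W := ((T.sub hp U).const_smul ((M : ℝ) / (M - 1))).add hp
    (V.const_smul ((M : ℝ) / (M - 1) - 1))
  have hW := W.mono (B := (2 * (C₁ * 2 + (4 * C₂ + 2 * C₂ ^ 2)) + 8) * (‖g‖ * (A * D) / s)) ?_
  · refine hW.congr (ae_of_all _ fun x => ?_)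
    simp only [sampleCov_apply]
    generalize (sampleMean M fun i => (inner ℝ (a i x) g : ℝ) • a i x) = ta
    generalize (sampleMean M fun i => (inner ℝ (b i x) g : ℝ) • b i x) = tb
    rw [show (sampleMean M fun i => a i x) = ah x from rfl,
      show (sampleMean M fun i => b i x) = bh x from rfl]
    generalize ah x = u
    generalize bh x = v
    simp only [inner_sub_left, smul_sub, sub_smul, smul_add, smul_smul, sub_mul, one_smul]
    module
  · have k1 : |(M : ℝ) / (M - 1) - 1| ≤ 2 / s := by
      have : (M : ℝ) / (M - 1) - 1 = 1 / (M - 1) := by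
        rw [div_sub_one (by linarith)]; congr 1; ring
      rw [this, abs_of_nonneg (div_nonneg zero_le_one (by linarith)),
        div_le_div_iff₀ (by linarith) hs0]
      nlinarith
    have k2 := div_sub_one_le_two hM
    have hXs : 0 ≤ ‖g‖ * (A * D) := by positivity
    -- The terms quadratic in the fluctuations are of order 1/M; one factor 1/√M is discarded.
    have k3 : C₂ * (D / s) * (C₂ * (A / s)) ≤ C₂ ^ 2 * (A * D) / s := by
      have : C₂ * (D / s) * (C₂ * (A / s)) = C₂ ^ 2 * (A * D) / s / s := by field_simp
      rw [this]
      exact div_le_self (by positivity) hs1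
    calc _ ≤ 2 * (C₁ * (2 * (‖g‖ * (A * D)) / s) +
          (‖g‖ * (D * (C₂ * (A / s))) + ‖g‖ * (A * (C₂ * (D / s))) +
            ‖g‖ * (C₂ * (A / s) * D) + ‖g‖ * (C₂ * (D / s) * A) +
            (‖g‖ * (C₂ ^ 2 * (A * D) / s) + ‖g‖ * (C₂ ^ 2 * (A * D) / s)))) +
          2 / s * (2 * (‖g‖ * (A * D)) + 2 * (‖g‖ * (A * D))) := by
          gcongr
          rw [mul_comm]
          exact k3
      _ = _ := by ring

lemma integrable_rankOne_sub {π : Measure E} [IsProbabilityMeasure π]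
    (hπ : MemLp (fun x : E => x) 2 π) (e : E) :
    Integrable (fun x : E => InnerProductSpace.rankOne ℝ (x - e) (x - e)) π := by
  have hsub : MemLp (fun x : E => x - e) 2 π := hπ.sub (memLp_const e)
  have hc : Continuous fun x : E => InnerProductSpace.rankOne ℝ (x - e) (x - e) :=
    continuous_rankOne.comp (by fun_prop : Continuous fun x : E => (x - e, x - e))
  refine (hsub.integrable_norm_pow (by norm_num)).mono hc.aestronglyMeasurable
    (ae_of_all _ fun x => ?_)
  rw [InnerProductSpace.norm_rankOne, norm_pow, norm_norm, sq]

lemma inner_covOp {π : Measure E} [IsProbabilityMeasure π] (hπ : MemLp (fun x : E => x) 2 π)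
    (f g : E) : inner ℝ f (covOp π g)
      = ∫ x, (inner ℝ (x - ∫ z, z ∂π) f * inner ℝ (x - ∫ z, z ∂π) g : ℝ) ∂π := by
  have hr := integrable_rankOne_sub hπ (∫ z, z ∂π)
  rw [covOp, ContinuousLinearMap.integral_apply hr, ← integral_inner (hr.apply_continuousLinearMap g)]
  refine integral_congr_ae (ae_of_all _ fun x => ?_)
  simp only [InnerProductSpace.rankOne_apply, real_inner_smul_right, real_inner_comm f]
  ring

/-- The covariance operator in terms of noncentered second moments. -/
lemma covOp_apply {π : Measure E} [IsProbabilityMeasure π] (hπ : MemLp (fun x : E => x) 2 π)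
    (g : E) : covOp π g = ∫ x, (inner ℝ x g : ℝ) • x ∂π
      - (inner ℝ (∫ x, x ∂π) g : ℝ) • ∫ x, x ∂π := by
  set e := ∫ x, x ∂π
  have hI : Integrable (fun x : E => x) π := hπ.integrable (by norm_num)
  have hr := integrable_rankOne_sub hπ e
  have hq : Integrable (fun x : E => (inner ℝ x g : ℝ) • x) π := by
    refine ((hπ.integrable_norm_pow (by norm_num)).const_mul ‖g‖).mono
      (by fun_prop) (ae_of_all _ fun x => ?_)
    simp only [norm_smul, norm_mul, norm_norm, norm_pow]
    have := norm_inner_le_norm (𝕜 := ℝ) x g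
    nlinarith [norm_nonneg x, norm_nonneg g]
  rw [covOp, ContinuousLinearMap.integral_apply hr]
  have hexp : ∀ x : E, InnerProductSpace.rankOne ℝ (x - e) (x - e) g
      = (inner ℝ x g : ℝ) • x - (inner ℝ x g : ℝ) • e - (inner ℝ e g : ℝ) • (x - e) := by
    intro x
    rw [InnerProductSpace.rankOne_apply, inner_sub_left]
    module
  simp only [hexp]
  have hi2 : Integrable (fun x : E => (inner ℝ x g : ℝ) • e) π :=
    (hI.inner_const g).smul_const e
  have hi3 : Integrable (fun x : E => (inner ℝ e g : ℝ) • (x - e)) π :=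
    (hI.sub (integrable_const e)).smul _
  have hi4 : Integrable (fun x : E => (inner ℝ x g : ℝ) • x - (inner ℝ x g : ℝ) • e) π := hq.sub hi2
  have h3 : ∫ x, (inner ℝ x g : ℝ) ∂π = inner ℝ e g := by
    simp only [real_inner_comm g]
    rw [integral_inner hI]
  rw [integral_sub hi4 hi3, integral_sub hq hi2, integral_smul, integral_sub hI (integrable_const e),
    integral_smul_const, h3]
  simp [e]

end SampleCov

end MLEnKF

namespace MLEnKF

/-! ### Resampling one coordinate of a product measure -/

section Resample

/-- This expresses freshness of a coordinate without conditioning: a quantity that ignores the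
coordinate i may be evaluated as if that coordinate were drawn anew. On a cylinder, the factor of i
is supplied by the new draw. -/
lemma measurePreserving_update {ι : Type*} [DecidableEq ι] {X : ι → Type*}
    [∀ i, MeasurableSpace (X i)] (μ : ∀ i, Measure (X i)) [∀ i, IsProbabilityMeasure (μ i)]
    (i : ι) : MeasurePreserving (fun z : (∀ i, X i) × X i => Function.update z.1 i z.2)
      ((Measure.infinitePi μ).prod (μ i)) (Measure.infinitePi μ) := by
  refine ⟨measurable_update', ?_⟩
  refine Measure.eq_infinitePi μ fun s t ht => ?_
  rw [Measure.map_apply measurable_update' (.pi s.countable_toSet fun j _ => ht j)]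
  by_cases hi : i ∈ s
  · have : (fun z : (∀ i, X i) × X i => Function.update z.1 i z.2) ⁻¹' (s : Set ι).pi t
        = ((s.erase i : Finset ι) : Set ι).pi t ×ˢ t i := by
      ext ⟨x, y⟩
      simp only [Set.mem_preimage, Set.mem_pi, Finset.mem_coe, Set.mem_prod, Finset.mem_erase]
      refine ⟨fun h => ⟨fun j hj => ?_, ?_⟩, fun h j hj => ?_⟩
      · simpa [Function.update_of_ne hj.1] using h j hj.2
      · simpa using h i hi
      · by_cases hji : j = i
        · subst hji; simpa using h.2
        · simpa [Function.update_of_ne hji] using h.1 j ⟨hji, hj⟩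
    rw [this, Measure.prod_prod, Measure.infinitePi_pi _ fun j _ => ht j, mul_comm,
      Finset.mul_prod_erase s (fun j => μ j (t j)) hi]
  · have : (fun z : (∀ i, X i) × X i => Function.update z.1 i z.2) ⁻¹' (s : Set ι).pi t
        = (s : Set ι).pi t ×ˢ Set.univ := by
      ext ⟨x, y⟩
      simp only [Set.mem_preimage, Set.mem_pi, Finset.mem_coe, Set.mem_prod, Set.mem_univ, and_true]
      refine forall₂_congr fun j hj => ?_
      have : j ≠ i := fun h => hi (h ▸ hj)
      simp [Function.update_of_ne this]
    rw [this, Measure.prod_prod, Measure.infinitePi_pi _ fun j _ => ht j]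
    simp

end Resample

namespace FilterModel

/-! ### Noise fields and the replacement of fresh noise. -/

section Laws

variable {𝓗 Ξ : Type*} [NormedAddCommGroup 𝓗] [InnerProductSpace ℝ 𝓗]
  [MeasurableSpace 𝓗] [MeasurableSpace Ξ] {m : ℕ} (S : FilterModel 𝓗 Ξ m)

instance : IsProbabilityMeasure S.μ₀ := S.isProb_μ₀

instance : IsProbabilityMeasure S.ν := S.isProb_ν

instance : IsProbabilityMeasure S.obsNoise := by unfold obsNoise; infer_instance

instance : IsProbabilityMeasure S.noiseLaw := by unfold noiseLaw; infer_instance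

/-- The law of the randomness of all particles. -/
noncomputable def fieldLaw : Measure (ℕ × ℕ → Noise 𝓗 Ξ m) :=
  Measure.infinitePi fun _ => S.noiseLaw

instance : IsProbabilityMeasure S.fieldLaw := by unfold fieldLaw; infer_instance

/-- Replace the noise of the transition `n` of a particle. -/
def setTime (n : ℕ) (w : Noise 𝓗 Ξ m) (x : Ξ × Obs m) : Noise 𝓗 Ξ m :=
  (w.1, Function.update w.2 n x)

lemma measurePreserving_setTime (n : ℕ) :
    MeasurePreserving (fun z : Noise 𝓗 Ξ m × (Ξ × Obs m) => setTime n z.1 z.2)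
      (S.noiseLaw.prod (S.ν.prod S.obsNoise)) S.noiseLaw :=
  ((MeasurePreserving.id S.μ₀).prod
    (measurePreserving_update (fun _ : ℕ => S.ν.prod S.obsNoise) n)).comp
    (measurePreserving_prodAssoc S.μ₀ _ _)

/-- Replace the noise of the transition `n` of the particle `q`. -/
def setAt (q : ℕ × ℕ) (n : ℕ) (w : ℕ × ℕ → Noise 𝓗 Ξ m) (x : Ξ × Obs m) :
    ℕ × ℕ → Noise 𝓗 Ξ m :=
  Function.update w q (setTime n (w q) x)

/-- The identity is checked after first resampling the whole particle `q`: overwriting a particle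
and then one of its times is the same as overwriting it with a particle whose time has been
replaced, and the latter is a composition of known measure preserving maps. -/
lemma measurePreserving_setAt (q : ℕ × ℕ) (n : ℕ) :
    MeasurePreserving (fun z : (ℕ × ℕ → Noise 𝓗 Ξ m) × (Ξ × Obs m) => setAt q n z.1 z.2)
      (S.fieldLaw.prod (S.ν.prod S.obsNoise)) S.fieldLaw := by
  have hT := measurePreserving_update (fun _ : ℕ × ℕ => S.noiseLaw) q
  have hTx := hT.prod (MeasurePreserving.id (S.ν.prod S.obsNoise))
  have hc := (hT.comp ((MeasurePreserving.id S.fieldLaw).prod (S.measurePreserving_setTime n))).comp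
    (measurePreserving_prodAssoc S.fieldLaw S.noiseLaw (S.ν.prod S.obsNoise))
  have hm : Measurable
      (fun z : (ℕ × ℕ → Noise 𝓗 Ξ m) × (Ξ × Obs m) => setAt q n z.1 z.2) := by
    refine (measurable_update' (a := q)).comp (measurable_fst.prodMk
      ((S.measurePreserving_setTime n).measurable.comp (Measurable.prodMk ?_ measurable_snd)))
    exact (measurable_pi_apply q).comp measurable_fst
  refine ⟨hm, ?_⟩
  have h1 : S.fieldLaw.prod (S.ν.prod S.obsNoise) = _ := hTx.map_eq.symm
  rw [h1, Measure.map_map hm hTx.measurable]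
  refine Eq.trans ?_ hc.map_eq
  congr 1
  funext z
  obtain ⟨⟨a, b⟩, c⟩ := z
  simp [setAt]
  rfl

lemma measurePreserving_eval_fieldLaw (q : ℕ × ℕ) :
    MeasurePreserving (fun w : ℕ × ℕ → Noise 𝓗 Ξ m => w q) S.fieldLaw S.noiseLaw :=
  measurePreserving_eval_infinitePi (fun _ : ℕ × ℕ => S.noiseLaw) q

/-- Replacing fresh noise by an independent copy does not change `L^p` norms. -/
lemma lpLE_of_fresh {α E : Type*} [MeasurableSpace α] [NormedAddCommGroup E] {μ : Measure α}
    [IsProbabilityMeasure μ] {T : α × (Ξ × Obs m) → α} {p B : ℝ}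
    (hT : MeasurePreserving T (μ.prod (S.ν.prod S.obsNoise)) μ) {F : α → E} {G : α × Ξ → E}
    (hFG : ∀ z, F (T z) = G (z.1, z.2.1)) (hF : AEStronglyMeasurable F μ)
    (hG : LpLE (μ.prod S.ν) p G B) : LpLE μ p F B := by
  have hpr : MeasurePreserving (fun z : α × (Ξ × Obs m) => (z.1, z.2.1))
      (μ.prod (S.ν.prod S.obsNoise)) (μ.prod S.ν) :=
    (MeasurePreserving.id μ).prod measurePreserving_fst
  refine LpLE.of_comp hT hF ?_
  simp only [hFG]
  exact hG.comp hpr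

end Laws

/-! ### The solver bounds on other probability spaces -/

section Transfer

variable {𝓗 Ξ : Type*} [NormedAddCommGroup 𝓗] [InnerProductSpace ℝ 𝓗]
  [SecondCountableTopology 𝓗] [MeasurableSpace 𝓗] [BorelSpace 𝓗] [MeasurableSpace Ξ] {m : ℕ}
  {S : FilterModel 𝓗 Ξ m} {α α' : Type*} [MeasurableSpace α] [MeasurableSpace α']
  {μ : Measure α} {μ' : Measure α'} [IsProbabilityMeasure μ] [IsProbabilityMeasure μ']

lemma aesm_solver {Φ : 𝓗 → Ξ → 𝓗} (hΦ : Measurable (Function.uncurry Φ)) {u : α → 𝓗}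
    (hu : AEStronglyMeasurable u μ) :
    AEStronglyMeasurable (fun z : α × Ξ => Φ (u z.1) z.2) (μ.prod S.ν) :=
  (hΦ.comp_aemeasurable ((hu.aemeasurable.comp_fst).prodMk
    measurable_snd.aemeasurable)).aestronglyMeasurable

variable {T : α → α'}

lemma eLpNorm_comp_fst (hT : MeasurePreserving T μ μ') (p : ℝ≥0∞) (g : α' × Ξ → 𝓗)
    (hg : AEStronglyMeasurable g (μ'.prod S.ν)) :
    eLpNorm (fun z : α × Ξ => g (T z.1, z.2)) p (μ.prod S.ν) = eLpNorm g p (μ'.prod S.ν) :=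
  eLpNorm_comp_measurePreserving hg (hT.prod (MeasurePreserving.id S.ν))

/-- The hypotheses concern random variables on one space only. A random variable on the target of a
measure preserving map pulls back with the same norms, so the bounds descend to the spaces of
noises. -/
lemma SolverBounds.of_measurePreserving (h : S.SolverBounds μ) (hT : MeasurePreserving T μ μ') :
    S.SolverBounds μ' := by
  refine ⟨fun p hp => ?_⟩
  obtain ⟨c, h1, h2⟩ := h.bounds p hp
  refine ⟨c, fun l u v hu hv => ?_, fun l u hu => ?_⟩
  · have := h1 l (u ∘ T) (v ∘ T) (hu.comp_measurePreserving hT) (hv.comp_measurePreserving hT)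
    have e1 := eLpNorm_comp_fst (S := S) hT (ENNReal.ofReal p)
      (fun z => S.Ψlev l (u z.1) z.2 - S.Ψlev l (v z.1) z.2)
      ((aesm_solver (S.measurable_Ψlev l) hu.1).sub (aesm_solver (S.measurable_Ψlev l) hv.1))
    have e2 := eLpNorm_comp_measurePreserving (p := ENNReal.ofReal p)
      (g := fun x => u x - v x) (hu.1.sub hv.1) hT
    rw [← e1, ← e2]
    exact this
  · have := h2 l (u ∘ T) (hu.comp_measurePreserving hT)
    have e1 := eLpNorm_comp_fst (S := S) hT (ENNReal.ofReal p) (fun z => S.Ψlev l (u z.1) z.2)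
      (aesm_solver (S.measurable_Ψlev l) hu.1)
    have e2 := eLpNorm_comp_measurePreserving (p := ENNReal.ofReal p) (g := u) hu.1 hT
    rw [← e1, ← e2]
    exact this

lemma MultilevelRates.of_measurePreserving {h costΨ : ℕ → ℝ} {d : ℕ} {κ β γ : ℝ}
    (hR : S.MultilevelRates μ h costΨ d κ β γ) (hT : MeasurePreserving T μ μ') :
    S.MultilevelRates μ' h costΨ d κ β γ := by
  refine ⟨hR.initial_memLp, hR.dim_growth, hR.resolution, hR.range_Ψlev, fun p hp u hu => ?_,
    hR.initial_rate, hR.cost_rate⟩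
  obtain ⟨C, hC⟩ := hR.solver_rate p hp (u ∘ T) (hu.comp_measurePreserving hT)
  refine ⟨C, fun l => ?_⟩
  rw [← eLpNorm_comp_fst (S := S) hT (ENNReal.ofReal p) (fun z => S.Ψlev l (u z.1) z.2 - S.Ψ (u z.1) z.2)
    ((aesm_solver (S.measurable_Ψlev l) hu.1).sub (aesm_solver S.measurable_Ψ hu.1))]
  exact hC l

/-- Lipschitz bounds in `L^p` with constant `c` for a random map. -/
def LipSolver (S : FilterModel 𝓗 Ξ m) (μ : Measure α) (p c : ℝ) (Φ : 𝓗 → Ξ → 𝓗) : Prop :=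
  ∀ (u v : α → 𝓗) (B : ℝ), MemLp u (ENNReal.ofReal p) μ → MemLp v (ENNReal.ofReal p) μ →
    LpLE μ p (fun w => u w - v w) B →
    LpLE (μ.prod S.ν) p (fun z => Φ (u z.1) z.2 - Φ (v z.1) z.2) (c * B)

lemma SolverBounds.exists_lipSolver (h : S.SolverBounds μ) {p : ℝ} (hp : 2 ≤ p) :
    ∃ c : ℝ, 0 ≤ c ∧ ∀ l, S.LipSolver μ p c (S.Ψlev l) ∧ S.LipSolver μ p c (prev S.Ψlev l) := by
  obtain ⟨c, h1, -⟩ := h.bounds p hp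
  have key : ∀ l, S.LipSolver μ p c (S.Ψlev l) := fun l u v B hu hv hd =>
    ⟨mul_nonneg c.2 hd.nonneg, (aesm_solver (S.measurable_Ψlev l) hu.1).sub
        (aesm_solver (S.measurable_Ψlev l) hv.1), (h1 l u v hu hv).trans (by
      rw [ENNReal.ofReal_mul c.coe_nonneg]
      simpa using mul_le_mul_right hd.le _)⟩
  refine ⟨c, c.2, fun l => ⟨key l, ?_⟩⟩
  cases l with
  | zero =>
    intro u v B hu hv hd
    simpa [prev] using LpLE.zero.mono (mul_nonneg c.2 hd.nonneg)
  | succ l => exact key l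

lemma SolverBounds.memLp (h : S.SolverBounds μ) {p : ℝ} (hp : 2 ≤ p) (l : ℕ) {u : α → 𝓗}
    (hu : MemLp u (ENNReal.ofReal p) μ) :
    MemLp (fun z : α × Ξ => S.Ψlev l (u z.1) z.2) (ENNReal.ofReal p) (μ.prod S.ν) := by
  obtain ⟨c, -, h2⟩ := h.bounds p hp
  refine ⟨aesm_solver (S.measurable_Ψlev l) hu.1, ?_⟩
  have h3 := (h2 l u hu).trans_lt (ENNReal.mul_lt_top ENNReal.coe_lt_top (ENNReal.add_lt_top.2
    ⟨ENNReal.one_lt_top, ENNReal.rpow_lt_top_of_nonneg (by linarith) hu.2.ne⟩))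
  by_contra hcon
  rw [not_lt, top_le_iff] at hcon
  rw [hcon, ENNReal.top_rpow_of_pos (by linarith)] at h3
  exact lt_irrefl _ h3

end Transfer

/-! ### Measurability and adaptedness of the ensemble -/

section Ensemble

variable {𝓗 Ξ : Type*} [NormedAddCommGroup 𝓗] [InnerProductSpace ℝ 𝓗] [CompleteSpace 𝓗]
  [MeasurableSpace 𝓗] [MeasurableSpace Ξ] {m : ℕ} (S : FilterModel 𝓗 Ξ m)

lemma obsMatrix_crossCov (C : 𝓗 →L[ℝ] 𝓗) (i j : Fin m) :
    S.obsMatrix (S.crossCov C) i j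
      = inner ℝ (ContinuousLinearMap.adjoint S.H (EuclideanSpace.single i 1))
        (C (ContinuousLinearMap.adjoint S.H (EuclideanSpace.single j 1))) := by
  rw [ContinuousLinearMap.adjoint_inner_left, EuclideanSpace.inner_single_left]
  simp [obsMatrix, crossCov]

lemma isHermitian_obsMatrix_crossCov {C : 𝓗 →L[ℝ] 𝓗}
    (hC : ∀ x y, inner ℝ (C x) y = (inner ℝ x (C y) : ℝ)) :
    (S.obsMatrix (S.crossCov C)).IsHermitian := by
  ext i j
  rw [Matrix.conjTranspose_apply, obsMatrix_crossCov, obsMatrix_crossCov, ← hC, star_trivial,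
    real_inner_comm]

lemma inner_sampleCov_comm (M : ℕ) (v : ℕ → 𝓗) (x y : 𝓗) :
    inner ℝ (sampleCov M v x) y = (inner ℝ x (sampleCov M v y) : ℝ) := by
  rw [sampleCov_apply, sampleCov_apply, real_inner_smul_left, real_inner_smul_right,
    inner_sub_left, inner_sub_right, real_inner_smul_left, real_inner_smul_right]
  simp only [sampleMean, real_inner_smul_left, real_inner_smul_right, sum_inner, inner_sum,
    real_inner_comm x, mul_comm]

lemma inner_mlCov_comm (L : ℕ) (M : ℕ → ℕ) (v : ℕ → ℕ → 𝓗 × 𝓗) (x y : 𝓗) :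
    inner ℝ (mlCov L M v x) y = (inner ℝ x (mlCov L M v y) : ℝ) := by
  simp only [mlCov, _root_.sum_apply, _root_.sub_apply, sum_inner, inner_sum, inner_sub_left,
    inner_sub_right, inner_sampleCov_comm]

/-- The multilevel covariance may be indefinite, but it is symmetric, so symmetrizing changes
nothing. This matters because `posPartMatrix` is set to zero off the symmetric matrices and hence is
not continuous on all matrices. -/
lemma mlGain_eq_symGain (L : ℕ) (M : ℕ → ℕ) (v : ℕ → ℕ → 𝓗 × 𝓗) :
    S.mlGain L M v = S.symGain (S.crossCov (mlCov L M v)) := by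
  rw [mlGain, symGain, symObsMatrix_of_isHermitian _
    (S.isHermitian_obsMatrix_crossCov (inner_mlCov_comm L M v))]

/-- Adaptedness: the update at time n uses the noises of earlier transitions only. -/
lemma ensemble_congr {L : ℕ} {M : ℕ → ℕ} {w w' : ℕ → ℕ → Noise 𝓗 Ξ m} {n : ℕ}
    (h0 : ∀ l i, (w l i).1 = (w' l i).1)
    (h : ∀ l i, ∀ k < n, (w l i).2 k = (w' l i).2 k) :
    S.ensemble L M w n = S.ensemble L M w' n := by
  induction n with
  | zero => funext l i; simp [ensemble, h0]
  | succ n ih =>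
    have e := ih fun l i k hk => h l i k (by omega)
    have hn : ∀ l i, (w l i).2 n = (w' l i).2 n := fun l i => h l i n (by omega)
    simp only [ensemble, e, hn]

/-- The ensemble as a function of the whole field of noises. -/
noncomputable def ens (L : ℕ) (M : ℕ → ℕ) (n : ℕ) (l i : ℕ) (w : ℕ × ℕ → Noise 𝓗 Ξ m) : 𝓗 × 𝓗 :=
  S.ensemble L M (fun l i => w (l, i)) n l i

/-- The predicted ensemble. -/
noncomputable def ensPred (L : ℕ) (M : ℕ → ℕ) (n : ℕ) (l i : ℕ) (w : ℕ × ℕ → Noise 𝓗 Ξ m) :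
    𝓗 × 𝓗 :=
  (S.Ψlev l (S.ens L M n l i w).1 ((w (l, i)).2 n).1,
    prev S.Ψlev l (S.ens L M n l i w).2 ((w (l, i)).2 n).1)

/-- The multilevel gain of the predicted ensemble. -/
noncomputable def ensGain (L : ℕ) (M : ℕ → ℕ) (n : ℕ) (w : ℕ × ℕ → Noise 𝓗 Ξ m) : Obs m →L[ℝ] 𝓗 :=
  S.mlGain L M fun l i => S.ensPred L M n l i w

lemma ens_zero (L : ℕ) (M : ℕ → ℕ) (l i : ℕ) (w : ℕ × ℕ → Noise 𝓗 Ξ m) :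
    S.ens L M 0 l i w = (S.P l (w (l, i)).1, prev S.P l (w (l, i)).1) := rfl

lemma ens_setAt (L : ℕ) (M : ℕ → ℕ) (n l i : ℕ) (q : ℕ × ℕ) (w : ℕ × ℕ → Noise 𝓗 Ξ m)
    (x : Ξ × Obs m) : S.ens L M n l i (setAt q n w x) = S.ens L M n l i w := by
  have h : ∀ q', (setAt q n w x q').1 = (w q').1 ∧ ∀ k < n, (setAt q n w x q').2 k = (w q').2 k := by
    intro q'
    by_cases hq : q' = q
    · subst hq
      refine ⟨by simp [setAt, setTime], fun k hk => ?_⟩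
      simp [setAt, setTime, Function.update_of_ne hk.ne]
    · simp [setAt, Function.update_of_ne hq]
  exact congrFun (congrFun (S.ensemble_congr (fun l i => (h (l, i)).1)
    fun l i k hk => (h (l, i)).2 k hk) l) i

lemma setAt_self (q : ℕ × ℕ) (n : ℕ) (w : ℕ × ℕ → Noise 𝓗 Ξ m) (x : Ξ × Obs m) :
    (setAt q n w x q).2 n = x := by
  simp [setAt, setTime]

variable [BorelSpace 𝓗] [SecondCountableTopology 𝓗]

/-- Bounded operators on an infinite-dimensional space do not form a separable space, so
measurability of operators is carried in the strong form. -/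
lemma stronglyMeasurable_sampleCov {α : Type*} [MeasurableSpace α] (M : ℕ) {v : α → ℕ → 𝓗}
    (hv : ∀ i, Measurable fun w => v w i) : StronglyMeasurable fun w => sampleCov M (v w) := by
  have hr : ∀ {f : α → 𝓗}, Measurable f →
      StronglyMeasurable fun w => InnerProductSpace.rankOne ℝ (f w) (f w) := fun hf =>
    continuous_rankOne.comp_stronglyMeasurable (hf.stronglyMeasurable.prodMk hf.stronglyMeasurable)
  have hm : Measurable fun w => sampleMean M (v w) :=
    (Finset.measurable_sum _ fun i _ => hv i).const_smul _
  have h1 : StronglyMeasurable fun w => sampleMean M fun i =>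
      InnerProductSpace.rankOne ℝ (v w i) (v w i) :=
    (Finset.stronglyMeasurable_fun_sum (Finset.range M) fun i _ => hr (hv i)).const_smul
      ((M : ℝ)⁻¹)
  exact (h1.sub (hr hm)).const_smul ((M : ℝ) / (M - 1))

lemma stronglyMeasurable_mlGain {α : Type*} [MeasurableSpace α] (L : ℕ) (M : ℕ → ℕ)
    {v : α → ℕ → ℕ → 𝓗 × 𝓗} (hv : ∀ l i, Measurable fun w => v w l i) :
    StronglyMeasurable fun w => S.mlGain L M (v w) := by
  have hC : StronglyMeasurable fun w => mlCov L M (v w) :=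
    Finset.stronglyMeasurable_fun_sum _ fun l _ =>
      (stronglyMeasurable_sampleCov _ fun i => (hv l i).fst).sub
        (stronglyMeasurable_sampleCov _ fun i => (hv l i).snd)
  simp only [mlGain_eq_symGain]
  have hc : Continuous fun C : 𝓗 →L[ℝ] 𝓗 => S.symGain (S.crossCov C) :=
    S.continuous_symGain.comp (continuous_id.clm_comp continuous_const)
  exact hc.comp_stronglyMeasurable hC

lemma measurable_noise_fst (q : ℕ × ℕ) (n : ℕ) :
    Measurable fun w : ℕ × ℕ → Noise 𝓗 Ξ m => ((w q).2 n).1 := by fun_prop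

lemma measurable_noise_snd (q : ℕ × ℕ) (n : ℕ) :
    Measurable fun w : ℕ × ℕ → Noise 𝓗 Ξ m => ((w q).2 n).2 := by fun_prop

lemma measurable_prev_Ψlev (l : ℕ) : Measurable (Function.uncurry (prev S.Ψlev l)) := by
  cases l with
  | zero => exact measurable_const
  | succ l => exact S.measurable_Ψlev l

lemma measurable_updateState {α : Type*} [MeasurableSpace α] (Q : 𝓗 →L[ℝ] 𝓗)
    {K : α → Obs m →L[ℝ] 𝓗} {y : α → Obs m} {v : α → 𝓗} (hK : StronglyMeasurable K)
    (hy : Measurable y) (hv : Measurable v) :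
    Measurable fun w => S.updateState Q (K w) (y w) (v w) := by
  have happ : ∀ {z : α → Obs m}, Measurable z → Measurable fun w => K w (z w) := fun hz =>
    ((isBoundedBilinearMap_apply (𝕜 := ℝ) (E := Obs m) (F := 𝓗)).continuous.comp_stronglyMeasurable
      (hK.prodMk hz.stronglyMeasurable)).measurable
  exact (hv.sub (Q.continuous.measurable.comp (happ (S.H.continuous.measurable.comp hv)))).add
    (Q.continuous.measurable.comp (happ hy))

lemma measurable_ens (L : ℕ) (M : ℕ → ℕ) (n l i : ℕ) : Measurable (S.ens L M n l i) := by
  induction n generalizing l i with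
  | zero =>
    have hw : Measurable fun w : ℕ × ℕ → Noise 𝓗 Ξ m => (w (l, i)).1 := by fun_prop
    exact ((S.P l).continuous.measurable.comp hw).prodMk
      ((prev S.P l).continuous.measurable.comp hw)
  | succ n ih =>
    have hP : ∀ l i, Measurable fun w => S.ensPred L M n l i w := fun l i =>
      ((S.measurable_Ψlev l).comp ((ih l i).fst.prodMk (measurable_noise_fst _ n))).prodMk
        ((S.measurable_prev_Ψlev l).comp ((ih l i).snd.prodMk (measurable_noise_fst _ n)))
    have hK := S.stronglyMeasurable_mlGain L M hP
    have hy : Measurable fun w : ℕ × ℕ → Noise 𝓗 Ξ m => S.y (n + 1) + ((w (l, i)).2 n).2 :=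
      (measurable_noise_snd _ n).const_add _
    exact (S.measurable_updateState _ hK hy (hP l i).fst).prodMk
      (S.measurable_updateState _ hK hy (hP l i).snd)

lemma measurable_ensPred (L : ℕ) (M : ℕ → ℕ) (n l i : ℕ) : Measurable (S.ensPred L M n l i) :=
  ((S.measurable_Ψlev l).comp ((S.measurable_ens L M n l i).fst.prodMk
    (measurable_noise_fst _ n))).prodMk
    ((S.measurable_prev_Ψlev l).comp ((S.measurable_ens L M n l i).snd.prodMk
      (measurable_noise_fst _ n)))

lemma stronglyMeasurable_ensGain (L : ℕ) (M : ℕ → ℕ) (n : ℕ) :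
    StronglyMeasurable (S.ensGain L M n) :=
  S.stronglyMeasurable_mlGain L M (S.measurable_ensPred L M n)

end Ensemble

end FilterModel

end MLEnKF

namespace MLEnKF

lemma _root_.MeasureTheory.MeasurePreserving.of_comp_left {α β γ : Type*} [MeasurableSpace α]
    [MeasurableSpace β] [MeasurableSpace γ] {μ : Measure α} {ν : Measure β} {π : Measure γ}
    {T : α → β} {F : β → γ} (hT : MeasurePreserving T μ ν) (hF : Measurable F)
    (h : MeasurePreserving (F ∘ T) μ π) : MeasurePreserving F ν π :=
  ⟨hF, by rw [← hT.map_eq, Measure.map_map hF hT.measurable, h.map_eq]⟩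

namespace FilterModel

/-! ### The projections and the mean-field gain -/

section Gain

variable {𝓗 Ξ : Type*} [NormedAddCommGroup 𝓗] [InnerProductSpace ℝ 𝓗] [CompleteSpace 𝓗]
  [MeasurableSpace 𝓗] [MeasurableSpace Ξ] {m : ℕ} (S : FilterModel 𝓗 Ξ m)

lemma norm_P_le_one (l : ℕ) : ‖S.P l‖ ≤ 1 := by
  refine ContinuousLinearMap.opNorm_le_bound _ zero_le_one fun x => ?_
  have h1 : S.P l x = ∑ k ∈ Finset.range (S.N l), (inner ℝ (S.basis k) x : ℝ) • S.basis k := by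
    simp [P]
  have h2 : ‖S.P l x‖ ^ 2 ≤ ‖x‖ ^ 2 := by
    refine le_trans (le_of_eq ?_) (S.basis.orthonormal.sum_inner_products_le x
      (s := Finset.range (S.N l)))
    rw [← real_inner_self_eq_norm_sq, h1, S.basis.orthonormal.inner_sum]
    refine Finset.sum_congr rfl fun k _ => ?_
    simp [sq]
  rw [one_mul]
  exact (sq_le_sq₀ (norm_nonneg _) (norm_nonneg _)).1 h2

lemma norm_prev_P_le_one (l : ℕ) : ‖prev S.P l‖ ≤ 1 := by
  cases l with
  | zero => simp [prev]
  | succ l => exact S.norm_P_le_one l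

/-- Up to the factor 1 + ‖P‖ ≤ 2 the projection is as good as any approximant in its range. This
turns the rate of the solver into a rate for the projections. -/
lemma norm_sub_P_le (l : ℕ) {x z : 𝓗} (hz : S.P l z = z) : ‖x - S.P l x‖ ≤ 2 * ‖x - z‖ := by
  have : x - S.P l x = (x - z) - S.P l (x - z) := by rw [map_sub, hz]; abel
  rw [this]
  refine (norm_sub_le _ _).trans ?_
  have := (S.P l).le_of_opNorm_le (S.norm_P_le_one l) (x - z)
  linarith

lemma toEuclideanCLM_obsMatrix (R : Obs m →L[ℝ] 𝓗) :
    Matrix.toEuclideanCLM (𝕜 := ℝ) (S.obsMatrix R) = S.H ∘L R := by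
  ext x i
  have hx : x = ∑ j, x j • EuclideanSpace.single j (1 : ℝ) := by
    have := ((EuclideanSpace.basisFun (Fin m) ℝ).sum_repr x).symm
    simpa using this
  conv_rhs => rw [hx]
  simp [Matrix.ofLp_toEuclideanCLM, Matrix.mulVec, dotProduct, obsMatrix, mul_comm]

variable [BorelSpace 𝓗] [SecondCountableTopology 𝓗]

lemma posSemidef_obsMatrix_covOp {π : Measure 𝓗} [IsProbabilityMeasure π]
    (hπ : MemLp (fun x : 𝓗 => x) 2 π) : (S.obsMatrix (S.crossCov (covOp π))).PosSemidef := by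
  have hsymm : ∀ x y, inner ℝ (covOp π x) y = (inner ℝ x (covOp π y) : ℝ) := fun x y => by
    rw [real_inner_comm, inner_covOp hπ, inner_covOp hπ]
    simp only [mul_comm]
  refine Matrix.PosSemidef.of_dotProduct_mulVec_nonneg
    (S.isHermitian_obsMatrix_crossCov hsymm) fun x => ?_
  have h1 := Matrix.inner_toEuclideanCLM (S.obsMatrix (S.crossCov (covOp π)))
    (WithLp.toLp 2 x) (WithLp.toLp 2 x)
  rw [toEuclideanCLM_obsMatrix] at h1
  rw [star_trivial]
  refine le_of_le_of_eq ?_ h1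
  rw [ContinuousLinearMap.comp_apply, ← ContinuousLinearMap.adjoint_inner_left, crossCov,
    ContinuousLinearMap.comp_apply, inner_covOp hπ]
  exact integral_nonneg fun z => mul_self_nonneg _

/-- A true covariance gives a positive semidefinite H C H*, on which the positive part is inert. The
mean-field and multilevel gains are thus values of a single locally Lipschitz function at two cross
covariances. -/
lemma meanFieldGain_eq_symGain {π : Measure 𝓗} [IsProbabilityMeasure π]
    (hπ : MemLp (fun x : 𝓗 => x) 2 π) : S.meanFieldGain π = S.symGain (S.crossCov (covOp π)) := by
  have h := S.posSemidef_obsMatrix_covOp hπ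
  rw [meanFieldGain, symGain, S.symObsMatrix_of_isHermitian h.isHermitian,
    posPartMatrix_of_posSemidef h]

end Gain

/-! ### Particles driven by the mean-field gains -/

section Particle

variable {𝓗 Ξ : Type*} [NormedAddCommGroup 𝓗] [InnerProductSpace ℝ 𝓗] [CompleteSpace 𝓗]
  [MeasurableSpace 𝓗] [MeasurableSpace Ξ] {m : ℕ} (S : FilterModel 𝓗 Ξ m)

/-- The mean-field gain of the transition `n`. -/
noncomputable def gainAt (n : ℕ) : Obs m →L[ℝ] 𝓗 :=
  S.meanFieldGain (S.predictLaw (S.meanFieldLaw n))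

/-- The state with forward map `Φ` and projection `Q`, updated with the mean-field gains. -/
noncomputable def particle (Φ : 𝓗 → Ξ → 𝓗) (Q : 𝓗 →L[ℝ] 𝓗) : ℕ → Noise 𝓗 Ξ m → 𝓗
  | 0, w => Q w.1
  | n + 1, w => S.updateState Q (S.gainAt n) (S.y (n + 1) + (w.2 n).2)
      (Φ (particle Φ Q n w) (w.2 n).1)

/-- The predicted state with forward map `Φ` and projection `Q`. -/
noncomputable def predicted (Φ : 𝓗 → Ξ → 𝓗) (Q : 𝓗 →L[ℝ] 𝓗) (n : ℕ) (w : Noise 𝓗 Ξ m) : 𝓗 :=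
  Φ (S.particle Φ Q n w) (w.2 n).1

lemma particle_succ (Φ : 𝓗 → Ξ → 𝓗) (Q : 𝓗 →L[ℝ] 𝓗) (n : ℕ) (w : Noise 𝓗 Ξ m) :
    S.particle Φ Q (n + 1) w = S.updateState Q (S.gainAt n) (S.y (n + 1) + (w.2 n).2)
      (S.predicted Φ Q n w) := rfl

lemma particle_congr (Φ : 𝓗 → Ξ → 𝓗) (Q : 𝓗 →L[ℝ] 𝓗) {n : ℕ} {w w' : Noise 𝓗 Ξ m}
    (h0 : w.1 = w'.1) (h : ∀ k < n, w.2 k = w'.2 k) : S.particle Φ Q n w = S.particle Φ Q n w' := by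
  induction n with
  | zero => simp [particle, h0]
  | succ n ih =>
    simp only [particle, ih fun k hk => h k (by omega), h n (by omega)]

lemma particle_setTime (Φ : 𝓗 → Ξ → 𝓗) (Q : 𝓗 →L[ℝ] 𝓗) (n : ℕ) (w : Noise 𝓗 Ξ m)
    (x : Ξ × Obs m) : S.particle Φ Q n (setTime n w x) = S.particle Φ Q n w :=
  S.particle_congr Φ Q rfl fun k hk => by simp [setTime, Function.update_of_ne hk.ne]

lemma setTime_self (n : ℕ) (w : Noise 𝓗 Ξ m) (x : Ξ × Obs m) : (setTime n w x).2 n = x := by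
  simp [setTime]

/-- With zero map and zero projection the affine update leaves 0 fixed; this is the convention for
level -1, and it keeps the pair formulas uniform in l. -/
lemma particle_zero_map (n : ℕ) (w : Noise 𝓗 Ξ m) : S.particle 0 0 n w = 0 := by
  cases n with
  | zero => rfl
  | succ n => simp [particle, updateState]

variable [BorelSpace 𝓗] [SecondCountableTopology 𝓗]

lemma measurable_particle {Φ : 𝓗 → Ξ → 𝓗} (hΦ : Measurable (Function.uncurry Φ)) (Q : 𝓗 →L[ℝ] 𝓗)
    (n : ℕ) : Measurable (S.particle Φ Q n) := by
  induction n with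
  | zero => exact Q.continuous.measurable.comp measurable_fst
  | succ n ih =>
    refine S.measurable_updateState Q stronglyMeasurable_const ?_ (hΦ.comp (ih.prodMk ?_))
    · exact Measurable.const_add (by fun_prop) _
    · fun_prop

lemma measurable_predicted {Φ : 𝓗 → Ξ → 𝓗} (hΦ : Measurable (Function.uncurry Φ)) (Q : 𝓗 →L[ℝ] 𝓗)
    (n : ℕ) : Measurable (S.predicted Φ Q n) :=
  hΦ.comp ((S.measurable_particle hΦ Q n).prodMk (by fun_prop))

lemma isProbabilityMeasure_predictLaw (π : Measure 𝓗) [IsProbabilityMeasure π] :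
    IsProbabilityMeasure (S.predictLaw π) :=
  Measure.isProbabilityMeasure_map S.measurable_Ψ.aemeasurable

lemma measurable_updateLaw_map (y : Obs m) (π : Measure 𝓗) :
    Measurable fun z : 𝓗 × Obs m =>
      z.1 - S.meanFieldGain π (S.H z.1) + S.meanFieldGain π (y + z.2) := by
  have h1 := (S.meanFieldGain π).continuous.measurable
  have h2 := S.H.continuous.measurable
  exact (measurable_fst.sub (h1.comp (h2.comp measurable_fst))).add
    (h1.comp (measurable_snd.const_add y))

instance isProbabilityMeasure_meanFieldLaw (n : ℕ) : IsProbabilityMeasure (S.meanFieldLaw n) := by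
  induction n with
  | zero => exact S.isProb_μ₀
  | succ n ih =>
    have := S.isProbabilityMeasure_predictLaw (S.meanFieldLaw n)
    exact Measure.isProbabilityMeasure_map (S.measurable_updateLaw_map _ _).aemeasurable

instance isProbabilityMeasure_predictLaw_meanFieldLaw (n : ℕ) :
    IsProbabilityMeasure (S.predictLaw (S.meanFieldLaw n)) :=
  S.isProbabilityMeasure_predictLaw _

lemma measurePreserving_predictLaw (π : Measure 𝓗) :
    MeasurePreserving (fun z : 𝓗 × Ξ => S.Ψ z.1 z.2) (π.prod S.ν) (S.predictLaw π) :=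
  ⟨S.measurable_Ψ, rfl⟩

lemma measurePreserving_fst_noise :
    MeasurePreserving (fun w : Noise 𝓗 Ξ m => w.1) S.noiseLaw S.μ₀ :=
  measurePreserving_fst

lemma measurePreserving_obs_noise (n : ℕ) :
    MeasurePreserving (fun w : Noise 𝓗 Ξ m => (w.2 n).2) S.noiseLaw S.obsNoise :=
  measurePreserving_snd.comp ((measurePreserving_eval_infinitePi
    (fun _ : ℕ => S.ν.prod S.obsNoise) n).comp measurePreserving_snd)

/-- The mean-field law is the law of the mean-field particle. -/
lemma measurePreserving_particle (n : ℕ) :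
    MeasurePreserving (S.particle S.Ψ (ContinuousLinearMap.id ℝ 𝓗) n) S.noiseLaw
      (S.meanFieldLaw n) := by
  induction n with
  | zero => exact S.measurePreserving_fst_noise
  | succ n ih =>
    -- Redrawing the noise of the transition n leaves the state at time n unchanged and makes its
    -- independence explicit as a product measure, the form in which the mean-field law is defined.
    refine (S.measurePreserving_setTime n).of_comp_left
      (S.measurable_particle S.measurable_Ψ _ _) ?_
    have := S.isProbabilityMeasure_predictLaw (S.meanFieldLaw n)
    have h1 : MeasurePreserving _ _ (S.meanFieldLaw (n + 1)) :=
      ⟨S.measurable_updateLaw_map (S.y (n + 1)) (S.predictLaw (S.meanFieldLaw n)), rfl⟩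
    have h2 := (S.measurePreserving_predictLaw (S.meanFieldLaw n)).prod
      (MeasurePreserving.id S.obsNoise)
    have h3 := (measurePreserving_prodAssoc (S.meanFieldLaw n) S.ν S.obsNoise).symm
    have h4 := ih.prod (MeasurePreserving.id (S.ν.prod S.obsNoise))
    have h5 := ((h1.comp h2).comp h3).comp h4
    convert h5 using 1
    funext ⟨w, x⟩
    simp only [Function.comp, particle_succ, predicted, particle_setTime, setTime_self]
    rfl

lemma measurePreserving_predicted (n : ℕ) :
    MeasurePreserving (S.predicted S.Ψ (ContinuousLinearMap.id ℝ 𝓗) n) S.noiseLaw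
      (S.predictLaw (S.meanFieldLaw n)) := by
  refine (S.measurePreserving_setTime n).of_comp_left
    (S.measurable_predicted S.measurable_Ψ _ _) ?_
  have h4 := (S.measurePreserving_particle n).prod
    (measurePreserving_fst (μ := S.ν) (ν := S.obsNoise))
  have h5 := (S.measurePreserving_predictLaw (S.meanFieldLaw n)).comp h4
  convert h5 using 1
  funext ⟨w, x⟩
  simp only [Function.comp, predicted, particle_setTime, setTime_self]
  rfl

end Particle

end FilterModel

end MLEnKF

namespace MLEnKF

namespace FilterModel

/-! ### Convergence rates of the mean-field particles -/

section Rates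

variable {𝓗 Ξ : Type*} [NormedAddCommGroup 𝓗] [InnerProductSpace ℝ 𝓗] [CompleteSpace 𝓗]
  [SecondCountableTopology 𝓗] [MeasurableSpace 𝓗] [BorelSpace 𝓗] [MeasurableSpace Ξ] {m : ℕ}

/-- Geometric convergence rates of the discretization. -/
structure LevelRates (S : FilterModel 𝓗 Ξ m) (r : ℝ) : Prop where
  pos : 0 < r
  lt_one : r < 1
  initial_memLp : ∀ p : ℝ, 2 ≤ p → MemLp (fun x : 𝓗 => x) (ENNReal.ofReal p) S.μ₀
  range_Ψlev : ∀ l x, ∀ᵐ ξ ∂S.ν, S.P l (S.Ψlev l x ξ) = S.Ψlev l x ξ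
  solver_rate : ∀ p : ℝ, 2 ≤ p → ∀ u : Noise 𝓗 Ξ m → 𝓗, MemLp u (ENNReal.ofReal p) S.noiseLaw →
    ∃ C : ℝ, 0 ≤ C ∧ ∀ l, LpLE (S.noiseLaw.prod S.ν) p
      (fun z => S.Ψlev l (u z.1) z.2 - S.Ψ (u z.1) z.2) (C * r ^ l)
  initial_rate : ∀ p : ℝ, 2 ≤ p → ∃ C : ℝ, 0 ≤ C ∧ ∀ l,
    LpLE S.μ₀ p (fun x : 𝓗 => x - S.P l x) (C * r ^ l)

variable {S : FilterModel 𝓗 Ξ m} {r : ℝ}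

lemma memLp_obs_noise (S : FilterModel 𝓗 Ξ m) (n : ℕ) (p : ℝ) :
    MemLp (fun w : Noise 𝓗 Ξ m => S.y (n + 1) + (w.2 n).2) (ENNReal.ofReal p) S.noiseLaw := by
  have h1 : MemLp id (ENNReal.ofReal p) S.obsNoise := by
    unfold obsNoise; exact IsGaussian.memLp_id _ _ ENNReal.ofReal_ne_top
  exact (memLp_const (S.y (n + 1))).add (h1.comp_measurePreserving (S.measurePreserving_obs_noise n))

/-- No moment bound is assumed for `Ψ` itself. It is written as the level 0 solver minus the level 0
error: the first is bounded by stability, the second by the convergence rate. -/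
lemma memLp_limit (hS : S.SolverBounds S.noiseLaw) (hR : S.LevelRates r) {p : ℝ} (hp : 2 ≤ p)
    (n : ℕ) : MemLp (S.particle S.Ψ (ContinuousLinearMap.id ℝ 𝓗) n) (ENNReal.ofReal p) S.noiseLaw ∧
      MemLp (S.predicted S.Ψ (ContinuousLinearMap.id ℝ 𝓗) n) (ENNReal.ofReal p) S.noiseLaw := by
  have key : ∀ n, MemLp (S.particle S.Ψ (ContinuousLinearMap.id ℝ 𝓗) n) (ENNReal.ofReal p)
      S.noiseLaw → MemLp (S.predicted S.Ψ (ContinuousLinearMap.id ℝ 𝓗) n) (ENNReal.ofReal p)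
      S.noiseLaw := by
    intro n hn
    obtain ⟨C, -, hC⟩ := hR.solver_rate p hp _ hn
    obtain ⟨B, hB⟩ := ((hS.memLp hp 0 hn).sub (hC 0).memLp).exists_lpLE
    refine (S.lpLE_of_fresh (S.measurePreserving_setTime n) (fun z => ?_)
      (S.measurable_predicted S.measurable_Ψ _ n).aestronglyMeasurable hB).memLp
    simp [predicted, particle_setTime, setTime_self]
  have main : MemLp (S.particle S.Ψ (ContinuousLinearMap.id ℝ 𝓗) n) (ENNReal.ofReal p)
      S.noiseLaw := by
    induction n with
    | zero => exact (hR.initial_memLp p hp).comp_measurePreserving S.measurePreserving_fst_noise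
    | succ n ih =>
      have h1 := key n ih
      exact (h1.sub (((S.gainAt n).comp S.H).comp_memLp' h1)).add
        ((S.gainAt n).comp_memLp' (S.memLp_obs_noise n p))
  exact ⟨main, key n main⟩

lemma memLp_id_predictLaw (hS : S.SolverBounds S.noiseLaw) (hR : S.LevelRates r) {p : ℝ}
    (hp : 2 ≤ p) (n : ℕ) :
    MemLp (fun x : 𝓗 => x) (ENNReal.ofReal p) (S.predictLaw (S.meanFieldLaw n)) := by
  have hmp := S.measurePreserving_predicted n
  have h := (memLp_map_measure_iff (μ := S.noiseLaw) (g := fun x : 𝓗 => x) (p := ENNReal.ofReal p)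
    aestronglyMeasurable_id hmp.measurable.aemeasurable).2 (memLp_limit hS hR hp n).2
  rwa [hmp.map_eq] at h

lemma memLp_two_id_predictLaw (hS : S.SolverBounds S.noiseLaw) (hR : S.LevelRates r) (n : ℕ) :
    MemLp (fun x : 𝓗 => x) 2 (S.predictLaw (S.meanFieldLaw n)) := by
  simpa using memLp_id_predictLaw hS hR le_rfl n

lemma gainAt_eq_symGain (hS : S.SolverBounds S.noiseLaw) (hR : S.LevelRates r) (n : ℕ) :
    S.gainAt n = S.symGain (S.crossCov (covOp (S.predictLaw (S.meanFieldLaw n)))) :=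
  S.meanFieldGain_eq_symGain (memLp_two_id_predictLaw hS hR n)

/-- The covariance of the prediction in terms of the mean-field particle. -/
lemma covOp_predictLaw_apply (hS : S.SolverBounds S.noiseLaw) (hR : S.LevelRates r) (n : ℕ)
    (g : 𝓗) : covOp (S.predictLaw (S.meanFieldLaw n)) g
      = ∫ w, (inner ℝ (S.predicted S.Ψ (ContinuousLinearMap.id ℝ 𝓗) n w) g : ℝ) •
          S.predicted S.Ψ (ContinuousLinearMap.id ℝ 𝓗) n w ∂S.noiseLaw
        - (inner ℝ (∫ w, S.predicted S.Ψ (ContinuousLinearMap.id ℝ 𝓗) n w ∂S.noiseLaw) g : ℝ) •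
          ∫ w, S.predicted S.Ψ (ContinuousLinearMap.id ℝ 𝓗) n w ∂S.noiseLaw := by
  have hmp := S.measurePreserving_predicted n
  rw [covOp_apply (memLp_two_id_predictLaw hS hR n)]
  have h1 := integral_map (μ := S.noiseLaw) hmp.measurable.aemeasurable
    (f := fun x : 𝓗 => (inner ℝ x g : ℝ) • x) (by fun_prop)
  have h2 := integral_map (μ := S.noiseLaw) hmp.measurable.aemeasurable (f := fun x : 𝓗 => x) (by fun_prop)
  rw [hmp.map_eq] at h1 h2
  rw [h1, h2]

lemma ae_P_Ψlev (hR : S.LevelRates r) {u : Noise 𝓗 Ξ m → 𝓗} (hu : Measurable u) (l : ℕ) :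
    ∀ᵐ z ∂(S.noiseLaw.prod S.ν), S.P l (S.Ψlev l (u z.1) z.2) = S.Ψlev l (u z.1) z.2 := by
  have hm : Measurable fun z : Noise 𝓗 Ξ m × Ξ => S.Ψlev l (u z.1) z.2 :=
    (S.measurable_Ψlev l).comp ((hu.comp measurable_fst).prodMk measurable_snd)
  have hs : MeasurableSet {z : Noise 𝓗 Ξ m × Ξ |
      S.P l (S.Ψlev l (u z.1) z.2) = S.Ψlev l (u z.1) z.2} :=
    measurableSet_eq_fun ((S.P l).continuous.measurable.comp hm) hm
  rw [Measure.ae_prod_iff_ae_ae hs]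
  exact ae_of_all _ fun w => hR.range_Ψlev l (u w)

/-- The prediction is approximated by its projections. -/
lemma exists_predicted_sub_P_le (hS : S.SolverBounds S.noiseLaw) (hR : S.LevelRates r) {p : ℝ}
    (hp : 2 ≤ p) (n : ℕ) : ∃ C : ℝ, 0 ≤ C ∧ ∀ l, LpLE S.noiseLaw p
      (fun w => S.predicted S.Ψ (ContinuousLinearMap.id ℝ 𝓗) n w
        - S.P l (S.predicted S.Ψ (ContinuousLinearMap.id ℝ 𝓗) n w)) (C * r ^ l) := by
  set I := ContinuousLinearMap.id ℝ 𝓗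
  obtain ⟨C, hC, h⟩ := hR.solver_rate p hp _ (memLp_limit hS hR hp n).1
  refine ⟨2 * C, by positivity, fun l => ?_⟩
  have hm := S.measurable_predicted S.measurable_Ψ I n
  have hu := S.measurable_particle S.measurable_Ψ I n
  refine S.lpLE_of_fresh (S.measurePreserving_setTime n)
    (G := fun z => S.Ψ (S.particle S.Ψ I n z.1) z.2 - S.P l (S.Ψ (S.particle S.Ψ I n z.1) z.2))
    (fun z => by simp [predicted, particle_setTime, setTime_self])
    (hm.sub ((S.P l).continuous.measurable.comp hm)).aestronglyMeasurable ?_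
  have hΨ : AEStronglyMeasurable (fun z : Noise 𝓗 Ξ m × Ξ => S.Ψ (S.particle S.Ψ I n z.1) z.2)
    (S.noiseLaw.prod S.ν) := aesm_solver S.measurable_Ψ hu.aestronglyMeasurable
  have hae := ae_P_Ψlev hR hu l
  refine ⟨by have := hR.pos; positivity,
    hΨ.sub ((S.P l).continuous.comp_aestronglyMeasurable hΨ), ?_⟩
  rw [mul_assoc, ENNReal.ofReal_mul (by norm_num)]
  -- The level l solver lies in the range of the projection and serves as the approximant.
  refine (eLpNorm_le_mul_eLpNorm_of_ae_le_mul ?_ _).trans (mul_le_mul_right (h l).le _)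
  filter_upwards [hae] with z hz
  rw [norm_sub_rev (S.Ψlev l _ _)]
  exact S.norm_sub_P_le l hz

/-- The mean-field gain is approximated by its projections. -/
lemma exists_gainAt_sub_P_le (hS : S.SolverBounds S.noiseLaw) (hR : S.LevelRates r) (n : ℕ) :
    ∃ C : ℝ, 0 ≤ C ∧ ∀ l, ‖S.gainAt n - S.P l ∘L S.gainAt n‖ ≤ C * r ^ l := by
  set I := ContinuousLinearMap.id ℝ 𝓗
  obtain ⟨C, hC, h⟩ := exists_predicted_sub_P_le hS hR (p := 2) le_rfl n
  obtain ⟨A, hA⟩ := (memLp_limit hS hR (p := 2) le_rfl n).2.exists_lpLE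
  have hr := hR.pos
  have hA0 := hA.nonneg
  set V := S.predicted S.Ψ I n
  set Cov := covOp (S.predictLaw (S.meanFieldLaw n))
  set T := Matrix.toEuclideanCLM (𝕜 := ℝ) (S.obsMatrix (S.crossCov Cov) + S.Γ)⁻¹
  -- With V the mean-field prediction, (I - P) C g = E[⟨V,g⟩ (V - PV)] - ⟨EV,g⟩ E[V - PV], so only
  -- the left tensor factor is projected and its rate passes to the operator norm.
  have hcov : ∀ l, ‖Cov - S.P l ∘L Cov‖ ≤ 2 * (A * C) * r ^ l := by
    intro l
    refine ContinuousLinearMap.opNorm_le_bound _ (by positivity) fun g => ?_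
    have hV2 : LpLE S.noiseLaw (2 * 1) V A := by simpa using hA
    have hd2 : LpLE S.noiseLaw (2 * 1) (fun w => V w - S.P l (V w)) (C * r ^ l) := by
      simpa using h l
    have hVV := LpLE.inner_smul g hV2 hV2
    have hVd := LpLE.inner_smul g hV2 hd2
    have hVI : Integrable V S.noiseLaw := hV2.integrable (by norm_num)
    have e1 : (Cov - S.P l ∘L Cov) g
        = ∫ w, (inner ℝ (V w) g : ℝ) • (V w - S.P l (V w)) ∂S.noiseLaw
          - (inner ℝ (∫ w, V w ∂S.noiseLaw) g : ℝ) • ∫ w, (V w - S.P l (V w)) ∂S.noiseLaw := by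
      have hi1 : Integrable (fun w => (inner ℝ (V w) g : ℝ) • V w) S.noiseLaw :=
        hVV.integrable le_rfl
      rw [_root_.sub_apply, ContinuousLinearMap.comp_apply, covOp_predictLaw_apply hS hR n g,
        map_sub, map_smul, ← (S.P l).integral_comp_comm hi1,
        ← (S.P l).integral_comp_comm hVI]
      simp only [map_smul, smul_sub]
      rw [integral_sub hi1 ((S.P l).integrable_comp hi1 |>.congr
        (ae_of_all _ fun w => by simp)), integral_sub hVI ((S.P l).integrable_comp hVI), smul_sub]
      abel
    rw [e1]
    have b1 := hVd.norm_integral_le le_rfl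
    have b2 := hV2.norm_integral_le (by norm_num)
    have b3 := hd2.norm_integral_le (by norm_num)
    refine (norm_sub_le _ _).trans ?_
    rw [norm_smul]
    calc _ ≤ ‖g‖ * (A * (C * r ^ l)) + (A * ‖g‖) * (C * r ^ l) := by
          gcongr
          exact (norm_inner_le_norm _ _).trans (by gcongr)
      _ = _ := by ring
  refine ⟨2 * (A * C) * ‖ContinuousLinearMap.adjoint S.H‖ * ‖T‖, by positivity, fun l => ?_⟩
  have e2 : S.gainAt n - S.P l ∘L S.gainAt n
      = ((Cov - S.P l ∘L Cov) ∘L ContinuousLinearMap.adjoint S.H) ∘L T := by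
    ext x : 1
    simp [gainAt, meanFieldGain, crossCov, T, Cov]
  rw [e2]
  calc _ ≤ ‖Cov - S.P l ∘L Cov‖ * ‖ContinuousLinearMap.adjoint S.H‖ * ‖T‖ :=
        (ContinuousLinearMap.opNorm_comp_le _ _).trans
          (mul_le_mul_of_nonneg_right (ContinuousLinearMap.opNorm_comp_le _ _) (norm_nonneg _))
    _ ≤ 2 * (A * C) * r ^ l * ‖ContinuousLinearMap.adjoint S.H‖ * ‖T‖ := by
        gcongr; exact hcov l
    _ = _ := by ring

/-- Stability, uniform in the level, handles the change of argument, and consistency is applied at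
the limiting state. The order of the two steps matters: the constant in the solver rate depends on
the argument, which therefore must not vary with l. -/
lemma exists_predicted_sub_le (hS : S.SolverBounds S.noiseLaw) (hR : S.LevelRates r) {p : ℝ}
    (hp : 2 ≤ p) {n : ℕ} (h : ∃ C : ℝ, 0 ≤ C ∧ ∀ l, LpLE S.noiseLaw p
      (fun w => S.particle (S.Ψlev l) (S.P l) n w
        - S.particle S.Ψ (ContinuousLinearMap.id ℝ 𝓗) n w) (C * r ^ l)) :
    ∃ C : ℝ, 0 ≤ C ∧ ∀ l, LpLE S.noiseLaw p
      (fun w => S.predicted (S.Ψlev l) (S.P l) n w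
        - S.predicted S.Ψ (ContinuousLinearMap.id ℝ 𝓗) n w) (C * r ^ l) := by
  set I := ContinuousLinearMap.id ℝ 𝓗
  obtain ⟨C, hC, h⟩ := h
  obtain ⟨C', hC', h'⟩ := hR.solver_rate p hp _ (memLp_limit hS hR hp n).1
  obtain ⟨c, hc, hlip⟩ := hS.exists_lipSolver hp
  refine ⟨c * C + C', by positivity, fun l => ?_⟩
  have hX := (memLp_limit hS hR hp n).1
  have hXl : MemLp (S.particle (S.Ψlev l) (S.P l) n) (ENNReal.ofReal p) S.noiseLaw := by
    refine ((h l).memLp.add hX).ae_eq (ae_of_all _ fun w => ?_)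
    simp [I]
  refine S.lpLE_of_fresh (S.measurePreserving_setTime n)
    (G := fun z => (S.Ψlev l (S.particle (S.Ψlev l) (S.P l) n z.1) z.2
        - S.Ψlev l (S.particle S.Ψ I n z.1) z.2)
      + (S.Ψlev l (S.particle S.Ψ I n z.1) z.2 - S.Ψ (S.particle S.Ψ I n z.1) z.2))
    (fun z => by simp [predicted, particle_setTime, setTime_self])
    ((S.measurable_predicted (S.measurable_Ψlev l) _ n).sub
      (S.measurable_predicted S.measurable_Ψ _ n)).aestronglyMeasurable ?_
  exact (((hlip l).1 _ _ _ hXl hX (h l)).add (by linarith) (h' l)).mono (le_of_eq (by ring))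

/-- Rates of convergence of the mean-field particles. -/
lemma exists_particle_sub_le (hS : S.SolverBounds S.noiseLaw) (hR : S.LevelRates r) {p : ℝ}
    (hp : 2 ≤ p) (n : ℕ) : ∃ C : ℝ, 0 ≤ C ∧ ∀ l, LpLE S.noiseLaw p
      (fun w => S.particle (S.Ψlev l) (S.P l) n w
        - S.particle S.Ψ (ContinuousLinearMap.id ℝ 𝓗) n w) (C * r ^ l) := by
  have hp1 : 1 ≤ p := by linarith
  induction n with
  | zero =>
    obtain ⟨C, hC, h⟩ := hR.initial_rate p hp
    refine ⟨C, hC, fun l => ?_⟩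
    refine ((h l).comp S.measurePreserving_fst_noise).neg.congr (ae_of_all _ fun w => ?_)
    simp [particle]
  | succ n ih =>
    obtain ⟨C, hC, h⟩ := exists_predicted_sub_le hS hR hp ih
    obtain ⟨D, hD, hK⟩ := exists_gainAt_sub_P_le hS hR n
    obtain ⟨A, hA⟩ := (memLp_limit hS hR hp n).2.exists_lpLE
    obtain ⟨B, hB⟩ := (S.memLp_obs_noise n p).exists_lpLE
    have hA0 := hA.nonneg
    have hB0 := hB.nonneg
    have hr := hR.pos
    set K := S.gainAt n
    set I := ContinuousLinearMap.id ℝ 𝓗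
    -- The update error consists of the prediction error propagated by I - QKH and of the projection
    -- error K - QK of the gain, applied to the observed prediction and to the perturbed data.
    refine ⟨C + ‖K‖ * ‖S.H‖ * C + D * (‖S.H‖ * A) + D * B, by positivity, fun l => ?_⟩
    set Q := S.P l
    have h1 := h l
    have h2 := (h1.clm (Q ∘L K ∘L S.H))
    have h3 := hA.clm ((K - Q ∘L K) ∘L S.H)
    have h4 := hB.clm (K - Q ∘L K)
    refine (((((h1.sub hp1 h2).add hp1 h3).sub hp1 h4).congr (ae_of_all _ fun w => ?_)).mono ?_)
    · simp only [particle_succ, updateState, ContinuousLinearMap.comp_apply, map_sub,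
        _root_.sub_apply, I, K, ContinuousLinearMap.id_apply]
      abel
    · have n1 : ‖Q ∘L K ∘L S.H‖ ≤ ‖K‖ * ‖S.H‖ :=
        (ContinuousLinearMap.opNorm_comp_le _ _).trans ((mul_le_mul (S.norm_P_le_one l)
          (ContinuousLinearMap.opNorm_comp_le _ _) (norm_nonneg _) zero_le_one).trans
          (one_mul _).le)
      have n2 : ‖(K - Q ∘L K) ∘L S.H‖ ≤ D * r ^ l * ‖S.H‖ :=
        (ContinuousLinearMap.opNorm_comp_le _ _).trans (by gcongr; exact hK l)
      calc _ ≤ C * r ^ l + ‖K‖ * ‖S.H‖ * (C * r ^ l) + D * r ^ l * ‖S.H‖ * A + D * r ^ l * B := by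
            gcongr
            exact hK l
        _ = _ := by ring

/-- The difference of the coupled predictions of one pair is geometrically small. -/
lemma exists_pair_sub_le {X X' : ℕ → Noise 𝓗 Ξ m → 𝓗} {x' : Noise 𝓗 Ξ m → 𝓗} (hr : 0 < r)
    {p : ℝ} (hp : 1 ≤ p) (hx : MemLp x' (ENNReal.ofReal p) S.noiseLaw) (h0 : X' 0 = 0)
    (hs : ∀ l, X' (l + 1) = X l) (hr1 : r < 1)
    (h : ∃ C : ℝ, 0 ≤ C ∧ ∀ l, LpLE S.noiseLaw p (fun w => X l w - x' w) (C * r ^ l)) :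
    ∃ A : ℝ, 0 ≤ A ∧ ∀ l, LpLE S.noiseLaw p (X l) A ∧ LpLE S.noiseLaw p (X' l) A ∧
      LpLE S.noiseLaw p (fun w => X l w - X' l w) (A * r ^ l) := by
  obtain ⟨C, hC, h⟩ := h
  obtain ⟨B, hB⟩ := hx.exists_lpLE
  have hB0 := hB.nonneg
  have hrl : ∀ l : ℕ, r ^ l ≤ 1 := fun l => pow_le_one₀ hr.le hr1.le
  have hX : ∀ l, LpLE S.noiseLaw p (X l) (C + B) := fun l => by
    refine (((h l).add hp hB).congr (ae_of_all _ fun w => by simp)).mono ?_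
    gcongr
    exact mul_le_of_le_one_right hC (hrl l)
  have hA : C + B ≤ C * (1 + r⁻¹) + B := by
    have : 0 ≤ C * r⁻¹ := by positivity
    linarith
  -- Through the common limit, C r^(l+1) + C r^l = C (1 + r⁻¹) r^(l+1). The term `B` is for level 0,
  -- where the difference is the full state.
  refine ⟨C * (1 + r⁻¹) + B, by positivity, fun l => ⟨(hX l).mono hA, ?_, ?_⟩⟩
  · cases l with
    | zero => rw [h0]; exact LpLE.zero.mono (by positivity)
    | succ l => rw [hs]; exact (hX l).mono hA
  · cases l with
    | zero => simpa [h0] using (hX 0).mono hA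
    | succ l =>
      rw [hs]
      refine (((h (l + 1)).sub hp (h l)).congr (ae_of_all _ fun w => by simp)).mono ?_
      have e : C * r ^ (l + 1) + C * r ^ l = C * (1 + r⁻¹) * r ^ (l + 1) := by
        field_simp
        ring
      rw [e]
      gcongr
      linarith

lemma exists_particle_pair_le (hS : S.SolverBounds S.noiseLaw) (hR : S.LevelRates r) {p : ℝ}
    (hp : 2 ≤ p) (n : ℕ) : ∃ A : ℝ, 0 ≤ A ∧ ∀ l,
      LpLE S.noiseLaw p (S.particle (S.Ψlev l) (S.P l) n) A ∧
      LpLE S.noiseLaw p (S.particle (prev S.Ψlev l) (prev S.P l) n) A ∧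
      LpLE S.noiseLaw p (fun w => S.particle (S.Ψlev l) (S.P l) n w
        - S.particle (prev S.Ψlev l) (prev S.P l) n w) (A * r ^ l) :=
  exists_pair_sub_le (X := fun l => S.particle (S.Ψlev l) (S.P l) n)
    (X' := fun l => S.particle (prev S.Ψlev l) (prev S.P l) n) hR.pos (by linarith)
    (memLp_limit hS hR hp n).1 (by funext w; exact S.particle_zero_map n w) (fun _ => rfl)
    hR.lt_one (exists_particle_sub_le hS hR hp n)

lemma exists_predicted_pair_le (hS : S.SolverBounds S.noiseLaw) (hR : S.LevelRates r) {p : ℝ}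
    (hp : 2 ≤ p) (n : ℕ) : ∃ A : ℝ, 0 ≤ A ∧ ∀ l,
      LpLE S.noiseLaw p (S.predicted (S.Ψlev l) (S.P l) n) A ∧
      LpLE S.noiseLaw p (S.predicted (prev S.Ψlev l) (prev S.P l) n) A ∧
      LpLE S.noiseLaw p (fun w => S.predicted (S.Ψlev l) (S.P l) n w
        - S.predicted (prev S.Ψlev l) (prev S.P l) n w) (A * r ^ l) :=
  exists_pair_sub_le (X := fun l => S.predicted (S.Ψlev l) (S.P l) n)
    (X' := fun l => S.predicted (prev S.Ψlev l) (prev S.P l) n) hR.pos (by linarith)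
    (memLp_limit hS hR hp n).2 rfl (fun _ => rfl)
    hR.lt_one (exists_predicted_sub_le hS hR hp (exists_particle_sub_le hS hR hp n))

end Rates

end FilterModel

end MLEnKF

/-! ### The error recursion for the interacting ensemble. -/

namespace MLEnKF

lemma integral_comp_of_measurePreserving {α β E : Type*} [MeasurableSpace α] [MeasurableSpace β]
    [NormedAddCommGroup E] [NormedSpace ℝ E] {μ : Measure α} {ν : Measure β} {T : α → β}
    (hT : MeasurePreserving T μ ν) {f : β → E} (hf : AEStronglyMeasurable f ν) :
    ∫ x, f (T x) ∂μ = ∫ y, f y ∂ν := by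
  rw [← hT.map_eq] at hf ⊢
  exact (integral_map hT.measurable.aemeasurable hf).symm

lemma sum_range_sub_prev {E : Type*} [AddCommGroup E] (f : ℕ → E) (L : ℕ) :
    ∑ l ∈ Finset.range (L + 1), (f l - prev f l) = f L := by
  induction L with
  | zero => simp [prev]
  | succ L ih => rw [Finset.sum_range_succ, ih]; simp [prev]

/-- Conditions on the accuracy, the finest level and the sample sizes: the statistical error and
the bias are at most of the order `ε`. -/
structure SampleRegime (r C₀ : ℝ) (B : ℕ → ℝ) (ε : ℝ) (L : ℕ) (M : ℕ → ℕ) : Prop where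
  pos : 0 < ε
  two_le : ∀ l ≤ L, 2 ≤ M l
  stat : ∑ l ∈ Finset.range (L + 1), r ^ l / √(M l) ≤ C₀ * ε
  bias : r ^ L ≤ C₀ * ε
  log_bound : ∀ n, ((L : ℝ) + 1) ^ n * ε ≤ B n

/-- The order of magnitude of the error of the ensemble at time `n`. -/
noncomputable def errRate (L : ℕ) (ε : ℝ) : ℕ → ℝ
  | 0 => 0
  | n + 1 => ((L : ℝ) + 1) ^ n * ε

section ErrRate

variable {r C₀ ε : ℝ} {B : ℕ → ℝ} {L : ℕ} {M : ℕ → ℕ}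

lemma errRate_nonneg (hε : 0 ≤ ε) (n : ℕ) : 0 ≤ errRate L ε n := by
  cases n <;> simp only [errRate] <;> positivity

/-- The recursion behind the logarithms: one step loses a factor L + 1, because every level of the
multilevel sum contributes the full ensemble error. -/
lemma mul_errRate_le (hε : 0 ≤ ε) (n : ℕ) :
    ((L : ℝ) + 1) * errRate L ε n ≤ errRate L ε (n + 1) := by
  cases n with
  | zero => simpa [errRate] using hε
  | succ n => simp only [errRate]; exact le_of_eq (by ring)

lemma errRate_le_succ (hε : 0 ≤ ε) (n : ℕ) : errRate L ε n ≤ errRate L ε (n + 1) :=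
  (le_mul_of_one_le_left (errRate_nonneg hε n) (by simp)).trans (mul_errRate_le hε n)

lemma le_errRate_succ (hε : 0 ≤ ε) (n : ℕ) : ε ≤ errRate L ε (n + 1) :=
  le_mul_of_one_le_left hε (one_le_pow₀ (by simp))

/-- A bound that does not depend on ε; it provides the uniform moments of the ensemble needed when
errors are multiplied. -/
lemma SampleRegime.errRate_le (h : SampleRegime r C₀ B ε L M) (n : ℕ) : errRate L ε n ≤ B n :=
  (errRate_le_succ h.pos.le n).trans (h.log_bound n)

end ErrRate

namespace FilterModel

section Induction

variable {𝓗 Ξ : Type*} [NormedAddCommGroup 𝓗] [InnerProductSpace ℝ 𝓗] [CompleteSpace 𝓗]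
  [SecondCountableTopology 𝓗] [MeasurableSpace 𝓗] [BorelSpace 𝓗] [MeasurableSpace Ξ] {m : ℕ}
  {S : FilterModel 𝓗 Ξ m} {r C₀ : ℝ} {B : ℕ → ℝ}

/-- The pair of coupled mean-field particles of level `l`. -/
noncomputable def particlePair (S : FilterModel 𝓗 Ξ m) (n l : ℕ) (w : Noise 𝓗 Ξ m) : 𝓗 × 𝓗 :=
  (S.particle (S.Ψlev l) (S.P l) n w, S.particle (prev S.Ψlev l) (prev S.P l) n w)

/-- The pair of coupled predictions of level `l`. -/
noncomputable def predictedPair (S : FilterModel 𝓗 Ξ m) (n l : ℕ) (w : Noise 𝓗 Ξ m) : 𝓗 × 𝓗 :=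
  (S.predicted (S.Ψlev l) (S.P l) n w, S.predicted (prev S.Ψlev l) (prev S.P l) n w)

lemma measurable_particlePair (S : FilterModel 𝓗 Ξ m) (n l : ℕ) :
    Measurable (S.particlePair n l) :=
  (S.measurable_particle (S.measurable_Ψlev l) _ n).prodMk
    (S.measurable_particle (S.measurable_prev_Ψlev l) _ n)

lemma measurable_predictedPair (S : FilterModel 𝓗 Ξ m) (n l : ℕ) :
    Measurable (S.predictedPair n l) :=
  (S.measurable_predicted (S.measurable_Ψlev l) _ n).prodMk
    (S.measurable_predicted (S.measurable_prev_Ψlev l) _ n)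

/-- An ensemble `X` is close to independent copies of `Y` in every `L^p`, with rate `errRate k`. -/
def EnsembleClose (S : FilterModel 𝓗 Ξ m) (r C₀ : ℝ) (B : ℕ → ℝ) (k : ℕ)
    (X : ℕ → (ℕ → ℕ) → ℕ → ℕ → (ℕ × ℕ → Noise 𝓗 Ξ m) → 𝓗 × 𝓗)
    (Y : ℕ → Noise 𝓗 Ξ m → 𝓗 × 𝓗) : Prop :=
  ∀ p : ℝ, 2 ≤ p → ∃ C : ℝ, 0 ≤ C ∧ ∀ ε L M, SampleRegime r C₀ B ε L M → ∀ l i,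
    LpLE S.fieldLaw p (fun w => (X L M l i w).1 - (Y l (w (l, i))).1) (C * errRate L ε k) ∧
    LpLE S.fieldLaw p (fun w => (X L M l i w).2 - (Y l (w (l, i))).2) (C * errRate L ε k)

lemma exists_particlePair_le (hS : S.SolverBounds S.noiseLaw) (hR : S.LevelRates r) {p : ℝ}
    (hp : 2 ≤ p) (n : ℕ) : ∃ A : ℝ, 0 ≤ A ∧ ∀ l i,
      LpLE S.fieldLaw p (fun w => (S.particlePair n l (w (l, i))).1) A ∧
      LpLE S.fieldLaw p (fun w => (S.particlePair n l (w (l, i))).2) A ∧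
      LpLE S.fieldLaw p (fun w => (S.particlePair n l (w (l, i))).1
        - (S.particlePair n l (w (l, i))).2) (A * r ^ l) := by
  obtain ⟨A, hA, h⟩ := exists_particle_pair_le hS hR hp n
  refine ⟨A, hA, fun l i => ?_⟩
  have hT := S.measurePreserving_eval_fieldLaw (l, i)
  exact ⟨LpLE.comp (f := fun w => (S.particlePair n l w).1) hT (h l).1,
    LpLE.comp (f := fun w => (S.particlePair n l w).2) hT (h l).2.1,
    LpLE.comp (f := fun w => (S.particlePair n l w).1 - (S.particlePair n l w).2) hT (h l).2.2⟩

lemma exists_predictedPair_le (hS : S.SolverBounds S.noiseLaw) (hR : S.LevelRates r) {p : ℝ}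
    (hp : 2 ≤ p) (n : ℕ) : ∃ A : ℝ, 0 ≤ A ∧ ∀ l i,
      LpLE S.fieldLaw p (fun w => (S.predictedPair n l (w (l, i))).1) A ∧
      LpLE S.fieldLaw p (fun w => (S.predictedPair n l (w (l, i))).2) A ∧
      LpLE S.fieldLaw p (fun w => (S.predictedPair n l (w (l, i))).1
        - (S.predictedPair n l (w (l, i))).2) (A * r ^ l) := by
  obtain ⟨A, hA, h⟩ := exists_predicted_pair_le hS hR hp n
  refine ⟨A, hA, fun l i => ?_⟩
  have hT := S.measurePreserving_eval_fieldLaw (l, i)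
  exact ⟨LpLE.comp (f := fun w => (S.predictedPair n l w).1) hT (h l).1,
    LpLE.comp (f := fun w => (S.predictedPair n l w).2) hT (h l).2.1,
    LpLE.comp (f := fun w => (S.predictedPair n l w).1 - (S.predictedPair n l w).2) hT (h l).2.2⟩

lemma iIndepFun_level (S : FilterModel 𝓗 Ξ m) (l : ℕ) {β : Type*} [MeasurableSpace β]
    {f : Noise 𝓗 Ξ m → β} (hf : Measurable f) :
    iIndepFun (fun i (w : ℕ × ℕ → Noise 𝓗 Ξ m) => f (w (l, i))) S.fieldLaw := by
  have h := iIndepFun_infinitePi (P := fun _ : ℕ × ℕ => S.noiseLaw) (X := fun _ w => f w)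
    (fun _ => hf)
  exact h.precomp (g := fun i : ℕ => (l, i)) (fun i j h => by simpa using h)

/-- Propagation of the error through the prediction. -/
lemma EnsembleClose.predict (hS : S.SolverBounds S.noiseLaw) (hSρ : S.SolverBounds S.fieldLaw)
    (hR : S.LevelRates r) {k n : ℕ}
    (h : S.EnsembleClose r C₀ B k (fun L M => S.ens L M n) (S.particlePair n)) :
    S.EnsembleClose r C₀ B k (fun L M => S.ensPred L M n) (S.predictedPair n) := by
  intro p hp
  obtain ⟨C, hC, h⟩ := h p hp
  obtain ⟨c, hc, hlip⟩ := hSρ.exists_lipSolver hp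
  obtain ⟨A, hA, hpart⟩ := exists_particlePair_le hS hR hp n
  refine ⟨c * C, by positivity, fun ε L M hreg l i => ?_⟩
  obtain ⟨h1, h2⟩ := h ε L M hreg l i
  obtain ⟨a1, a2, -⟩ := hpart l i
  have hset : ∀ (w : ℕ × ℕ → Noise 𝓗 Ξ m) (x : Ξ × Obs m), S.particlePair n l (setAt (l, i) n w x (l, i))
      = S.particlePair n l (w (l, i)) := fun w x => by
    simp [particlePair, setAt, particle_setTime]
  have hm := (S.measurable_ensPred L M n l i).prodMk
    ((S.measurable_predictedPair n l).comp (measurable_pi_apply (l, i)))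
  have hu1 : MemLp (fun w => (S.ens L M n l i w).1) (ENNReal.ofReal p) S.fieldLaw :=
    (h1.memLp.add a1.memLp).ae_eq (ae_of_all _ fun w => by simp)
  have hu2 : MemLp (fun w => (S.ens L M n l i w).2) (ENNReal.ofReal p) S.fieldLaw :=
    (h2.memLp.add a2.memLp).ae_eq (ae_of_all _ fun w => by simp)
  constructor
  -- Both the ensemble state and the mean-field particle at time n ignore the noise of the
  -- transition n, so the stability bound for independent noise applies although all particles
  -- interact.
  · refine S.lpLE_of_fresh (S.measurePreserving_setAt (l, i) n)
      (G := fun z => S.Ψlev l (S.ens L M n l i z.1).1 z.2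
        - S.Ψlev l (S.particlePair n l (z.1 (l, i))).1 z.2) (fun z => ?_)
      (hm.fst.fst.sub hm.snd.fst).aestronglyMeasurable ?_
    · have := congrArg Prod.fst (hset z.1 z.2)
      simp only [particlePair] at this
      simp [ensPred, predictedPair, predicted, ens_setAt, setAt_self, this, particlePair]
    · exact ((hlip l).1 _ _ _ hu1 a1.memLp h1).mono (le_of_eq (by ring))
  · refine S.lpLE_of_fresh (S.measurePreserving_setAt (l, i) n)
      (G := fun z => prev S.Ψlev l (S.ens L M n l i z.1).2 z.2
        - prev S.Ψlev l (S.particlePair n l (z.1 (l, i))).2 z.2) (fun z => ?_)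
      (hm.fst.snd.sub hm.snd.snd).aestronglyMeasurable ?_
    · have := congrArg Prod.snd (hset z.1 z.2)
      simp only [particlePair] at this
      simp [ensPred, predictedPair, predicted, ens_setAt, setAt_self, this, particlePair]
    · exact ((hlip l).2 _ _ _ hu2 a2.memLp h2).mono (le_of_eq (by ring))

/-- Moment bounds for an ensemble close to independent particles. -/
lemma EnsembleClose.exists_le {X : ℕ → (ℕ → ℕ) → ℕ → ℕ → (ℕ × ℕ → Noise 𝓗 Ξ m) → 𝓗 × 𝓗}
    {Y : ℕ → Noise 𝓗 Ξ m → 𝓗 × 𝓗} {k : ℕ} (h : S.EnsembleClose r C₀ B k X Y) {p A : ℝ}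
    (hp : 2 ≤ p) (hB : ∀ k, 0 ≤ B k)
    (hY : ∀ l i, LpLE S.fieldLaw p (fun w => (Y l (w (l, i))).1) A ∧
      LpLE S.fieldLaw p (fun w => (Y l (w (l, i))).2) A) :
    ∃ A' : ℝ, A ≤ A' ∧ ∀ ε L M, SampleRegime r C₀ B ε L M → ∀ l i,
      LpLE S.fieldLaw p (fun w => (X L M l i w).1) A' ∧
      LpLE S.fieldLaw p (fun w => (X L M l i w).2) A' := by
  obtain ⟨C, hC, h⟩ := h p hp
  have := hB k
  refine ⟨C * B k + A, le_add_of_nonneg_left (by positivity), fun ε L M hreg l i => ?_⟩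
  have h1 := h ε L M hreg l i
  have hle : C * errRate L ε k + A ≤ C * B k + A := by gcongr; exact hreg.errRate_le k
  exact ⟨((h1.1.add (by linarith) (hY l i).1).congr (ae_of_all _ fun w => by simp)).mono hle,
    ((h1.2.add (by linarith) (hY l i).2).congr (ae_of_all _ fun w => by simp)).mono hle⟩

/-- The covariance functional of the level `l` prediction, applied to `g`. -/
noncomputable def predCov (S : FilterModel 𝓗 Ξ m) (n : ℕ) (g : 𝓗) (l : ℕ) : 𝓗 :=
  ∫ w, (inner ℝ (S.predicted (S.Ψlev l) (S.P l) n w) g : ℝ) •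
      S.predicted (S.Ψlev l) (S.P l) n w ∂S.noiseLaw
    - (inner ℝ (∫ w, S.predicted (S.Ψlev l) (S.P l) n w ∂S.noiseLaw) g : ℝ) •
      ∫ w, S.predicted (S.Ψlev l) (S.P l) n w ∂S.noiseLaw

/-- At l = 0 both sides vanish by the convention for level -1, so the expected increments telescope
without a special case. -/
lemma prev_predCov (S : FilterModel 𝓗 Ξ m) (n : ℕ) (g : 𝓗) (l : ℕ) :
    prev (S.predCov n g) l
      = ∫ w, (inner ℝ (S.predictedPair n l w).2 g : ℝ) • (S.predictedPair n l w).2 ∂S.noiseLaw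
        - (inner ℝ (∫ w, (S.predictedPair n l w).2 ∂S.noiseLaw) g : ℝ) •
          ∫ w, (S.predictedPair n l w).2 ∂S.noiseLaw := by
  cases l with
  | zero => simp [prev, predictedPair, predicted]
  | succ l => rfl

/-- The bias of the covariance on the finest level. -/
lemma exists_predCov_sub_le (hS : S.SolverBounds S.noiseLaw) (hR : S.LevelRates r) (n : ℕ) :
    ∃ C : ℝ, 0 ≤ C ∧ ∀ g l,
      ‖S.predCov n g l - covOp (S.predictLaw (S.meanFieldLaw n)) g‖ ≤ C * ‖g‖ * r ^ l := by
  obtain ⟨C, hC, h⟩ := exists_predicted_sub_le hS hR (p := 2) le_rfl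
    (exists_particle_sub_le hS hR le_rfl n)
  obtain ⟨A, hA, hpair⟩ := exists_predicted_pair_le hS hR (p := 2) le_rfl n
  obtain ⟨A', hA'⟩ := (memLp_limit hS hR (p := 2) le_rfl n).2.exists_lpLE
  have hA'0 := hA'.nonneg
  set V := S.predicted S.Ψ (ContinuousLinearMap.id ℝ 𝓗) n
  -- Two differences of quadratic expressions, the second moments and the products of the means,
  -- each cost 2 (A + A') C.
  refine ⟨4 * ((A + A') * C), by positivity, fun g l => ?_⟩
  set X := S.predicted (S.Ψlev l) (S.P l) n with hX
  have e2 : (2 : ℝ) = 2 * 1 := by norm_num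
  have hXA : LpLE S.noiseLaw (2 * 1) X (A + A') := by
    rw [← e2]; exact (hpair l).1.mono (by linarith)
  have hVA : LpLE S.noiseLaw (2 * 1) V (A + A') := by rw [← e2]; exact hA'.mono (by linarith)
  have hd : LpLE S.noiseLaw (2 * 1) (fun w => X w - V w) (C * r ^ l) := by rw [← e2]; exact h l
  rw [covOp_predictLaw_apply hS hR n g]
  have h1 := (LpLE.inner_smul_sub le_rfl g hXA hVA hd).norm_integral_le le_rfl
  have h2 : (1 : ℝ) ≤ 2 * 1 := by norm_num
  have i1 := (LpLE.inner_smul g hXA hXA).integrable le_rfl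
  have i2 := (LpLE.inner_smul g hVA hVA).integrable le_rfl
  rw [integral_sub i1 i2] at h1
  have bX := hXA.norm_integral_le h2
  have bV := hVA.norm_integral_le h2
  have bd := hd.norm_integral_le h2
  rw [integral_sub (hXA.integrable h2) (hVA.integrable h2)] at bd
  have h3 : ‖(inner ℝ (∫ w, X w ∂S.noiseLaw) g : ℝ) • ∫ w, X w ∂S.noiseLaw
      - (inner ℝ (∫ w, V w ∂S.noiseLaw) g : ℝ) • ∫ w, V w ∂S.noiseLaw‖
      ≤ 2 * (‖g‖ * ((A + A') * (C * r ^ l))) := by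
    rw [inner_smul_sub_inner_smul]
    refine (norm_add_le _ _).trans ?_
    rw [norm_smul, norm_smul]
    have hr := hR.pos
    calc _ ≤ (C * r ^ l * ‖g‖) * (A + A') + ((A + A') * ‖g‖) * (C * r ^ l) := by
          gcongr
          · exact (norm_inner_le_norm _ _).trans (by gcongr)
          · exact (norm_inner_le_norm _ _).trans (by gcongr)
      _ = _ := by ring
  calc _ = ‖(∫ w, (inner ℝ (X w) g : ℝ) • X w ∂S.noiseLaw - ∫ w, (inner ℝ (V w) g : ℝ) • V w ∂S.noiseLaw)
        - ((inner ℝ (∫ w, X w ∂S.noiseLaw) g : ℝ) • ∫ w, X w ∂S.noiseLaw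
      - (inner ℝ (∫ w, V w ∂S.noiseLaw) g : ℝ) • ∫ w, V w ∂S.noiseLaw)‖ := by
        rw [predCov]; congr 1; abel
    _ ≤ _ := (norm_sub_le _ _).trans (add_le_add h1 h3)
    _ = _ := by ring

/-- The error of the multilevel sample covariance of the prediction. -/
lemma EnsembleClose.exists_mlCov_sub_le (hS : S.SolverBounds S.noiseLaw) (hR : S.LevelRates r)
    (hC₀ : 0 ≤ C₀) (hB : ∀ k, 0 ≤ B k) {n : ℕ}
    (h : S.EnsembleClose r C₀ B n (fun L M => S.ensPred L M n) (S.predictedPair n)) {p : ℝ}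
    (hp : 2 ≤ p) : ∃ C : ℝ, 0 ≤ C ∧ ∀ ε L M, SampleRegime r C₀ B ε L M → ∀ g : 𝓗,
      LpLE S.fieldLaw p (fun w => mlCov L M (fun l i => S.ensPred L M n l i w) g
        - covOp (S.predictLaw (S.meanFieldLaw n)) g) (C * ‖g‖ * errRate L ε (n + 1)) := by
  have hp1 : 1 ≤ p := by linarith
  have h2p : 2 ≤ 2 * p := by linarith
  set q : ℝ := 2 * evenExp (2 * p)
  have hq : 2 * p ≤ q := by
    have := le_evenExp (2 * p)
    simp only [q]; linarith
  have hq2 : 2 ≤ q := by linarith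
  obtain ⟨A, hA, hY⟩ := exists_predictedPair_le hS hR h2p n
  obtain ⟨Aq, hAq, hYq⟩ := exists_predictedPair_le hS hR hq2 n
  obtain ⟨A', hAA', hX⟩ := h.exists_le h2p hB fun l i => ⟨(hY l i).1, (hY l i).2.1⟩
  obtain ⟨C₁, hC₁, hd⟩ := h (2 * p) h2p
  obtain ⟨C₂, hC₂, hfl⟩ := exists_sampleCov_sub_sub_le (μ := S.fieldLaw) (E := 𝓗) p hp1
  obtain ⟨C₃, hC₃, hbias⟩ := exists_predCov_sub_le hS hR n
  have hA'0 : 0 ≤ A' := hA.trans hAA'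
  have hr := hR.pos
  refine ⟨16 * (A' * C₁) + C₂ * (Aq * Aq) * C₀ + C₃ * C₀, by positivity, fun ε L M hreg g => ?_⟩
  have hε := hreg.pos.le
  set D := errRate L ε n
  set D' := errRate L ε (n + 1)
  have hD : 0 ≤ D := errRate_nonneg hε n
  have hεD : ε ≤ D' := le_errRate_succ hε n
  set v : ℕ → ℕ → (ℕ × ℕ → Noise 𝓗 Ξ m) → 𝓗 × 𝓗 := fun l i => S.ensPred L M n l i
  set y : ℕ → ℕ → (ℕ × ℕ → Noise 𝓗 Ξ m) → 𝓗 × 𝓗 := fun l i w => S.predictedPair n l (w (l, i))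
  -- dependence on the ensemble
  have t1 : LpLE S.fieldLaw p (fun w => ∑ l ∈ Finset.range (L + 1),
      ((sampleCov (M l) (fun i => (v l i w).1) g - sampleCov (M l) (fun i => (y l i w).1) g)
        - (sampleCov (M l) (fun i => (v l i w).2) g - sampleCov (M l) (fun i => (y l i w).2) g)))
      (16 * (A' * C₁) * ‖g‖ * D') := by
    refine (LpLE.sum hp1 (Finset.range (L + 1)) (B := fun _ => 16 * (A' * C₁) * ‖g‖ * D)
      fun l hl => ?_).mono ?_
    · have hM := hreg.two_le l (by simpa [Nat.lt_succ_iff] using hl)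
      have s1 := LpLE.sampleCov_sub hp1 hM (u := fun i w => (v l i w).1)
        (v := fun i w => (y l i w).1) g (fun i _ => (hX ε L M hreg l i).1)
        (fun i _ => (hY l i).1.mono hAA') (fun i _ => (hd ε L M hreg l i).1)
      have s2 := LpLE.sampleCov_sub hp1 hM (u := fun i w => (v l i w).2)
        (v := fun i w => (y l i w).2) g (fun i _ => (hX ε L M hreg l i).2)
        (fun i _ => (hY l i).2.1.mono hAA') (fun i _ => (hd ε L M hreg l i).2)
      exact (s1.sub hp1 s2).mono (le_of_eq (by simp only [D]; ring))
    -- The ensemble error shows no decay in the level: all L + 1 levels contribute equally, which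
    -- produces the next power of L + 1.
    · rw [Finset.sum_const, Finset.card_range, nsmul_eq_mul]
      have := mul_errRate_le (L := L) hε n
      calc _ = 16 * (A' * C₁) * ‖g‖ * (((L : ℝ) + 1) * D) := by push_cast; ring
        _ ≤ _ := by gcongr
  -- fluctuations
  have t2 : LpLE S.fieldLaw p (fun w => ∑ l ∈ Finset.range (L + 1),
      (sampleCov (M l) (fun i => (y l i w).1) g - sampleCov (M l) (fun i => (y l i w).2) g
        - (S.predCov n g l - prev (S.predCov n g) l)))
      (C₂ * (Aq * Aq) * C₀ * ‖g‖ * D') := by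
    refine (LpLE.sum hp1 (Finset.range (L + 1))
      (B := fun l => C₂ * (‖g‖ * (Aq * (Aq * r ^ l)) / √(M l))) fun l hl => ?_).mono ?_
    · have hM := hreg.two_le l (by simpa [Nat.lt_succ_iff] using hl)
      have hmp := fun i => S.measurePreserving_eval_fieldLaw (l, i)
      have hm1 := (S.measurable_predictedPair n l).fst
      have hm2 := (S.measurable_predictedPair n l).snd
      have := hfl (fun i w => (y l i w).1) (fun i w => (y l i w).2) g
        (∫ w, (S.predictedPair n l w).1 ∂S.noiseLaw) (∫ w, (S.predictedPair n l w).2 ∂S.noiseLaw)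
        (∫ w, (inner ℝ (S.predictedPair n l w).1 g : ℝ) • (S.predictedPair n l w).1 ∂S.noiseLaw)
        (∫ w, (inner ℝ (S.predictedPair n l w).2 g : ℝ) • (S.predictedPair n l w).2 ∂S.noiseLaw)
        Aq (Aq * r ^ l) (S.iIndepFun_level l (S.measurable_predictedPair n l))
        (fun i => hm1.comp (measurable_pi_apply (l, i)))
        (fun i => hm2.comp (measurable_pi_apply (l, i)))
        (fun i => integral_comp_of_measurePreserving (hmp i) hm1.aestronglyMeasurable)
        (fun i => integral_comp_of_measurePreserving (hmp i) hm2.aestronglyMeasurable)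
        (fun i => integral_comp_of_measurePreserving (hmp i)
          (f := fun w => (inner ℝ (S.predictedPair n l w).1 g : ℝ) • (S.predictedPair n l w).1)
          ((hm1.inner_const (𝕜 := ℝ)).smul hm1).aestronglyMeasurable)
        (fun i => integral_comp_of_measurePreserving (hmp i)
          (f := fun w => (inner ℝ (S.predictedPair n l w).2 g : ℝ) • (S.predictedPair n l w).2)
          ((hm2.inner_const (𝕜 := ℝ)).smul hm2).aestronglyMeasurable)
        (fun i => (hYq l i).1) (fun i => (hYq l i).2.1) (fun i => (hYq l i).2.2) (M l) hM
      rw [prev_predCov]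
      exact this
    · calc _ = C₂ * (Aq * Aq) * ‖g‖ * ∑ l ∈ Finset.range (L + 1), r ^ l / √(M l) := by
            rw [Finset.mul_sum]; exact Finset.sum_congr rfl fun l _ => by ring
        _ ≤ C₂ * (Aq * Aq) * ‖g‖ * (C₀ * D') := by
            gcongr
            exact hreg.stat.trans (by gcongr)
        _ = _ := by ring
  -- Bias: the expectations of the level increments telescope to the covariance of the finest level.
  have t3 : LpLE S.fieldLaw p (fun _ => S.predCov n g L
      - covOp (S.predictLaw (S.meanFieldLaw n)) g) (C₃ * C₀ * ‖g‖ * D') := by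
    refine (LpLE.const (by linarith) _).mono ((hbias g L).trans ?_)
    calc C₃ * ‖g‖ * r ^ L ≤ C₃ * ‖g‖ * (C₀ * D') := by
          gcongr
          exact hreg.bias.trans (by gcongr)
      _ = _ := by ring
  refine (((t1.add hp1 t2).add hp1 t3).congr (ae_of_all _ fun w => ?_)).mono (le_of_eq (by ring))
  have e := sum_range_sub_prev (S.predCov n g) L
  simp only [mlCov, _root_.sum_apply, _root_.sub_apply]
  rw [← Finset.sum_add_distrib, ← e, ← add_sub_assoc, ← Finset.sum_add_distrib]
  congr 1
  exact Finset.sum_congr rfl fun l _ => by simp only [v, y]; abel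

/-- The moment bounds for independent sums need an inner product, which the operator norm lacks. An
operator on `Obs m` is controlled by finitely many columns, and the columns live in `𝓗`. -/
lemma norm_le_sum_norm_single {m : ℕ} (R : Obs m →L[ℝ] 𝓗) :
    ‖R‖ ≤ ∑ j, ‖R (EuclideanSpace.single j 1)‖ := by
  refine ContinuousLinearMap.opNorm_le_bound _ (Finset.sum_nonneg fun _ _ => norm_nonneg _)
    fun x => ?_
  have hx : x = ∑ j, x j • EuclideanSpace.single j (1 : ℝ) := by
    have := ((EuclideanSpace.basisFun (Fin m) ℝ).sum_repr x).symm
    simpa using this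
  conv_lhs => rw [hx]
  rw [map_sum, Finset.sum_mul]
  refine (norm_sum_le _ _).trans (Finset.sum_le_sum fun j _ => ?_)
  rw [map_smul, norm_smul, mul_comm]
  gcongr
  exact PiLp.norm_apply_le x j

/-- The error of the multilevel gain. -/
lemma EnsembleClose.exists_ensGain_sub_le (hS : S.SolverBounds S.noiseLaw) (hR : S.LevelRates r)
    (hC₀ : 0 ≤ C₀) (hB : ∀ k, 0 ≤ B k) {n : ℕ}
    (h : S.EnsembleClose r C₀ B n (fun L M => S.ensPred L M n) (S.predictedPair n)) {p : ℝ}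
    (hp : 2 ≤ p) : ∃ C : ℝ, 0 ≤ C ∧ ∀ ε L M, SampleRegime r C₀ B ε L M →
      LpLE S.fieldLaw p (fun w => S.ensGain L M n w - S.gainAt n) (C * errRate L ε (n + 1)) := by
  have hp1 : 1 ≤ p := by linarith
  obtain ⟨C, hC, hcov⟩ := h.exists_mlCov_sub_le hS hR hC₀ hB hp
  obtain ⟨c, hc, hgain⟩ := S.exists_norm_symGain_sub_le
  set R := S.crossCov (covOp (S.predictLaw (S.meanFieldLaw n))) with hRdef
  set e : Fin m → 𝓗 := fun j => ContinuousLinearMap.adjoint S.H (EuclideanSpace.single j 1)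
  refine ⟨c * (1 + ‖R‖) * ∑ j, C * ‖e j‖, by positivity, fun ε L M hreg => ?_⟩
  have h1 := LpLE.sum hp1 Finset.univ fun j (_ : j ∈ Finset.univ) => (hcov ε L M hreg (e j)).norm
  have hpt : ∀ w, ‖S.ensGain L M n w - S.gainAt n‖ ≤ c * (1 + ‖R‖) *
      ‖∑ j, ‖mlCov L M (fun l i => S.ensPred L M n l i w) (e j)
        - covOp (S.predictLaw (S.meanFieldLaw n)) (e j)‖‖ := fun w => by
    have h2 : S.ensGain L M n w = S.symGain (S.crossCov (mlCov L M fun l i =>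
      S.ensPred L M n l i w)) := S.mlGain_eq_symGain L M _
    rw [h2, gainAt_eq_symGain hS hR, ← hRdef]
    refine (hgain _ _).trans ?_
    gcongr
    exact (norm_le_sum_norm_single _).trans (Real.le_norm_self _)
  refine (LpLE.of_norm_le_mul (f := fun w => S.ensGain L M n w - S.gainAt n) h1
    ((S.stronglyMeasurable_ensGain L M n).aestronglyMeasurable.sub aestronglyMeasurable_const)
    hpt (by positivity)).mono (le_of_eq ?_)
  rw [← Finset.sum_mul, mul_assoc, mul_assoc, mul_assoc]

/-- The difference is (I - QK'H)(v - v') - Q(K - K')Hv + Q(K - K')z. In the first part the gain is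
deterministic; in the others a random gain error multiplies a random vector, so Hölder's inequality
asks for the exponent 2p. -/
lemma LpLE.updateState_sub {α : Type*} [MeasurableSpace α] {μ : Measure α}
    [IsProbabilityMeasure μ] (S : FilterModel 𝓗 Ξ m)
    {p D A D' B : ℝ} (hp : 1 ≤ p) {Q : 𝓗 →L[ℝ] 𝓗} (hQ : ‖Q‖ ≤ 1) {K : α → Obs m →L[ℝ] 𝓗}
    {K' : Obs m →L[ℝ] 𝓗} {v v' : α → 𝓗} {z : α → Obs m} (hKm : StronglyMeasurable K)
    (hvm : Measurable v) (hzm : Measurable z)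
    (hd : LpLE μ (2 * p) (fun w => v w - v' w) D) (hv : LpLE μ (2 * p) v A)
    (hK : LpLE μ (2 * p) (fun w => K w - K') D') (hz : LpLE μ (2 * p) z B) :
    LpLE μ p (fun w => S.updateState Q (K w) (z w) (v w) - S.updateState Q K' (z w) (v' w))
      (D + ‖K'‖ * ‖S.H‖ * D + D' * (‖S.H‖ * A) + D' * B) := by
  have hd1 := hd.mono_exp (p := p) (by linarith)
  have n1 : ‖Q ∘L K' ∘L S.H‖ ≤ ‖K'‖ * ‖S.H‖ :=
    (ContinuousLinearMap.opNorm_comp_le _ _).trans ((mul_le_mul hQ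
      (ContinuousLinearMap.opNorm_comp_le _ _) (norm_nonneg _) zero_le_one).trans (one_mul _).le)
  have happ : ∀ {x : α → Obs m}, Measurable x →
      AEStronglyMeasurable (fun w => Q ((K w - K') (x w))) μ := fun hx =>
    Q.continuous.comp_aestronglyMeasurable
      ((isBoundedBilinearMap_apply (𝕜 := ℝ) (E := Obs m)
        (F := 𝓗)).continuous.comp_stronglyMeasurable ((hKm.sub stronglyMeasurable_const).prodMk
          hx.stronglyMeasurable)).aestronglyMeasurable
  have hbd : ∀ w (x : Obs m), ‖Q ((K w - K') x)‖ ≤ ‖K w - K'‖ * ‖x‖ := fun w x =>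
    (Q.le_of_opNorm_le hQ _).trans (by rw [one_mul]; exact (K w - K').le_opNorm x)
  have t3 : LpLE μ p (fun w => Q ((K w - K') (S.H (v w)))) (D' * (‖S.H‖ * A)) :=
    hK.mul (hv.clm S.H) (happ (S.H.continuous.measurable.comp hvm)) fun w => hbd w _
  have t4 : LpLE μ p (fun w => Q ((K w - K') (z w))) (D' * B) :=
    hK.mul hz (happ hzm) fun w => hbd w _
  refine ((((hd1.sub hp (hd1.clm (Q ∘L K' ∘L S.H))).sub hp t3).add hp t4).congr
    (ae_of_all _ fun w => ?_)).mono ?_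
  · simp only [updateState, ContinuousLinearMap.comp_apply, map_sub, _root_.sub_apply]
    abel
  · have := hd.nonneg
    gcongr

/-- Propagation of the error through the update. -/
lemma EnsembleClose.update (hS : S.SolverBounds S.noiseLaw) (hR : S.LevelRates r)
    (hC₀ : 0 ≤ C₀) (hB : ∀ k, 0 ≤ B k) {n : ℕ}
    (h : S.EnsembleClose r C₀ B n (fun L M => S.ensPred L M n) (S.predictedPair n)) :
    S.EnsembleClose r C₀ B (n + 1) (fun L M => S.ens L M (n + 1)) (S.particlePair (n + 1)) := by
  intro p hp
  have hp1 : 1 ≤ p := by linarith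
  have h2p : 2 ≤ 2 * p := by linarith
  obtain ⟨C₁, hC₁, hd⟩ := h (2 * p) h2p
  obtain ⟨C₂, hC₂, hK⟩ := h.exists_ensGain_sub_le hS hR hC₀ hB h2p
  obtain ⟨A, hA, hY⟩ := exists_predictedPair_le hS hR h2p n
  obtain ⟨A', hAA', hX⟩ := h.exists_le h2p hB fun l i => ⟨(hY l i).1, (hY l i).2.1⟩
  obtain ⟨Bz, hz⟩ := (S.memLp_obs_noise n (2 * p)).exists_lpLE
  have hBz := hz.nonneg
  have hA'0 : 0 ≤ A' := hA.trans hAA'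
  set K := S.gainAt n
  refine ⟨C₁ + ‖K‖ * ‖S.H‖ * C₁ + C₂ * (‖S.H‖ * A') + C₂ * Bz, by positivity,
    fun ε L M hreg l i => ?_⟩
  have hmv := S.measurable_ensPred L M n l i
  have hKm := S.stronglyMeasurable_ensGain L M n
  have hzm : Measurable fun w : ℕ × ℕ → Noise 𝓗 Ξ m => S.y (n + 1) + ((w (l, i)).2 n).2 :=
    (measurable_noise_snd _ n).const_add _
  have hz' : LpLE S.fieldLaw (2 * p) (fun w => S.y (n + 1) + ((w (l, i)).2 n).2) Bz :=
    LpLE.comp (f := fun w : Noise 𝓗 Ξ m => S.y (n + 1) + (w.2 n).2)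
      (S.measurePreserving_eval_fieldLaw (l, i)) hz
  have hDD := errRate_le_succ (L := L) hreg.pos.le n
  have hfin : C₁ * errRate L ε n + ‖K‖ * ‖S.H‖ * (C₁ * errRate L ε n)
      + C₂ * errRate L ε (n + 1) * (‖S.H‖ * A') + C₂ * errRate L ε (n + 1) * Bz
      ≤ (C₁ + ‖K‖ * ‖S.H‖ * C₁ + C₂ * (‖S.H‖ * A') + C₂ * Bz) * errRate L ε (n + 1) := by
    calc _ ≤ C₁ * errRate L ε (n + 1) + ‖K‖ * ‖S.H‖ * (C₁ * errRate L ε (n + 1))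
      + C₂ * errRate L ε (n + 1) * (‖S.H‖ * A') + C₂ * errRate L ε (n + 1) * Bz := by gcongr
      _ = _ := by ring
  exact ⟨(LpLE.updateState_sub S hp1 (S.norm_P_le_one l) hKm hmv.fst hzm (hd ε L M hreg l i).1
      (hX ε L M hreg l i).1 (hK ε L M hreg) hz').mono hfin,
    (LpLE.updateState_sub S hp1 (S.norm_prev_P_le_one l) hKm hmv.snd hzm (hd ε L M hreg l i).2
      (hX ε L M hreg l i).2 (hK ε L M hreg) hz').mono hfin⟩

/-- The ensemble is close to independent mean-field particles. -/
lemma ensembleClose_particlePair (hS : S.SolverBounds S.noiseLaw)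
    (hSρ : S.SolverBounds S.fieldLaw) (hR : S.LevelRates r) (hC₀ : 0 ≤ C₀) (hB : ∀ k, 0 ≤ B k)
    (n : ℕ) : S.EnsembleClose r C₀ B n (fun L M => S.ens L M n) (S.particlePair n) := by
  induction n with
  | zero =>
    -- Both systems start from the projections of the same initial draw.
    refine fun p hp => ⟨0, le_rfl, fun ε L M hreg l i => ?_⟩
    simp only [ens_zero, particlePair, particle, sub_self, zero_mul]
    exact ⟨LpLE.zero, LpLE.zero⟩
  | succ n ih => exact (ih.predict hS hSρ hR).update hS hR hC₀ hB

/-! ### Lipschitz observables and the multilevel estimator. -/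

lemma _root_.LipschitzWith.memLp_comp {α : Type*} [MeasurableSpace α] {μ : Measure α}
    [IsFiniteMeasure μ] {φ : 𝓗 → ℝ} {c : ℝ≥0} (hφ : LipschitzWith c φ) {X : α → 𝓗} {p : ℝ≥0∞}
    (hX : MemLp X p μ) : MemLp (fun w => φ (X w)) p μ := by
  have h1 : MemLp (fun w => φ (X w) - φ 0) p μ := by
    refine hX.of_le_mul (c := c) ((hφ.continuous.comp_aestronglyMeasurable hX.1).sub
      aestronglyMeasurable_const) (ae_of_all _ fun w => ?_)
    simpa using hφ.norm_sub_le (X w) 0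
  exact (h1.add (memLp_const (φ 0))).ae_eq (ae_of_all _ fun w => by simp)

lemma LpLE.lipschitz_sub {α : Type*} [MeasurableSpace α] {μ : Measure α} {φ : 𝓗 → ℝ} {c : ℝ≥0}
    (hφ : LipschitzWith c φ) {X Y : α → 𝓗} {p B : ℝ} (hX : AEStronglyMeasurable X μ)
    (hY : AEStronglyMeasurable Y μ) (h : LpLE μ p (fun w => X w - Y w) B) :
    LpLE μ p (fun w => φ (X w) - φ (Y w)) (c * B) :=
  h.of_norm_le_mul ((hφ.continuous.comp_aestronglyMeasurable hX).sub
    (hφ.continuous.comp_aestronglyMeasurable hY)) (fun _ => hφ.norm_sub_le _ _) c.2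

lemma integrable_meanFieldLaw (hS : S.SolverBounds S.noiseLaw) (hR : S.LevelRates r) {φ : 𝓗 → ℝ}
    {c : ℝ≥0} (hφ : LipschitzWith c φ) (n : ℕ) : Integrable φ (S.meanFieldLaw n) := by
  rw [← (S.measurePreserving_particle n).map_eq, integrable_map_measure
    hφ.continuous.aestronglyMeasurable (S.measurePreserving_particle n).measurable.aemeasurable]
  refine (hφ.memLp_comp (memLp_limit hS hR (p := 2) le_rfl n).1).integrable ?_
  simp

/-- The multilevel difference of the observable on one pair of mean-field particles. -/
noncomputable def pairDiff (S : FilterModel 𝓗 Ξ m) (φ : 𝓗 → ℝ) (n l : ℕ) (w : Noise 𝓗 Ξ m) : ℝ :=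
  φ (S.particlePair n l w).1 - (if l = 0 then 0 else φ (S.particlePair n l w).2)

/-- On level 0 the observable itself appears rather than a difference, and φ need not vanish at the
origin; hence the term `‖φ 0‖`, which is needed at r^0 = 1 only. -/
lemma exists_pairDiff_le (hS : S.SolverBounds S.noiseLaw) (hR : S.LevelRates r) {φ : 𝓗 → ℝ}
    {c : ℝ≥0} (hφ : LipschitzWith c φ) {p : ℝ} (hp : 2 ≤ p) (n : ℕ) :
    ∃ A : ℝ, 0 ≤ A ∧ ∀ l, LpLE S.noiseLaw p (S.pairDiff φ n l) (A * r ^ l) := by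
  have hp1 : 1 ≤ p := by linarith
  obtain ⟨A, hA, h⟩ := exists_particle_pair_le hS hR hp n
  have hr := hR.pos
  refine ⟨c * A + ‖φ 0‖, by positivity, fun l => ?_⟩
  cases l with
  | zero =>
    have h1 := LpLE.lipschitz_sub hφ (h 0).1.aesm
      (aestronglyMeasurable_const (b := (0 : 𝓗))) (by simpa using (h 0).1)
    refine ((h1.add hp1 (LpLE.const (by linarith) (φ 0))).congr (ae_of_all _ fun w => ?_)).mono ?_
    · simp [pairDiff, particlePair]
    · simp
  | succ l =>
    have h1 := LpLE.lipschitz_sub hφ (h (l + 1)).1.aesm (h (l + 1)).2.1.aesm (h (l + 1)).2.2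
    refine (h1.congr (ae_of_all _ fun w => ?_)).mono ?_
    · simp [pairDiff, particlePair]
    · rw [← mul_assoc]
      gcongr
      simp

/-- The error of the multilevel estimator. -/
lemma exists_mlEstimator_sub_le (hS : S.SolverBounds S.noiseLaw) (hSρ : S.SolverBounds S.fieldLaw)
    (hR : S.LevelRates r) (hC₀ : 0 ≤ C₀) (hB : ∀ k, 0 ≤ B k) {φ : 𝓗 → ℝ} {c : ℝ≥0}
    (hφ : LipschitzWith c φ) (n : ℕ) {p : ℝ} (hp : 2 ≤ p) :
    ∃ C : ℝ, 0 ≤ C ∧ ∀ ε L M, SampleRegime r C₀ B ε L M →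
      LpLE S.fieldLaw p (fun w => S.mlEstimator L M n φ (fun l i => w (l, i))
        - ∫ x, φ x ∂(S.meanFieldLaw n)) (C * (((L : ℝ) + 1) ^ n * ε)) := by
  have hp1 : 1 ≤ p := by linarith
  have hev : 2 ≤ evenExp p := by
    have := le_evenExp p
    have : (2 : ℝ) ≤ evenExp p := by linarith
    exact_mod_cast this
  obtain ⟨C₁, hC₁, hd⟩ := ensembleClose_particlePair (C₀ := C₀) hS hSρ hR hC₀ hB n p hp
  obtain ⟨A, hA, hG⟩ := exists_pairDiff_le hS hR hφ (p := evenExp p) (by exact_mod_cast hev) n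
  obtain ⟨C₂, hC₂, hmean⟩ := exists_sampleMean_sub_le (μ := S.fieldLaw) (E := ℝ) p hp1
  obtain ⟨C₃, hC₃, hbias⟩ := exists_particle_sub_le hS hR (p := 2) le_rfl n
  have hr := hR.pos
  refine ⟨2 * (c * C₁) + C₂ * A * C₀ + c * C₃ * C₀, by positivity, fun ε L M hreg => ?_⟩
  have hε := hreg.pos.le
  -- The index is n + 1 although the ensemble error has order `errRate L ε n`: the sum over levels
  -- in the estimator costs another factor L + 1.
  change LpLE _ _ _ (_ * errRate L ε (n + 1))
  set D := errRate L ε n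
  set D' := errRate L ε (n + 1)
  have hD : 0 ≤ D := errRate_nonneg hε n
  have hεD : ε ≤ D' := le_errRate_succ hε n
  have hGm : ∀ l, Measurable (S.pairDiff φ n l) := fun l => by
    have hm := S.measurable_particlePair n l
    unfold pairDiff
    split_ifs
    · exact (hφ.continuous.measurable.comp hm.fst).sub measurable_const
    · exact (hφ.continuous.measurable.comp hm.fst).sub (hφ.continuous.measurable.comp hm.snd)
  -- Replacement of the interacting ensemble by the i.i.d. mean-field particles.
  have t1 : LpLE S.fieldLaw p (fun w => ∑ l ∈ Finset.range (L + 1), sampleMean (M l) fun i =>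
      ((φ (S.ens L M n l i w).1 - φ (S.particlePair n l (w (l, i))).1)
        - (if l = 0 then 0 else
          φ (S.ens L M n l i w).2 - φ (S.particlePair n l (w (l, i))).2)))
      (2 * (c * C₁) * D') := by
    refine (LpLE.sum hp1 (Finset.range (L + 1)) (B := fun _ => 2 * (c * C₁) * D)
      fun l hl => ?_).mono ?_
    · refine LpLE.sampleMean (v := fun i w =>
        ((φ (S.ens L M n l i w).1 - φ (S.particlePair n l (w (l, i))).1)
        - (if l = 0 then 0 else
          φ (S.ens L M n l i w).2 - φ (S.particlePair n l (w (l, i))).2)))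
        hp1 (by positivity) fun i hi => ?_
      obtain ⟨d1, d2⟩ := hd ε L M hreg l i
      have hme := S.measurable_ens L M n l i
      have hmp : Measurable fun w : ℕ × ℕ → Noise 𝓗 Ξ m => S.particlePair n l (w (l, i)) :=
        (S.measurable_particlePair n l).comp (measurable_pi_apply (l, i))
      have b1 := LpLE.lipschitz_sub hφ hme.fst.aestronglyMeasurable hmp.fst.aestronglyMeasurable d1
      have b2 := LpLE.lipschitz_sub hφ hme.snd.aestronglyMeasurable hmp.snd.aestronglyMeasurable d2
      by_cases hl0 : l = 0
      · subst hl0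
        simp only [if_true, sub_zero]
        refine b1.mono ?_
        have : 0 ≤ c * C₁ * D := by positivity
        simp only [D] at this ⊢
        nlinarith
      · simp only [if_neg hl0]
        exact (b1.sub hp1 b2).mono (le_of_eq (by simp only [D]; ring))
    · rw [Finset.sum_const, Finset.card_range, nsmul_eq_mul]
      have := mul_errRate_le (L := L) hε n
      calc _ = 2 * (c * C₁) * (((L : ℝ) + 1) * D) := by push_cast; ring
        _ ≤ _ := by gcongr
  -- Monte Carlo fluctuation of the i.i.d. system.
  have t2 : LpLE S.fieldLaw p (fun w => ∑ l ∈ Finset.range (L + 1),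
      ((sampleMean (M l) fun i => S.pairDiff φ n l (w (l, i)))
        - ∫ w, S.pairDiff φ n l w ∂S.noiseLaw)) (C₂ * A * C₀ * D') := by
    refine (LpLE.sum hp1 (Finset.range (L + 1))
      (B := fun l => C₂ * (A * r ^ l / √(M l))) fun l hl => ?_).mono ?_
    · have hM := hreg.two_le l (by simpa [Nat.lt_succ_iff] using hl)
      exact hmean (fun i w => S.pairDiff φ n l (w (l, i))) _ (A * r ^ l)
        (S.iIndepFun_level l (hGm l)) (fun i => (hGm l).comp (measurable_pi_apply (l, i)))
        (fun i => integral_comp_of_measurePreserving (S.measurePreserving_eval_fieldLaw (l, i))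
          (hGm l).aestronglyMeasurable)
        (fun i => (hG l).comp (S.measurePreserving_eval_fieldLaw (l, i))) (M l) (by omega)
    · calc _ = C₂ * A * ∑ l ∈ Finset.range (L + 1), r ^ l / √(M l) := by
            rw [Finset.mul_sum]; exact Finset.sum_congr rfl fun l _ => by ring
        _ ≤ C₂ * A * (C₀ * D') := by
            gcongr
            exact hreg.stat.trans (by gcongr)
        _ = _ := by ring
  have hint : ∀ l, Integrable (fun w => φ (S.particle (S.Ψlev l) (S.P l) n w)) S.noiseLaw :=
    fun l => by
      obtain ⟨A', -, h'⟩ := exists_particle_pair_le hS hR (p := 2) le_rfl n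
      exact (hφ.memLp_comp (h' l).1.memLp).integrable (by simp)
  have hlim : Integrable (fun w => φ (S.particle S.Ψ (ContinuousLinearMap.id ℝ 𝓗) n w))
      S.noiseLaw :=
    (hφ.memLp_comp (memLp_limit hS hR (p := 2) le_rfl n).1).integrable (by simp)
  -- The expectation of the i.i.d. estimator telescopes to the finest level; what then remains is
  -- the weak error of that level, bounded below by the strong one.
  have etel : ∑ l ∈ Finset.range (L + 1), ∫ w, S.pairDiff φ n l w ∂S.noiseLaw
      = ∫ w, φ (S.particle (S.Ψlev L) (S.P L) n w) ∂S.noiseLaw := by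
    rw [← sum_range_sub_prev (fun l => ∫ w, φ (S.particle (S.Ψlev l) (S.P l) n w) ∂S.noiseLaw) L]
    refine Finset.sum_congr rfl fun l _ => ?_
    cases l with
    | zero => simp [pairDiff, particlePair, prev]
    | succ l =>
      simp only [pairDiff, particlePair, prev, if_neg (Nat.succ_ne_zero l)]
      exact integral_sub (hint (l + 1)) (hint l)
  have t3 : LpLE S.fieldLaw p (fun _ => ∫ w, φ (S.particle (S.Ψlev L) (S.P L) n w) ∂S.noiseLaw
      - ∫ x, φ x ∂(S.meanFieldLaw n)) (c * C₃ * C₀ * D') := by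
    refine (LpLE.const (by linarith) _).mono ?_
    rw [← integral_comp_of_measurePreserving (S.measurePreserving_particle n)
      hφ.continuous.aestronglyMeasurable, ← integral_sub (hint L) hlim]
    have h1 := (LpLE.lipschitz_sub hφ
      (S.measurable_particle (S.measurable_Ψlev L) _ n).aestronglyMeasurable
      (memLp_limit hS hR (p := 2) le_rfl n).1.1 (hbias L)).norm_integral_le (by norm_num)
    refine h1.trans ?_
    calc (c : ℝ) * (C₃ * r ^ L) ≤ c * (C₃ * (C₀ * D')) := by
          gcongr
          exact hreg.bias.trans (by gcongr)
      _ = _ := by ring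
  refine (((t1.add hp1 t2).add hp1 t3).congr (ae_of_all _ fun w => ?_)).mono (le_of_eq (by ring))
  beta_reduce
  rw [← etel, ← Finset.sum_add_distrib, ← add_sub_assoc, ← Finset.sum_add_distrib, mlEstimator]
  congr 1
  refine Finset.sum_congr rfl fun l _ => ?_
  rw [add_assoc, sub_add_cancel]
  simp only [sampleMean, ← smul_add, ← Finset.sum_add_distrib]
  congr 2
  funext i
  simp only [pairDiff, ens]
  split_ifs <;> ring

end Induction

end FilterModel

end MLEnKF

namespace MLEnKF

/-! ### Comparable sequences -/

section Comparable

variable {f g k : ℕ → ℝ} {s : ℝ}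

lemma Comparable.trans (h₁ : Comparable f g) (h₂ : Comparable g k) : Comparable f k := by
  obtain ⟨a, ha, b, hb, h⟩ := h₁
  obtain ⟨a', ha', b', hb', h'⟩ := h₂
  refine ⟨a * a', by positivity, b * b', by positivity, fun l => ⟨?_, ?_⟩⟩
  · rw [mul_assoc]
    exact (mul_le_mul_of_nonneg_left (h' l).1 ha.le).trans (h l).1
  · rw [mul_assoc]
    exact (h l).2.trans (mul_le_mul_of_nonneg_left (h' l).2 hb.le)

lemma Comparable.pos (h : Comparable f g) (hg : ∀ l, 0 < g l) (l : ℕ) : 0 < f l := by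
  obtain ⟨a, ha, b, hb, h⟩ := h
  exact (mul_pos ha (hg l)).trans_le (h l).1

lemma Comparable.rpow (h : Comparable f g) (hg : ∀ l, 0 < g l) (θ : ℝ) :
    Comparable (fun l => f l ^ θ) (fun l => g l ^ θ) := by
  have hf := h.pos hg
  obtain ⟨a, ha, b, hb, h⟩ := h
  rcases le_total 0 θ with hθ | hθ
  · refine ⟨a ^ θ, by positivity, b ^ θ, by positivity, fun l => ⟨?_, ?_⟩⟩
    · rw [← Real.mul_rpow ha.le (hg l).le]
      exact Real.rpow_le_rpow (mul_pos ha (hg l)).le (h l).1 hθ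
    · rw [← Real.mul_rpow hb.le (hg l).le]
      exact Real.rpow_le_rpow (hf l).le (h l).2 hθ
  · refine ⟨b ^ θ, by positivity, a ^ θ, by positivity, fun l => ⟨?_, ?_⟩⟩
    · rw [← Real.mul_rpow hb.le (hg l).le]
      exact Real.rpow_le_rpow_of_nonpos (hf l) (h l).2 hθ
    · rw [← Real.mul_rpow ha.le (hg l).le]
      exact Real.rpow_le_rpow_of_nonpos (mul_pos ha (hg l)) (h l).1 hθ

lemma pow_rpow_eq (hs : 0 < s) (l : ℕ) (θ : ℝ) : (s ^ l) ^ θ = s ^ (θ * l) := by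
  rw [← Real.rpow_natCast, ← Real.rpow_mul hs.le, mul_comm]

end Comparable

/-! ### Geometric sums -/

section Geometric

variable {s θ : ℝ}

lemma exists_sum_rpow_le (hs : 0 < s) (hs1 : s < 1) (hθ : 0 < θ) :
    ∃ G : ℝ, 0 ≤ G ∧ ∀ L : ℕ, ∑ l ∈ Finset.range (L + 1), s ^ (θ * (l : ℝ)) ≤ G := by
  have h1 : s ^ θ < 1 := Real.rpow_lt_one hs.le hs1 hθ
  have h0 : 0 ≤ s ^ θ := by positivity
  refine ⟨∑' l : ℕ, (s ^ θ) ^ l, tsum_nonneg fun _ => by positivity, fun L => ?_⟩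
  simp only [Real.rpow_mul hs.le, Real.rpow_natCast]
  exact (summable_geometric_of_lt_one h0 h1).sum_le_tsum _ fun _ _ => by positivity

lemma exists_sum_rpow_sub_le (hs : 0 < s) (hs1 : s < 1) (hθ : 0 < θ) :
    ∃ G : ℝ, 0 ≤ G ∧ ∀ L : ℕ, ∑ l ∈ Finset.range (L + 1), s ^ (θ * ((L : ℝ) - l)) ≤ G := by
  obtain ⟨G, hG, h⟩ := exists_sum_rpow_le hs hs1 hθ
  refine ⟨G, hG, fun L => (le_of_eq ?_).trans (h L)⟩
  rw [← Finset.sum_range_reflect]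
  refine Finset.sum_congr rfl fun l hl => ?_
  have : l ≤ L := by simpa [Nat.lt_succ_iff] using hl
  rw [show L + 1 - 1 - l = L - l by omega, Nat.cast_sub this]
  congr 2; ring

/-- The factor `q` accommodates the L² in the critical case, where q = L; otherwise q = 1. -/
lemma rpow_div_sqrt_le {c q b A M : ℝ} (hs : 0 < s) (hc : 0 < c) (hq : 0 < q)
    (h : c * (q ^ 2 * s ^ A) ≤ M) : s ^ b / √M ≤ (√c)⁻¹ * q⁻¹ * s ^ (b - A / 2) := by
  have h1 : √c * (q * s ^ (A / 2)) ≤ √M := by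
    have e : √c * (q * s ^ (A / 2)) = √(c * (q ^ 2 * s ^ A)) := by
      rw [Real.sqrt_mul hc.le, Real.sqrt_mul (by positivity), Real.sqrt_sq hq.le,
        Real.sqrt_eq_rpow (s ^ A), ← Real.rpow_mul hs.le]
      congr 3; ring
    rw [e]; exact Real.sqrt_le_sqrt h
  have hpos : 0 < √c * (q * s ^ (A / 2)) := by positivity
  refine (div_le_div_of_nonneg_left (by positivity) hpos h1).trans (le_of_eq ?_)
  rw [Real.rpow_sub hs]
  field_simp

end Geometric

/-! ### The sample sizes -/

section Rates

variable {s β γ : ℝ} {d : ℕ}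

lemma sampleRate_geom_of_lt (hs : 0 < s) (h : (d : ℝ) * γ < β) (L l : ℕ) :
    sampleRate (fun l => s ^ l) d β γ L l = s ^ ((β + d * γ) / 2 * l - β * L) := by
  simp only [sampleRate, if_pos h, pow_rpow_eq hs, ← Real.rpow_add hs]
  congr 1; ring

lemma sampleRate_geom_of_eq (hs : 0 < s) (h : β = (d : ℝ) * γ) (L l : ℕ) :
    sampleRate (fun l => s ^ l) d β γ L l = (L : ℝ) ^ 2 * s ^ (β * l - β * L) := by
  have h1 : ¬ (d : ℝ) * γ < β := by rw [h]; exact lt_irrefl _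
  simp only [sampleRate, if_neg h1, if_pos h, pow_rpow_eq hs]
  rw [mul_right_comm, ← Real.rpow_add hs, mul_comm]
  congr 2; rw [← h]; ring

lemma sampleRate_geom_of_gt (hs : 0 < s) (h : β < (d : ℝ) * γ) (L l : ℕ) :
    sampleRate (fun l => s ^ l) d β γ L l
      = s ^ ((β + d * γ) / 2 * l - (β + d * γ) / 2 * L) := by
  simp only [sampleRate, if_neg h.not_gt, if_neg h.ne, pow_rpow_eq hs, ← Real.rpow_add hs]
  congr 1; ring

/-- Replaces `h` by the exact geometric sequence at the price of constants, valid for either sign of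
the exponents, so that the sums over levels become explicit. -/
lemma exists_sampleRate_bounds {h : ℕ → ℝ} (hs : 0 < s) (hc : Comparable h fun l => s ^ l)
    (d : ℕ) (β γ : ℝ) : ∃ e₁ > 0, ∃ e₂ > 0, ∀ L l,
      e₁ * sampleRate (fun l => s ^ l) d β γ L l ≤ sampleRate h d β γ L l ∧
      sampleRate h d β γ L l ≤ e₂ * sampleRate (fun l => s ^ l) d β γ L l := by
  have hg : ∀ l : ℕ, 0 < s ^ l := fun l => by positivity
  have hp := hc.pos hg
  have key : ∀ (θ η : ℝ) (b : ℕ → ℝ), (∀ L, 0 ≤ b L) → ∃ e₁ > 0, ∃ e₂ > 0, ∀ L l,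
      e₁ * ((s ^ l) ^ θ * b L * (s ^ L) ^ η) ≤ h l ^ θ * b L * h L ^ η ∧
      h l ^ θ * b L * h L ^ η ≤ e₂ * ((s ^ l) ^ θ * b L * (s ^ L) ^ η) := by
    intro θ η b hb
    obtain ⟨a₁, ha₁, a₂, ha₂, h1⟩ := hc.rpow hg θ
    obtain ⟨b₁, hb₁, b₂, hb₂, h2⟩ := hc.rpow hg η
    refine ⟨a₁ * b₁, by positivity, a₂ * b₂, by positivity, fun L l => ?_⟩
    have := hb L
    have := hp l
    have := hp L
    constructor
    · calc _ = (a₁ * (s ^ l) ^ θ) * b L * (b₁ * (s ^ L) ^ η) := by ring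
        _ ≤ _ := by
          gcongr
          · exact (h1 l).1
          · exact (h2 L).1
    · calc _ ≤ (a₂ * (s ^ l) ^ θ) * b L * (b₂ * (s ^ L) ^ η) := by
            gcongr
            · exact (h1 l).2
            · exact (h2 L).2
        _ = _ := by ring
  unfold sampleRate
  split_ifs with h1 h2
  · simpa using key ((β + d * γ) / 2) (-β) (fun _ => 1) fun _ => zero_le_one
  · exact key ((β + d * γ) / 2) (-β) (fun L => (L : ℝ) ^ 2) fun _ => by positivity
  · simpa using key ((β + d * γ) / 2) (-((β + d * γ) / 2)) (fun _ => 1) fun _ => zero_le_one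

/-- The statistical error for sample sizes of the prescribed order. -/
lemma exists_stat_le (hs : 0 < s) (hs1 : s < 1) (d : ℕ) (β γ : ℝ) {c : ℝ} (hc : 0 < c) :
    ∃ C : ℝ, 0 ≤ C ∧ ∀ (L : ℕ) (M : ℕ → ℕ), 1 ≤ L →
      (∀ l ≤ L, c * sampleRate (fun l => s ^ l) d β γ L l ≤ M l) →
      ∑ l ∈ Finset.range (L + 1), s ^ (β / 2 * (l : ℝ)) / √(M l) ≤ C * s ^ (β / 2 * (L : ℝ)) := by
  have hmem : ∀ {L l : ℕ}, l ∈ Finset.range (L + 1) → l ≤ L := fun h => by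
    simpa [Nat.lt_succ_iff] using h
  rcases lt_trichotomy ((d : ℝ) * γ) β with h | h | h
  -- The summand equals, up to a constant, s^(βL/2) s^((β-dγ)l/4): a geometric series dominated by
  -- the coarse levels.
  · obtain ⟨G, hG, hsum⟩ := exists_sum_rpow_le hs hs1 (θ := (β - d * γ) / 4) (by linarith)
    refine ⟨(√c)⁻¹ * G, by positivity, fun L M hL hM => ?_⟩
    calc _ ≤ ∑ l ∈ Finset.range (L + 1),
          (√c)⁻¹ * s ^ ((β - d * γ) / 4 * (l : ℝ)) * s ^ (β / 2 * (L : ℝ)) := by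
          refine Finset.sum_le_sum fun l hl => ?_
          have h1 := hM l (hmem hl)
          rw [sampleRate_geom_of_lt hs h] at h1
          refine (rpow_div_sqrt_le hs hc one_pos (by rwa [one_pow, one_mul])).trans (le_of_eq ?_)
          rw [inv_one, mul_one, mul_assoc, ← Real.rpow_add hs]
          congr 2; ring
      _ ≤ _ := by
          rw [← Finset.sum_mul, ← Finset.mul_sum]
          gcongr
          exact hsum L
  -- Critical case: every level contributes s^(βL/2)/L, and (L+1)/L ≤ 2 since L ≥ 1. The L² in the
  -- sample sizes is there to absorb the number of levels.
  · refine ⟨2 * (√c)⁻¹, by positivity, fun L M hL hM => ?_⟩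
    have hL0 : (1 : ℝ) ≤ L := by exact_mod_cast hL
    calc _ ≤ ∑ l ∈ Finset.range (L + 1), (√c)⁻¹ * (L : ℝ)⁻¹ * s ^ (β / 2 * (L : ℝ)) := by
          refine Finset.sum_le_sum fun l hl => ?_
          have h1 := hM l (hmem hl)
          rw [sampleRate_geom_of_eq hs h.symm] at h1
          refine (rpow_div_sqrt_le hs hc (by linarith) h1).trans (le_of_eq ?_)
          congr 2; ring
      _ = (((L : ℝ) + 1) * (L : ℝ)⁻¹) * ((√c)⁻¹ * s ^ (β / 2 * (L : ℝ))) := by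
          rw [Finset.sum_const, Finset.card_range, nsmul_eq_mul]; push_cast; ring
      _ ≤ 2 * ((√c)⁻¹ * s ^ (β / 2 * (L : ℝ))) := by
          gcongr
          rw [← div_eq_mul_inv, div_le_iff₀ (by linarith)]
          linarith
      _ = _ := by ring
  -- Now the summand is of order s^(βL/2) s^((dγ-β)(L-l)/4), dominated by the fine levels.
  · obtain ⟨G, hG, hsum⟩ := exists_sum_rpow_sub_le hs hs1 (θ := (d * γ - β) / 4) (by linarith)
    refine ⟨(√c)⁻¹ * G, by positivity, fun L M hL hM => ?_⟩
    calc _ ≤ ∑ l ∈ Finset.range (L + 1),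
          (√c)⁻¹ * s ^ ((d * γ - β) / 4 * ((L : ℝ) - l)) * s ^ (β / 2 * (L : ℝ)) := by
          refine Finset.sum_le_sum fun l hl => ?_
          have h1 := hM l (hmem hl)
          rw [sampleRate_geom_of_gt hs h] at h1
          refine (rpow_div_sqrt_le hs hc one_pos (by rwa [one_pow, one_mul])).trans (le_of_eq ?_)
          rw [inv_one, mul_one, mul_assoc, ← Real.rpow_add hs]
          congr 2; ring
      _ ≤ _ := by
          rw [← Finset.sum_mul, ← Finset.mul_sum]
          gcongr
          exact hsum L

/-- The work over all levels for sample sizes of the prescribed order. -/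
lemma exists_work_le (hs : 0 < s) (hs1 : s < 1) (d : ℕ) (β γ : ℝ) {c : ℝ} (hc : 0 < c) :
    ∃ C : ℝ, 0 ≤ C ∧ ∀ (L : ℕ) (M : ℕ → ℕ),
      (∀ l ≤ L, M l ≤ c * sampleRate (fun l => s ^ l) d β γ L l) →
      ∑ l ∈ Finset.range (L + 1), M l * s ^ (-(d * γ) * (l : ℝ)) ≤
        C * (if (d : ℝ) * γ < β then s ^ (-β * (L : ℝ))
          else if β = d * γ then ((L : ℝ) + 1) ^ 3 * s ^ (-β * (L : ℝ))
          else s ^ (-(d * γ) * (L : ℝ))) := by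
  have hmem : ∀ {L l : ℕ}, l ∈ Finset.range (L + 1) → l ≤ L := fun h => by
    simpa [Nat.lt_succ_iff] using h
  rcases lt_trichotomy ((d : ℝ) * γ) β with h | h | h
  -- The work of a level is of order s^(-βL) s^((β-dγ)l/2), which decays in l.
  · obtain ⟨G, hG, hsum⟩ := exists_sum_rpow_le hs hs1 (θ := (β - d * γ) / 2) (by linarith)
    refine ⟨c * G, by positivity, fun L M hM => ?_⟩
    rw [if_pos h]
    calc _ ≤ ∑ l ∈ Finset.range (L + 1),
          c * s ^ ((β - d * γ) / 2 * (l : ℝ)) * s ^ (-β * (L : ℝ)) := by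
          refine Finset.sum_le_sum fun l hl => ?_
          have h1 := hM l (hmem hl)
          rw [sampleRate_geom_of_lt hs h] at h1
          refine (mul_le_mul_of_nonneg_right h1 (by positivity)).trans (le_of_eq ?_)
          rw [mul_assoc, mul_assoc, ← Real.rpow_add hs, ← Real.rpow_add hs]
          congr 2; ring
      _ ≤ _ := by
          rw [← Finset.sum_mul, ← Finset.mul_sum]
          gcongr
          exact hsum L
  -- All levels cost the same, L² s^(-βL); the sum over L + 1 levels gives the cubic factor, hence
  -- the cubed logarithm.
  · refine ⟨c, hc.le, fun L M hM => ?_⟩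
    rw [if_neg (by rw [h]; exact lt_irrefl _), if_pos h.symm]
    calc _ ≤ ∑ l ∈ Finset.range (L + 1), c * (L : ℝ) ^ 2 * s ^ (-β * (L : ℝ)) := by
          refine Finset.sum_le_sum fun l hl => ?_
          have h1 := hM l (hmem hl)
          rw [sampleRate_geom_of_eq hs h.symm] at h1
          refine (mul_le_mul_of_nonneg_right h1 (by positivity)).trans (le_of_eq ?_)
          rw [mul_assoc, mul_assoc, mul_assoc, ← Real.rpow_add hs, h]
          congr 3; ring
      _ = c * ((((L : ℝ) + 1) * (L : ℝ) ^ 2) * s ^ (-β * (L : ℝ))) := by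
          rw [Finset.sum_const, Finset.card_range, nsmul_eq_mul]; push_cast; ring
      _ ≤ _ := by
          rw [pow_succ' _ 2]
          gcongr
          linarith
  -- The work of a level is of order s^(-dγL) s^((dγ-β)(L-l)/2), dominated by the finest level.
  · obtain ⟨G, hG, hsum⟩ := exists_sum_rpow_sub_le hs hs1 (θ := (d * γ - β) / 2) (by linarith)
    refine ⟨c * G, by positivity, fun L M hM => ?_⟩
    rw [if_neg h.not_gt, if_neg h.ne]
    calc _ ≤ ∑ l ∈ Finset.range (L + 1),
          c * s ^ ((d * γ - β) / 2 * ((L : ℝ) - l)) * s ^ (-(d * γ) * (L : ℝ)) := by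
          refine Finset.sum_le_sum fun l hl => ?_
          have h1 := hM l (hmem hl)
          rw [sampleRate_geom_of_gt hs h] at h1
          refine (mul_le_mul_of_nonneg_right h1 (by positivity)).trans (le_of_eq ?_)
          rw [mul_assoc, mul_assoc, ← Real.rpow_add hs, ← Real.rpow_add hs]
          congr 2; ring
      _ ≤ _ := by
          rw [← Finset.sum_mul, ← Finset.mul_sum]
          gcongr
          exact hsum L

end Rates

/-! ### The finest level -/

section FinestLevel

variable {κ β ε ε₀ : ℝ} {d : ℕ}

lemma logb_inv_eq (hε : 0 < ε) (hε1 : ε < 1) : Real.logb κ ε⁻¹ = |Real.log ε| / Real.log κ := by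
  rw [Real.logb, Real.log_inv, abs_of_neg (Real.log_neg hε hε1)]

/-- Without the ceiling the finest level would give s^(βL/2) = ε exactly; this identity motivates
the definition. -/
lemma rpow_finestLevel (hd : 0 < d) (hκ : 1 < κ) (hβ : 0 < β) (hε : 0 < ε) :
    (κ ^ (-(1 / (d : ℝ)))) ^ (β / 2 * (2 * (d : ℝ) * Real.logb κ ε⁻¹ / β)) = ε := by
  have hd' : (0 : ℝ) < d := by exact_mod_cast hd
  rw [← Real.rpow_mul (by linarith),
    show -(1 / (d : ℝ)) * (β / 2 * (2 * (d : ℝ) * Real.logb κ ε⁻¹ / β)) = -Real.logb κ ε⁻¹ by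
      field_simp,
    Real.rpow_neg (by linarith), Real.rpow_logb (by linarith) hκ.ne' (by positivity), inv_inv]

/-- The ceiling adds less than one level, so the lower bound loses only the factor s^(β/2). Accuracy
uses the upper bound, cost the lower one. -/
lemma finestLevel_bounds (hd : 0 < d) (hκ : 1 < κ) (hβ : 0 < β) (hε : 0 < ε) (hε1 : ε < 1) :
    1 ≤ finestLevel d κ β ε ∧
    (κ ^ (-(1 / (d : ℝ)))) ^ (β / 2 * (finestLevel d κ β ε : ℝ)) ≤ ε ∧
    ε * (κ ^ (-(1 / (d : ℝ)))) ^ (β / 2)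
      ≤ (κ ^ (-(1 / (d : ℝ)))) ^ (β / 2 * (finestLevel d κ β ε : ℝ)) := by
  have hd' : (0 : ℝ) < d := by exact_mod_cast hd
  have hlog := Real.log_pos hκ
  have hs : 0 < κ ^ (-(1 / (d : ℝ))) := by have : 0 < κ := by linarith
                                           positivity
  have hs1 : κ ^ (-(1 / (d : ℝ))) < 1 := Real.rpow_lt_one_of_one_lt_of_neg hκ (by
    have : 0 < 1 / (d : ℝ) := by positivity
    linarith)
  have hx : 0 < 2 * (d : ℝ) * Real.logb κ ε⁻¹ / β := by
    rw [logb_inv_eq hε hε1]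
    have : 0 < |Real.log ε| := abs_pos.2 (Real.log_neg hε hε1).ne
    positivity
  have e := rpow_finestLevel hd hκ hβ hε
  refine ⟨Nat.one_le_iff_ne_zero.2 (Nat.ceil_pos.2 hx).ne', ?_, ?_⟩
  · conv_rhs => rw [← e]
    exact Real.rpow_le_rpow_of_exponent_ge hs hs1.le
      (mul_le_mul_of_nonneg_left (Nat.le_ceil _) (by linarith))
  · conv_lhs => rw [← e]
    rw [← Real.rpow_add hs]
    refine Real.rpow_le_rpow_of_exponent_ge hs hs1.le ?_
    have := (Nat.ceil_lt_add_one hx.le).le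
    rw [finestLevel]
    nlinarith

lemma exists_finestLevel_le (hκ : 1 < κ) (hβ : 0 < β) (hε₀ : 0 < ε₀) (hε₀1 : ε₀ < 1) :
    ∃ c : ℝ, 0 ≤ c ∧ ∀ ε, 0 < ε → ε ≤ ε₀ → (finestLevel d κ β ε : ℝ) + 1 ≤ c * |Real.log ε| := by
  have hlog := Real.log_pos hκ
  have hl0 : 0 < |Real.log ε₀| := abs_pos.2 (Real.log_neg hε₀ hε₀1).ne
  -- The first summand is the leading term. The second absorbs the additive 2, one unit from the
  -- ceiling and one from L + 1, since |log ε| ≥ |log ε₀| > 0; here ε₀ < 1 enters.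
  refine ⟨2 * d / (β * Real.log κ) + 2 / |Real.log ε₀|, by positivity, fun ε hε hεε₀ => ?_⟩
  have hε1 : ε < 1 := by linarith
  have hx : 0 ≤ 2 * (d : ℝ) * Real.logb κ ε⁻¹ / β := by
    rw [logb_inv_eq hε hε1]; positivity
  have h1 := (Nat.ceil_lt_add_one hx).le
  have h2 : |Real.log ε₀| ≤ |Real.log ε| := by
    rw [abs_of_neg (Real.log_neg hε₀ hε₀1), abs_of_neg (Real.log_neg hε hε1)]
    exact neg_le_neg (Real.log_le_log hε hεε₀)
  have h3 : 2 ≤ 2 / |Real.log ε₀| * |Real.log ε| := by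
    rw [div_mul_eq_mul_div, le_div_iff₀ hl0]; linarith
  have h4 : 2 * (d : ℝ) * Real.logb κ ε⁻¹ / β = 2 * d / (β * Real.log κ) * |Real.log ε| := by
    rw [logb_inv_eq hε hε1]; field_simp
  rw [finestLevel]
  rw [h4] at h1 ⊢
  linarith

lemma exists_abs_log_pow_mul_le (n : ℕ) :
    ∃ B : ℝ, 0 ≤ B ∧ ∀ ε : ℝ, 0 < ε → ε ≤ 1 → |Real.log ε| ^ n * ε ≤ B := by
  rcases Nat.eq_zero_or_pos n with rfl | hn
  · exact ⟨1, zero_le_one, fun ε _ h => by simpa using h⟩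
  have hn' : (0 : ℝ) < n := by exact_mod_cast hn
  -- The bound |log ε| ε^(1/n) < n, raised to the power n.
  refine ⟨(n : ℝ) ^ n, by positivity, fun ε hε hε1 => ?_⟩
  have h := (Real.abs_log_mul_self_rpow_lt ε (1 / n) hε hε1 (by positivity)).le
  rw [one_div_one_div, abs_mul, abs_of_nonneg (Real.rpow_nonneg hε.le _)] at h
  calc |Real.log ε| ^ n * ε = (|Real.log ε| * ε ^ (1 / (n : ℝ))) ^ n := by
        rw [mul_pow, ← Real.rpow_natCast (ε ^ (1 / (n : ℝ))), ← Real.rpow_mul hε.le,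
          one_div_mul_cancel hn'.ne', Real.rpow_one]
    _ ≤ _ := by gcongr

end FinestLevel

namespace FilterModel

/-! ### From the stated rates to the sample regime and the total cost. -/

section Model

variable {𝓗 Ξ Ω : Type*} [NormedAddCommGroup 𝓗] [InnerProductSpace ℝ 𝓗] [CompleteSpace 𝓗]
  [SecondCountableTopology 𝓗] [MeasurableSpace 𝓗] [BorelSpace 𝓗] [MeasurableSpace Ξ]
  [MeasurableSpace Ω] {Pr : Measure Ω} {m : ℕ}
  {S : FilterModel 𝓗 Ξ m} {h costΨ : ℕ → ℝ} {d : ℕ} {κ β γ : ℝ}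

lemma MultilevelRates.comparable_resolution (hR : S.MultilevelRates Pr h costΨ d κ β γ)
    (hκ : 1 < κ) : Comparable h fun l => (κ ^ (-(1 / (d : ℝ)))) ^ l := by
  have hk : ∀ l : ℕ, 0 < κ ^ l := fun l => by have : 0 < κ := by linarith
                                              positivity
  have h1 := hR.resolution.trans (hR.dim_growth.rpow hk (-(1 / (d : ℝ))))
  have e : (fun l : ℕ => (κ ^ l) ^ (-(1 / (d : ℝ)))) = fun l => (κ ^ (-(1 / (d : ℝ)))) ^ l := by
    funext l
    rw [pow_rpow_eq (by linarith), Real.rpow_mul (by linarith), Real.rpow_natCast]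
  rwa [e] at h1

lemma MultilevelRates.levelRates (hR : S.MultilevelRates S.noiseLaw h costΨ d κ β γ)
    (hd : 0 < d) (hκ : 1 < κ) (hβ : 0 < β) :
    S.LevelRates ((κ ^ (-(1 / (d : ℝ)))) ^ (β / 2)) := by
  have hd' : (0 : ℝ) < d := by exact_mod_cast hd
  set s := κ ^ (-(1 / (d : ℝ))) with hsdef
  have hs : 0 < s := by have : 0 < κ := by linarith
                        positivity
  have hs1 : s < 1 := Real.rpow_lt_one_of_one_lt_of_neg hκ (by
    have : 0 < 1 / (d : ℝ) := by positivity
    linarith)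
  have hsl : ∀ l : ℕ, 0 < s ^ l := fun l => by positivity
  have hc := hR.comparable_resolution hκ
  have hh : ∀ l, 0 < h l := hc.pos hsl
  obtain ⟨_, _, b, hb, hcr⟩ := hc.rpow hsl (β / 2)
  -- The constants in the hypotheses carry no sign, hence the absolute value.
  have key : ∀ (C : ℝ) (l : ℕ), C * h l ^ (β / 2) ≤ |C| * b * (s ^ (β / 2)) ^ l := by
    intro C l
    have h1 : h l ^ (β / 2) ≤ b * (s ^ l) ^ (β / 2) := (hcr l).2
    rw [pow_rpow_eq hs, Real.rpow_mul hs.le, Real.rpow_natCast] at h1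
    have := hh l
    calc C * h l ^ (β / 2) ≤ |C| * h l ^ (β / 2) := by gcongr; exact le_abs_self C
      _ ≤ |C| * (b * (s ^ (β / 2)) ^ l) := by gcongr
      _ = _ := by ring
  refine ⟨by positivity, Real.rpow_lt_one hs.le hs1 (by linarith), hR.initial_memLp,
    hR.range_Ψlev, fun p hp u hu => ?_, fun p hp => ?_⟩
  · obtain ⟨C, hC⟩ := hR.solver_rate p hp u hu
    exact ⟨|C| * b, by positivity, fun l => ⟨by positivity,
      (aesm_solver (S.measurable_Ψlev l) hu.1).sub (aesm_solver S.measurable_Ψ hu.1),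
      (hC l).trans (ENNReal.ofReal_le_ofReal (key C l))⟩⟩
  · obtain ⟨C, hC⟩ := hR.initial_rate p hp
    exact ⟨|C| * b, by positivity, fun l => ⟨by positivity, by fun_prop,
      (hC l).trans (ENNReal.ofReal_le_ofReal (key C l))⟩⟩

/-- Only the lower bound on the sample sizes is used for accuracy. In C₀ = C + 1, `C` serves the
statistical error and 1 the bias; the bound on (L+1)^k ε holds because ε beats every power of |log
ε|. -/
lemma MultilevelRates.exists_sampleRegime (hR : S.MultilevelRates Pr h costΨ d κ β γ)
    (hd : 0 < d) (hκ : 1 < κ) (hβ : 0 < β) {ε₀ c₁ c₂ : ℝ} (hε₀ : 0 < ε₀) (hε₀1 : ε₀ < 1)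
    (hc₁ : 0 < c₁) : ∃ (C₀ : ℝ) (B : ℕ → ℝ), 0 ≤ C₀ ∧ (∀ k, 0 ≤ B k) ∧
      ∀ ε, 0 < ε → ε ≤ ε₀ → ∀ M, AdmissibleSizes h d β γ c₁ c₂ (finestLevel d κ β ε) M →
        SampleRegime ((κ ^ (-(1 / (d : ℝ)))) ^ (β / 2)) C₀ B ε (finestLevel d κ β ε) M := by
  have hd' : (0 : ℝ) < d := by exact_mod_cast hd
  set s := κ ^ (-(1 / (d : ℝ))) with hsdef
  have hs : 0 < s := by have : 0 < κ := by linarith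
                        positivity
  have hs1 : s < 1 := Real.rpow_lt_one_of_one_lt_of_neg hκ (by
    have : 0 < 1 / (d : ℝ) := by positivity
    linarith)
  have hpow : ∀ l : ℕ, (s ^ (β / 2)) ^ l = s ^ (β / 2 * (l : ℝ)) := fun l => by
    rw [Real.rpow_mul hs.le, Real.rpow_natCast]
  obtain ⟨e₁, he₁, _, _, he⟩ := exists_sampleRate_bounds hs (hR.comparable_resolution hκ) d β γ
  obtain ⟨C, hC, hstat⟩ := exists_stat_le hs hs1 d β γ (mul_pos hc₁ he₁)
  obtain ⟨c, hc, hL⟩ := exists_finestLevel_le (d := d) hκ hβ hε₀ hε₀1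
  choose B hB hlog using exists_abs_log_pow_mul_le
  refine ⟨C + 1, fun k => c ^ k * B k, by positivity, fun k => mul_nonneg (by positivity) (hB k),
    fun ε hε hεε₀ M hM => ?_⟩
  have hε1 : ε < 1 := by linarith
  obtain ⟨hL1, hLε, -⟩ := finestLevel_bounds hd hκ hβ hε hε1
  rw [← hsdef] at hLε
  refine ⟨hε, fun l hl => (hM l hl).1, ?_, ?_, fun n => ?_⟩
  · simp only [hpow]
    refine (hstat _ M hL1 fun l hl => le_trans ?_ (hM l hl).2.1).trans ?_
    · rw [mul_assoc]
      exact mul_le_mul_of_nonneg_left (he _ l).1 hc₁.le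
    · calc _ ≤ C * ε := by gcongr
        _ ≤ _ := by gcongr; linarith
  · rw [hpow]
    exact hLε.trans (le_mul_of_one_le_left hε.le (by linarith))
  · calc _ ≤ (c * |Real.log ε|) ^ n * ε := by gcongr; exact hL ε hε hεε₀
      _ = c ^ n * (|Real.log ε| ^ n * ε) := by ring
      _ ≤ _ := by gcongr; exact hlog n ε hε hε1.le

lemma prev_le {f : ℕ → ℝ} {g : ℕ → ℝ} (hg : Monotone g) (hg0 : 0 ≤ g 0) (h : ∀ l, f l ≤ g l)
    (l : ℕ) : prev f l ≤ g l := by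
  cases l with
  | zero => exact hg0
  | succ l => exact (h l).trans (hg (Nat.le_succ l))

/-- The cost is bounded by the work over all levels. -/
lemma MultilevelRates.exists_mlCost_le (hR : S.MultilevelRates Pr h costΨ d κ β γ)
    (hd : 0 < d) (hκ : 1 < κ) (hγ : 1 ≤ γ) (n : ℕ) :
    ∃ C : ℝ, 0 ≤ C ∧ ∀ (L : ℕ) (M : ℕ → ℕ), (∀ l ≤ L, 2 ≤ M l) →
      S.mlCost costΨ L M n ≤ C * ∑ l ∈ Finset.range (L + 1),
        M l * (κ ^ (-(1 / (d : ℝ)))) ^ (-(d * γ) * (l : ℝ)) := by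
  have hd' : (0 : ℝ) < d := by exact_mod_cast hd
  set s := κ ^ (-(1 / (d : ℝ))) with hsdef
  have hκ0 : 0 < κ := by linarith
  have hs : 0 < s := by positivity
  have hs1 : s < 1 := Real.rpow_lt_one_of_one_lt_of_neg hκ (by
    have : 0 < 1 / (d : ℝ) := by positivity
    linarith)
  -- The unit in which all costs of level l are measured, comparable to h_l^(-dγ).
  set w : ℕ → ℝ := fun l => s ^ (-(d * γ) * (l : ℝ)) with hw
  have hw_mono : Monotone w := fun a b hab => Real.rpow_le_rpow_of_exponent_ge hs hs1.le (by
    have : (a : ℝ) ≤ b := by exact_mod_cast hab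
    have h2 : 0 ≤ (d : ℝ) * γ := by positivity
    nlinarith)
  have hw1 : ∀ l, 1 ≤ w l := fun l => by
    have : w 0 = 1 := by simp [hw]
    rw [← this]; exact hw_mono (Nat.zero_le l)
  have hsl : ∀ l : ℕ, 0 < s ^ l := fun l => by positivity
  have hc := hR.comparable_resolution hκ
  have hh : ∀ l, 0 < h l := hc.pos hsl
  obtain ⟨_, _, b, hb, hcr⟩ := hc.rpow hsl (-((d : ℝ) * γ))
  obtain ⟨Cc, hCc⟩ := hR.cost_rate
  obtain ⟨_, _, a, ha, hN⟩ := hR.dim_growth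
  -- Here γ ≥ 1 enters: κ^l = s^(-dl) ≤ s^(-dγl), so arithmetic linear in the dimension is dominated
  -- by the unit of work.
  have hκs : ∀ l : ℕ, κ ^ l ≤ w l := fun l => by
    have e : κ ^ l = s ^ (-(d : ℝ) * (l : ℝ)) := by
      rw [hsdef, ← Real.rpow_mul hκ0.le, ← Real.rpow_natCast]
      congr 1
      field_simp
    rw [e]
    refine Real.rpow_le_rpow_of_exponent_ge hs hs1.le ?_
    have : (0 : ℝ) ≤ d * (l : ℝ) := by positivity
    nlinarith
  set Q : ℝ := a + |Cc| * b + 1 with hQ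
  have hQ1 : 1 ≤ Q := by have : 0 ≤ |Cc| * b := by positivity
                         linarith
  have bN : ∀ l, (S.N l : ℝ) ≤ Q * w l := fun l => by
    refine (hN l).2.trans ?_
    have := hκs l
    have := hw1 l
    have h3 : 0 ≤ |Cc| * b := by positivity
    gcongr
    linarith
  have bC : ∀ l, costΨ l ≤ Q * w l := fun l => by
    have h1 : h l ^ (-((d : ℝ) * γ)) ≤ b * (s ^ l) ^ (-((d : ℝ) * γ)) := (hcr l).2
    rw [pow_rpow_eq hs] at h1
    have := hh l
    have h2 := hw1 l
    calc costΨ l ≤ Cc * h l ^ (-((d : ℝ) * γ)) := hCc l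
      _ ≤ |Cc| * h l ^ (-((d : ℝ) * γ)) := by gcongr; exact le_abs_self Cc
      _ ≤ |Cc| * (b * w l) := by gcongr
      _ = |Cc| * b * w l := by ring
      _ ≤ Q * w l := by gcongr; linarith
  have hQw_mono : Monotone fun l => Q * w l := fun a b hab =>
    mul_le_mul_of_nonneg_left (hw_mono hab) (by linarith)
  have hQw0 : 0 ≤ Q * w 0 := by have := hw1 0; positivity
  have bC' := prev_le hQw_mono hQw0 bC
  have bN' : ∀ l, ((prev S.N l : ℕ) : ℝ) ≤ Q * w l := fun l => by
    cases l with
    | zero => simpa [prev] using hQw0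
    | succ l => exact (bN l).trans (hQw_mono (Nat.le_succ l))
  have bone : ∀ l, 1 ≤ Q * w l := fun l => one_le_mul_of_one_le_of_one_le hQ1 (hw1 l)
  have hm0 : (0 : ℝ) ≤ m := Nat.cast_nonneg m
  have bstate : ∀ (N : ℕ) (c x : ℝ), (N : ℝ) ≤ x → c ≤ x → 1 ≤ x →
      stateCost m N c ≤ (4 + 9 * m) * x := by
    intro N c x h1 h2 h3
    have h4 : (m : ℝ) * N ≤ m * x := by gcongr
    have h5 : (m : ℝ) ≤ m * x := le_mul_of_one_le_right hm0 h3
    simp only [stateCost]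
    linarith
  have bacc : ∀ (N : ℕ) (x : ℝ), (N : ℝ) ≤ x → 1 ≤ x →
      accumulateCost m N ≤ (1 + 3 * m) * x := by
    intro N x h1 h3
    have h4 : (m : ℝ) * N ≤ m * x := by gcongr
    have h5 : (m : ℝ) ≤ m * x := le_mul_of_one_le_right hm0 h3
    simp only [accumulateCost]
    linarith
  have bgain : ∀ (N : ℕ) (x : ℝ), (N : ℝ) ≤ x → 1 ≤ x →
      gainCost m N ≤ (5 * m ^ 2 + 3 * m ^ 3) * x := by
    intro N x h1 h3
    have h4 : (m : ℝ) ^ 2 * N ≤ m ^ 2 * x := by gcongr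
    have h5 : (m : ℝ) ^ 2 ≤ m ^ 2 * x := le_mul_of_one_le_right (by positivity) h3
    have h6 : (m : ℝ) ^ 3 ≤ m ^ 3 * x := le_mul_of_one_le_right (by positivity) h3
    simp only [gainCost]
    linarith
  -- A pair costs 2m + 2(4 + 9m) = 8 + 20m units, accumulation on a level 2(1 + 3m) more; the last
  -- bracket is the gain.
  set T : ℝ := 10 + 26 * m + (5 * m ^ 2 + 3 * m ^ 3) with hT
  have hT0 : 0 ≤ T := by positivity
  refine ⟨(2 + n * T + 6) * Q, by positivity, fun L M hM => ?_⟩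
  have hmem : ∀ {L l : ℕ}, l ∈ Finset.range (L + 1) → l ≤ L := fun h => by
    simpa [Nat.lt_succ_iff] using h
  set Wk := ∑ l ∈ Finset.range (L + 1), (M l : ℝ) * w l with hWk
  have hWQ : Q * Wk = ∑ l ∈ Finset.range (L + 1), (M l : ℝ) * (Q * w l) := by
    rw [hWk, Finset.mul_sum]; exact Finset.sum_congr rfl fun l _ => by ring
  -- The one-time cost of the gain is charged to a single particle of the finest level.
  have hlast : Q * w L ≤ Q * Wk := by
    rw [hWQ]
    have h1 : (1 : ℝ) ≤ M L := by exact_mod_cast (by have := hM L le_rfl; omega : 1 ≤ M L)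
    have h2 := bone L
    refine le_trans ?_ (Finset.single_le_sum (f := fun l => (M l : ℝ) * (Q * w l))
      (fun l _ => by have := bone l; positivity) (Finset.mem_range.2 (Nat.lt_succ_self L)))
    exact le_mul_of_one_le_left (by linarith) h1
  have p1 : ∑ l ∈ Finset.range (L + 1), (M l : ℝ) * (S.N l + prev S.N l) ≤ 2 * (Q * Wk) := by
    rw [hWQ, Finset.mul_sum]
    refine Finset.sum_le_sum fun l _ => ?_
    calc _ ≤ (M l : ℝ) * (Q * w l + Q * w l) := by gcongr; exacts [bN l, bN' l]
      _ = _ := by ring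
  have p3 : ∑ l ∈ Finset.range (L + 1), ((M l : ℝ) * (S.N l + prev S.N l + 2) + 2)
      ≤ 6 * (Q * Wk) := by
    rw [hWQ, Finset.mul_sum]
    refine Finset.sum_le_sum fun l hl => ?_
    have h2 : (2 : ℝ) ≤ M l := by exact_mod_cast hM l (hmem hl)
    have h3 := bone l
    have h4 : 2 ≤ (M l : ℝ) * (Q * w l) := by nlinarith
    calc _ ≤ (M l : ℝ) * (Q * w l + Q * w l + 2 * (Q * w l)) + 2 := by
          gcongr
          exacts [bN l, bN' l, by linarith]
      _ ≤ _ := by linarith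
  have p2 : S.transitionCost costΨ L M ≤ T * (Q * Wk) := by
    have q1 : ∑ l ∈ Finset.range (L + 1),
        ((M l : ℝ) * (2 * m + stateCost m (S.N l) (costΨ l)
          + stateCost m (prev S.N l) (prev costΨ l))
        + (accumulateCost m (S.N l) + accumulateCost m (prev S.N l)))
        ≤ (10 + 26 * m) * (Q * Wk) := by
      rw [hWQ, Finset.mul_sum]
      refine Finset.sum_le_sum fun l hl => ?_
      have h2 : (1 : ℝ) ≤ M l := by exact_mod_cast (by have := hM l (hmem hl); omega : 1 ≤ M l)
      have h3 := bone l
      have s1 := bstate _ _ _ (bN l) (bC l) h3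
      have s2 := bstate _ _ _ (bN' l) (bC' l) h3
      have a1 := bacc _ _ (bN l) h3
      have a2 := bacc _ _ (bN' l) h3
      have h5 : (m : ℝ) ≤ m * (Q * w l) := le_mul_of_one_le_right hm0 h3
      have h6 : (2 + 6 * m) * (Q * w l) ≤ (M l : ℝ) * ((2 + 6 * m) * (Q * w l)) :=
        le_mul_of_one_le_left (by positivity) h2
      calc _ ≤ (M l : ℝ) * ((8 + 20 * m) * (Q * w l)) + (2 + 6 * m) * (Q * w l) := by
            gcongr
            · linarith
            · linarith
        _ ≤ _ := by linarith
    have q2 := bgain _ _ (bN L) (bone L)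
    have q3 : (5 * (m : ℝ) ^ 2 + 3 * m ^ 3) * (Q * w L)
        ≤ (5 * (m : ℝ) ^ 2 + 3 * m ^ 3) * (Q * Wk) := by gcongr
    simp only [transitionCost]
    rw [hT, add_mul]
    linarith
  simp only [mlCost]
  have p2' : (n : ℝ) * S.transitionCost costΨ L M ≤ n * (T * (Q * Wk)) := by gcongr
  calc _ ≤ 2 * (Q * Wk) + n * (T * (Q * Wk)) + 6 * (Q * Wk) := by linarith
    _ = _ := by ring

/-- The cost as a function of the accuracy. -/
lemma MultilevelRates.exists_mlCost_le_costRate (hR : S.MultilevelRates Pr h costΨ d κ β γ)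
    (hd : 0 < d) (hκ : 1 < κ) (hβ : 0 < β) (hγ : 1 ≤ γ) (n : ℕ) {ε₀ c₁ c₂ : ℝ} (hε₀ : 0 < ε₀)
    (hε₀1 : ε₀ < 1) (hc₂ : 0 < c₂) : ∃ C : ℝ, ∀ ε, 0 < ε → ε ≤ ε₀ → ∀ M,
      AdmissibleSizes h d β γ c₁ c₂ (finestLevel d κ β ε) M →
        S.mlCost costΨ (finestLevel d κ β ε) M n ≤ C * costRate d β γ ε := by
  have hd' : (0 : ℝ) < d := by exact_mod_cast hd
  obtain ⟨C, hC, hcost⟩ := hR.exists_mlCost_le hd hκ hγ n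
  set s := κ ^ (-(1 / (d : ℝ))) with hsdef
  have hs : 0 < s := by have : 0 < κ := by linarith
                        positivity
  have hs1 : s < 1 := Real.rpow_lt_one_of_one_lt_of_neg hκ (by
    have : 0 < 1 / (d : ℝ) := by positivity
    linarith)
  obtain ⟨_, _, e₂, he₂, he⟩ := exists_sampleRate_bounds hs (hR.comparable_resolution hκ) d β γ
  obtain ⟨C', hC', hwork⟩ := exists_work_le hs hs1 d β γ (mul_pos hc₂ he₂)
  obtain ⟨c, hc, hL⟩ := exists_finestLevel_le (d := d) hκ hβ hε₀ hε₀1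
  -- Converts powers of s^L into powers of ε. It is applied with θ = 2 for s^(-βL) and θ = 2dγ/β for
  -- s^(-dγL).
  have hε_pow : ∀ ε, 0 < ε → ε ≤ ε₀ → ∀ θ : ℝ, 0 ≤ θ →
      s ^ (-(β / 2 * θ) * (finestLevel d κ β ε : ℝ)) ≤ s ^ (-(β / 2 * θ)) * ε ^ (-θ) := by
    intro ε hε hεε₀ θ hθ
    obtain ⟨-, -, h1⟩ := finestLevel_bounds hd hκ hβ hε (by linarith : ε < 1)
    rw [← hsdef] at h1
    have h2 := Real.rpow_le_rpow_of_nonpos (by positivity) h1 (neg_nonpos.2 hθ)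
    rw [Real.mul_rpow hε.le (by positivity), ← Real.rpow_mul hs.le, ← Real.rpow_mul hs.le] at h2
    convert h2 using 1
    · congr 1; ring
    · rw [mul_comm]; congr 2; ring
  have hexp : ∀ x : ℝ, β / 2 * (2 * x / β) = x := fun x => by field_simp
  refine ⟨C * C' * (s ^ (-β) * c ^ 3 + s ^ (-β) + s ^ (-((d : ℝ) * γ))),
    fun ε hε hεε₀ M hM => ?_⟩
  have hwork' := hwork (finestLevel d κ β ε) M fun l hl => (hM l hl).2.2.trans (by
    rw [mul_assoc]; exact mul_le_mul_of_nonneg_left (he _ l).2 hc₂.le)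
  refine (hcost _ M fun l hl => (hM l hl).1).trans ?_
  refine (mul_le_mul_of_nonneg_left hwork' hC).trans ?_
  rw [← mul_assoc, mul_assoc (C * C')]
  refine mul_le_mul_of_nonneg_left ?_ (by positivity)
  have hβ2 := hε_pow ε hε hεε₀ 2 (by norm_num)
  rw [show β / 2 * 2 = β by ring] at hβ2
  have i1 : 0 ≤ s ^ (-β) * c ^ 3 := by positivity
  have i2 : 0 < s ^ (-β) := by positivity
  have i3 : 0 < s ^ (-((d : ℝ) * γ)) := by positivity
  unfold costRate
  split_ifs with h1 h2
  · refine hβ2.trans ?_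
    gcongr
    linarith
  · calc _ ≤ (c * |Real.log ε|) ^ 3 * (s ^ (-β) * ε ^ (-2 : ℝ)) := by
          gcongr
          exact hL ε hε hεε₀
      _ = s ^ (-β) * c ^ 3 * (ε ^ (-2 : ℝ) * |Real.log ε| ^ 3) := by ring
      _ ≤ _ := by
          gcongr
          linarith
  · have h3 := hε_pow ε hε hεε₀ (2 * (d * γ) / β) (by positivity)
    rw [hexp] at h3
    refine h3.trans ?_
    rw [show -(2 * (d * γ) / β) = -(2 * d * γ / β) by ring]
    gcongr
    linarith

end Model

end FilterModel

end MLEnKF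

namespace MLEnKF

namespace FilterModel

/-! ### Transfer of the accuracy bound to the given probability space. -/

section Accuracy

variable {𝓗 Ξ Ω : Type*} [NormedAddCommGroup 𝓗] [InnerProductSpace ℝ 𝓗] [CompleteSpace 𝓗]
  [SecondCountableTopology 𝓗] [MeasurableSpace 𝓗] [BorelSpace 𝓗] [MeasurableSpace Ξ]
  [MeasurableSpace Ω] {Pr : Measure Ω} [IsProbabilityMeasure Pr] {m : ℕ}
  {S : FilterModel 𝓗 Ξ m} {h costΨ : ℕ → ℝ} {d : ℕ} {κ β γ : ℝ}

/-- The noises of all particles as a measure preserving map to the space of noise fields. -/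
lemma exists_measurePreserving_fieldLaw {W : ℕ → ℕ → Ω → Noise 𝓗 Ξ m}
    (hWlaw : ∀ l i, HasLaw (W l i) S.noiseLaw Pr)
    (hWindep : iIndepFun (fun q : ℕ × ℕ => W q.1 q.2) Pr) :
    ∃ T : Ω → ℕ × ℕ → Noise 𝓗 Ξ m, MeasurePreserving T Pr S.fieldLaw ∧
      ∀ᵐ ω ∂Pr, ∀ l i, T ω (l, i) = W l i ω := by
  have hm : AEMeasurable (fun ω (q : ℕ × ℕ) => W q.1 q.2 ω) Pr :=
    aemeasurable_pi_iff.2 fun q => (hWlaw q.1 q.2).aemeasurable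
  have hL := iIndepFun.hasLaw_infinitePi (fun q : ℕ × ℕ => hWlaw q.1 q.2) hWindep hm
  -- The noises are only almost everywhere measurable, so the map is a measurable modification,
  -- equal to them for all particles outside a single null set.
  refine ⟨hm.mk _, ⟨hm.measurable_mk, ?_⟩, ?_⟩
  · rw [← Measure.map_congr hm.ae_eq_mk]
    exact hL.map_eq
  · filter_upwards [hm.ae_eq_mk] with ω hω l i
    rw [← hω]

/-- The assumptions are pushed forward from Ω to the space of noise fields and then to a single
particle, the estimate is proved on the fields, and its norm is pulled back to Ω. -/
theorem accuracy (hd : 0 < d) (hκ : 1 < κ) (hβ : 0 < β)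
    (hSolver : S.SolverBounds Pr) (hRates : S.MultilevelRates Pr h costΨ d κ β γ)
    {φ : 𝓗 → ℝ} {Cφ : ℝ≥0} (hφ : LipschitzWith Cφ φ) {W : ℕ → ℕ → Ω → Noise 𝓗 Ξ m}
    (hWlaw : ∀ l i, HasLaw (W l i) S.noiseLaw Pr)
    (hWindep : iIndepFun (fun q : ℕ × ℕ => W q.1 q.2) Pr) :
    (∀ n, Integrable φ (S.meanFieldLaw n)) ∧
    ∀ p : ℝ, 2 ≤ p → ∀ (n : ℕ) (ε₀ c₁ c₂ : ℝ), 0 < ε₀ → ε₀ < 1 → 0 < c₁ → 0 < c₂ →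
      ∃ C : ℝ, ∀ ε : ℝ, 0 < ε → ε ≤ ε₀ → ∀ M : ℕ → ℕ,
        AdmissibleSizes h d β γ c₁ c₂ (finestLevel d κ β ε) M →
        LpLE Pr p (fun ω => S.mlEstimator (finestLevel d κ β ε) M n φ (fun l i => W l i ω)
          - ∫ x, φ x ∂(S.meanFieldLaw n)) (C * (|Real.log ε| ^ n * ε)) := by
  obtain ⟨T, hT, hTW⟩ := exists_measurePreserving_fieldLaw hWlaw hWindep
  have hTn := (S.measurePreserving_eval_fieldLaw (0, 0)).comp hT
  have hSρ := hSolver.of_measurePreserving hT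
  have hS := hSolver.of_measurePreserving hTn
  have hR := (hRates.of_measurePreserving hTn).levelRates hd hκ hβ
  refine ⟨integrable_meanFieldLaw hS hR hφ, fun p hp n ε₀ c₁ c₂ hε₀ hε₀1 hc₁ _ => ?_⟩
  obtain ⟨C₀, B, hC₀, hB, hreg⟩ :=
    hRates.exists_sampleRegime hd hκ hβ (c₂ := c₂) hε₀ hε₀1 hc₁
  obtain ⟨C, hC, hest⟩ := exists_mlEstimator_sub_le hS hSρ hR hC₀ hB hφ n hp
  obtain ⟨c, hc, hL⟩ := exists_finestLevel_le (d := d) hκ hβ hε₀ hε₀1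
  refine ⟨C * c ^ n, fun ε hε hεε₀ M hM => ?_⟩
  have h1 := (hest ε _ M (hreg ε hε hεε₀ M hM)).comp hT
  refine (h1.congr ?_).mono ?_
  · filter_upwards [hTW] with ω hω
    simp only [hω]
  · calc _ ≤ C * ((c * |Real.log ε|) ^ n * ε) := by
          gcongr
          exact hL ε hε hεε₀
      _ = _ := by ring

end Accuracy

end FilterModel

end MLEnKF

namespace MLEnKF

/-! ### The density of a Gaussian measure -/

section Density

variable {E : Type*} [NormedAddCommGroup E] [InnerProductSpace ℝ E] [FiniteDimensional ℝ E]
  [MeasurableSpace E] [BorelSpace E]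

lemma integrable_exp_neg_sq_norm :
    Integrable (fun x : E => Real.exp (-(1 / 2) * ‖x‖ ^ 2)) := by
  have h := (GaussianFourier.integrable_cexp_neg_mul_sq_norm_add (V := E) (b := (1 / 2 : ℂ))
    (by norm_num) 0 0).norm
  refine h.congr (ae_of_all _ fun x => ?_)
  simp only [Complex.norm_exp]
  congr 1
  simp [← Complex.ofReal_pow]

/-- The Gaussian Fourier integral shows that both sides have proportional characteristic functions.
The normalizing constant is never computed: it is the inverse of the total mass, read off at t = 0.
-/
lemma exists_stdGaussian_eq_withDensity : ∃ c : ℝ≥0∞, c ≠ 0 ∧ c ≠ ⊤ ∧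
    stdGaussian E = c • (volume : Measure E).withDensity
      (fun x => ENNReal.ofReal (Real.exp (-(1 / 2) * ‖x‖ ^ 2))) := by
  set φ : E → ℝ≥0∞ := fun x => ENNReal.ofReal (Real.exp (-(1 / 2) * ‖x‖ ^ 2)) with hφ
  have hφm : Measurable φ := by fun_prop
  set ν := (volume : Measure E).withDensity φ
  have hν : IsFiniteMeasure ν := isFiniteMeasure_withDensity_ofReal integrable_exp_neg_sq_norm.2
  have hchar : ∀ t : E, charFun ν t
      = (Real.pi / (1 / 2 : ℂ)) ^ (Module.finrank ℝ E / 2 : ℂ) * Complex.exp (-‖t‖ ^ 2 / 2) := by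
    intro t
    have h := GaussianFourier.integral_cexp_neg_mul_sq_norm_add (V := E) (b := (1 / 2 : ℂ))
      (by norm_num) Complex.I t
    rw [charFun_apply, integral_withDensity_eq_integral_toReal_smul hφm
      (ae_of_all _ fun _ => ENNReal.ofReal_lt_top)]
    convert h using 1
    · refine integral_congr_ae (ae_of_all _ fun x => ?_)
      simp only [hφ]
      rw [ENNReal.toReal_ofReal (Real.exp_pos _).le, Complex.real_smul, Complex.ofReal_exp,
        ← Complex.exp_add, real_inner_comm]
      congr 1
      push_cast
      ring
    · congr 2
      rw [Complex.I_sq]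
      ring
  have hA : (Real.pi / (1 / 2 : ℂ)) ^ (Module.finrank ℝ E / 2 : ℂ) ≠ 0 := by
    rw [Complex.cpow_ne_zero_iff]
    left
    simp [Real.pi_ne_zero]
  have h0 : ((ν.real Set.univ : ℝ) : ℂ)
      = (Real.pi / (1 / 2 : ℂ)) ^ (Module.finrank ℝ E / 2 : ℂ) := by
    have := hchar 0
    rw [charFun_zero] at this
    simpa using this
  have hν0 : ν Set.univ ≠ 0 := by
    intro h
    rw [measureReal_def, h] at h0
    exact hA (by rw [← h0]; simp)
  refine ⟨(ν Set.univ)⁻¹, ENNReal.inv_ne_zero.2 (measure_ne_top _ _), ENNReal.inv_ne_top.2 hν0, ?_⟩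
  have : IsFiniteMeasure ((ν Set.univ)⁻¹ • ν) :=
    ν.smul_finite (ENNReal.inv_ne_top.2 hν0)
  refine Measure.ext_of_charFun (funext fun t => ?_)
  rw [charFun_stdGaussian, charFun_apply, integral_smul_measure, ← charFun_apply, hchar, ← h0,
    ENNReal.toReal_inv, ← measureReal_def, Complex.real_smul, ← mul_assoc, Complex.ofReal_inv,
    inv_mul_cancel₀ (by rw [h0]; exact hA), one_mul]

lemma map_withDensity_equiv {α β : Type*} [MeasurableSpace α] [MeasurableSpace β] (μ : Measure α)
    (e : α ≃ᵐ β) {f : α → ℝ≥0∞} (hf : Measurable f) :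
    (μ.withDensity f).map e = (μ.map e).withDensity (f ∘ e.symm) := by
  ext s hs
  rw [Measure.map_apply e.measurable hs, withDensity_apply _ (e.measurable hs),
    withDensity_apply _ hs, setLIntegral_map hs (hf.comp e.symm.measurable) e.measurable]
  simp

end Density

namespace FilterModel

/-! ### Gaussian noise density and independence of the Kalman residual. -/

section Gaussian

variable {𝓗 Ξ : Type*} [NormedAddCommGroup 𝓗] [InnerProductSpace ℝ 𝓗] [CompleteSpace 𝓗]
  [SecondCountableTopology 𝓗] [MeasurableSpace 𝓗] [BorelSpace 𝓗] [MeasurableSpace Ξ] {m : ℕ}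
  (S : FilterModel 𝓗 Ξ m)

open scoped MatrixOrder in
/-- The observation noise has a density with respect to some Haar measure. -/
lemma exists_obsNoise_eq_withDensity : ∃ lam : Measure (Obs m), lam.IsAddHaarMeasure ∧
    S.obsNoise = lam.withDensity (fun x => ENNReal.ofReal
      (Real.exp (-(1 / 2) * inner ℝ x (Matrix.toEuclideanCLM (𝕜 := ℝ) S.Γ⁻¹ x)))) := by
  obtain ⟨c, hc0, hc, h⟩ := exists_stdGaussian_eq_withDensity (E := Obs m)
  have hA := isUnit_sqrt S.posDef_Γ
  set A := CFC.sqrt S.Γ with hAdef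
  have hAs : A.IsHermitian := isHermitian_sqrt S.Γ
  have hAA : A * A = S.Γ := by
    exact CFC.sqrt_mul_sqrt_self S.Γ S.posDef_Γ.posSemidef.nonneg
  -- The noise is the image of the standard Gaussian under √Γ. The image of Lebesgue measure is
  -- again a Haar measure, and it absorbs every constant, the determinant included.
  let e : Obs m ≃L[ℝ] Obs m := ContinuousLinearEquiv.equivOfInverse
    (Matrix.toEuclideanCLM (𝕜 := ℝ) A) (Matrix.toEuclideanCLM (𝕜 := ℝ) A⁻¹)
    (toEuclideanCLM_inv_apply hA) (toEuclideanCLM_apply_inv hA)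
  have hH : ((volume : Measure (Obs m)).map e).IsAddHaarMeasure := inferInstance
  refine ⟨c • (volume : Measure (Obs m)).map e, Measure.IsAddHaarMeasure.smul _ hc0 hc, ?_⟩
  have h1 : S.obsNoise = (stdGaussian (Obs m)).map e := by
    rw [obsNoise, multivariateGaussian]
    simp only [zero_add]
    rfl
  rw [h1, h, Measure.map_smul, withDensity_smul_measure]
  congr 1
  have h2 := map_withDensity_equiv (volume : Measure (Obs m)) e.toHomeomorph.toMeasurableEquiv
    (f := fun x => ENNReal.ofReal (Real.exp (-(1 / 2) * ‖x‖ ^ 2))) (by fun_prop)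
  refine h2.trans ?_
  congr 1
  funext x
  simp only [Function.comp_apply]
  congr 3
  change ‖Matrix.toEuclideanCLM (𝕜 := ℝ) A⁻¹ x‖ ^ 2 = _
  rw [← real_inner_self_eq_norm_sq, inner_toEuclideanCLM_left hAs.inv, ← hAA, Matrix.mul_inv_rev,
    map_mul]
  rfl

lemma measurable_likelihood :
    Measurable fun z : 𝓗 × Obs m => ENNReal.ofReal (S.likelihood z.2 z.1) := by
  unfold likelihood
  refine ENNReal.measurable_ofReal.comp (Continuous.measurable ?_)
  fun_prop

lemma likelihood_pos (y : Obs m) (u : 𝓗) : 0 < S.likelihood y u := Real.exp_pos _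

lemma likelihood_le_one (y : Obs m) (u : 𝓗) : S.likelihood y u ≤ 1 := by
  refine Real.exp_le_one_iff.2 ?_
  have h := S.posDef_Γ.inv.posSemidef
  have h1 := Matrix.inner_toEuclideanCLM S.Γ⁻¹ (y - S.H u) (y - S.H u)
  have h2 := h.dotProduct_mulVec_nonneg (y - S.H u).ofLp
  rw [star_trivial] at h2
  have : 0 ≤ inner ℝ (y - S.H u) (Matrix.toEuclideanCLM (𝕜 := ℝ) S.Γ⁻¹ (y - S.H u)) := by
    rw [h1]; exact h2
  linarith

/-- Disintegration of the joint law of the state and the observation. -/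
lemma exists_lintegral_obs (π : Measure 𝓗) [IsProbabilityMeasure π] :
    ∃ lam : Measure (Obs m), lam.IsAddHaarMeasure ∧ ∀ F : 𝓗 × Obs m → ℝ≥0∞, Measurable F →
      ∫⁻ z, F (z.1, S.H z.1 - z.2) ∂(π.prod S.obsNoise)
        = ∫⁻ y, ∫⁻ u, ENNReal.ofReal (S.likelihood y u) * F (u, y) ∂π ∂lam := by
  obtain ⟨lam, hlam, h⟩ := S.exists_obsNoise_eq_withDensity
  refine ⟨lam, hlam, fun F hF => ?_⟩
  have hm := S.measurable_likelihood
  rw [lintegral_lintegral_swap ((hm.comp measurable_swap).mul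
    (hF.comp measurable_swap)).aemeasurable, lintegral_prod]
  · refine lintegral_congr fun u => ?_
    have hF' : Measurable fun x : Obs m => F (u, S.H u - x) :=
      hF.comp (measurable_const.prodMk (measurable_const.sub measurable_id))
    rw [h]
    refine (lintegral_withDensity_eq_lintegral_mul lam (by fun_prop) hF').trans ?_
    -- The substitution y = H u - x, allowed by invariance of Haar measure under translation and
    -- reflection, turns the noise density at x into the likelihood of y.
    rw [← lintegral_sub_left_eq_self (μ := lam)
      (fun y => ENNReal.ofReal (S.likelihood y u) * F (u, y)) (S.H u)]
    refine lintegral_congr fun x => ?_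
    simp [likelihood]
  · exact (hF.comp (measurable_fst.prodMk ((S.H.continuous.measurable.comp measurable_fst).sub
      measurable_snd))).aemeasurable

/-- The innovation part `v - K (H v - η)` of the update. -/
noncomputable def residual (π : Measure 𝓗) (z : 𝓗 × Obs m) : 𝓗 :=
  z.1 - S.meanFieldGain π (S.H z.1 - z.2)

lemma measurable_residual (π : Measure 𝓗) : Measurable (S.residual π) := by
  unfold residual; fun_prop

variable {π : Measure 𝓗}

lemma updateLaw_eq (y : Obs m) : S.updateLaw y π
    = (π.prod S.obsNoise).map fun z => S.residual π z + S.meanFieldGain π y := by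
  unfold updateLaw residual
  congr 1
  funext z
  simp only [map_add, map_sub]
  abel

lemma isGaussian_obsNoise : IsGaussian S.obsNoise := by unfold obsNoise; infer_instance

lemma hasGaussianLaw_residual_obs [IsGaussian π] :
    HasGaussianLaw (fun z => (S.residual π z, S.H z.1 - z.2)) (π.prod S.obsNoise) := by
  have := S.isGaussian_obsNoise
  let Y : 𝓗 × Obs m →L[ℝ] Obs m :=
    S.H ∘L ContinuousLinearMap.fst ℝ 𝓗 (Obs m) - ContinuousLinearMap.snd ℝ 𝓗 (Obs m)
  let Z : 𝓗 × Obs m →L[ℝ] 𝓗 := ContinuousLinearMap.fst ℝ 𝓗 (Obs m) - S.meanFieldGain π ∘L Y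
  exact (IsGaussian.hasGaussianLaw_id (μ := π.prod S.obsNoise)).map_fun (Z.prod Y)

lemma isGaussian_updateLaw [IsGaussian π] (y : Obs m) : IsGaussian (S.updateLaw y π) := by
  have h := S.hasGaussianLaw_residual_obs (π := π) |>.fst
  have h1 : S.updateLaw y π
      = ((π.prod S.obsNoise).map (S.residual π)).map (fun x => x + S.meanFieldGain π y) := by
    rw [updateLaw_eq, Measure.map_map (by fun_prop) (S.measurable_residual π)]
    rfl
  have := h.isGaussian_map
  rw [h1]
  infer_instance

/-- The gain equation. -/
lemma meanFieldGain_comp [IsProbabilityMeasure π] (hπ : MemLp (fun x : 𝓗 => x) 2 π) (w : Obs m) :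
    S.meanFieldGain π (S.H (covOp π (ContinuousLinearMap.adjoint S.H w))
      + Matrix.toEuclideanCLM (𝕜 := ℝ) S.Γ w)
      = covOp π (ContinuousLinearMap.adjoint S.H w) := by
  have hu : IsUnit (S.obsMatrix (S.crossCov (covOp π)) + S.Γ) :=
    (Matrix.PosDef.posSemidef_add (S.posSemidef_obsMatrix_covOp hπ) S.posDef_Γ).isUnit
  have h1 : S.H (covOp π (ContinuousLinearMap.adjoint S.H w))
      + Matrix.toEuclideanCLM (𝕜 := ℝ) S.Γ w
      = Matrix.toEuclideanCLM (𝕜 := ℝ) (S.obsMatrix (S.crossCov (covOp π)) + S.Γ) w := by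
    rw [map_add, toEuclideanCLM_obsMatrix]
    rfl
  rw [h1, meanFieldGain, ContinuousLinearMap.comp_apply, toEuclideanCLM_inv_apply hu]
  rfl

lemma covariance_inner_covOp [IsProbabilityMeasure π] (hπ : MemLp (fun x : 𝓗 => x) 2 π) (a b : 𝓗) :
    cov[fun u => inner ℝ a u, fun u => inner ℝ b u; π] = inner ℝ a (covOp π b) := by
  have hI : Integrable (fun x : 𝓗 => x) π := hπ.integrable (by norm_num)
  rw [inner_covOp hπ, covariance]
  refine integral_congr_ae (ae_of_all _ fun x => ?_)
  simp only [integral_inner hI]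
  rw [real_inner_comm a, real_inner_comm b, inner_sub_right, inner_sub_right]

lemma covariance_inner_obsNoise (a b : Obs m) :
    cov[fun u => inner ℝ a u, fun u => inner ℝ b u; S.obsNoise]
      = inner ℝ a (Matrix.toEuclideanCLM (𝕜 := ℝ) S.Γ b) := by
  have := S.isGaussian_obsNoise
  rw [← covarianceBilin_apply_eq_cov IsGaussian.memLp_two_id, obsNoise,
    covarianceBilin_multivariateGaussian S.posDef_Γ.posSemidef, Matrix.inner_toEuclideanCLM]

/-- The defining property of the Kalman gain. For test vectors x and w the covariance is ⟨x, C H*w⟩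
- ⟨x, K (H C H* + Γ) w⟩, which vanishes by the gain equation; for jointly Gaussian vectors
uncorrelated means independent. -/
lemma indepFun_residual_obs [IsGaussian π] :
    IndepFun (S.residual π) (fun z => S.H z.1 - z.2) (π.prod S.obsNoise) := by
  have := S.isGaussian_obsNoise
  have hπ : MemLp (fun x : 𝓗 => x) 2 π := IsGaussian.memLp_two_id
  have hη : MemLp (fun x : Obs m => x) 2 S.obsNoise := IsGaussian.memLp_two_id
  refine S.hasGaussianLaw_residual_obs.indepFun_of_covariance_inner fun x w => ?_
  set K := S.meanFieldGain π
  set b := ContinuousLinearMap.adjoint K x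
  set a := x - ContinuousLinearMap.adjoint S.H b with ha
  set a' := ContinuousLinearMap.adjoint S.H w
  have e1 : (fun z : 𝓗 × Obs m => (inner ℝ x (S.residual π z) : ℝ))
      = fun z => inner ℝ a z.1 + inner ℝ b z.2 := by
    funext z
    simp only [residual, a, b, inner_sub_left, inner_sub_right,
      ContinuousLinearMap.adjoint_inner_left, map_sub]
    ring
  have e2 : (fun z : 𝓗 × Obs m => (inner ℝ w (S.H z.1 - z.2) : ℝ))
      = fun z => inner ℝ a' z.1 - inner ℝ w z.2 := by
    funext z
    simp only [a', inner_sub_right, ContinuousLinearMap.adjoint_inner_left]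
  have l1 : ∀ a : 𝓗, MemLp (fun u : 𝓗 => (inner ℝ a u : ℝ)) 2 π := fun a =>
    (innerSL ℝ a).comp_memLp' hπ
  have l2 : ∀ a : Obs m, MemLp (fun u : Obs m => (inner ℝ a u : ℝ)) 2 S.obsNoise := fun a =>
    (innerSL ℝ a).comp_memLp' hη
  have m1 : ∀ a : 𝓗, MemLp (fun z : 𝓗 × Obs m => (inner ℝ a z.1 : ℝ)) 2 (π.prod S.obsNoise) :=
    fun a => (l1 a).comp_measurePreserving measurePreserving_fst
  have m2 : ∀ a : Obs m, MemLp (fun z : 𝓗 × Obs m => (inner ℝ a z.2 : ℝ)) 2 (π.prod S.obsNoise) :=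
    fun a => (l2 a).comp_measurePreserving measurePreserving_snd
  have c1 : ∀ a a' : 𝓗, cov[fun z : 𝓗 × Obs m => inner ℝ a z.1, fun z => inner ℝ a' z.1;
      π.prod S.obsNoise] = inner ℝ a (covOp π a') := fun a a' => by
    rw [← covariance_inner_covOp hπ]
    have hmp : MeasurePreserving Prod.fst (π.prod S.obsNoise) π := measurePreserving_fst
    conv_rhs => rw [← hmp.map_eq]
    exact (covariance_map_fun (by fun_prop) (by fun_prop) hmp.measurable.aemeasurable).symm
  have c2 : ∀ a a' : Obs m, cov[fun z : 𝓗 × Obs m => inner ℝ a z.2, fun z => inner ℝ a' z.2;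
      π.prod S.obsNoise] = inner ℝ a (Matrix.toEuclideanCLM (𝕜 := ℝ) S.Γ a') := fun a a' => by
    rw [← covariance_inner_obsNoise]
    have hmp : MeasurePreserving Prod.snd (π.prod S.obsNoise) S.obsNoise := measurePreserving_snd
    conv_rhs => rw [← hmp.map_eq]
    exact (covariance_map_fun (by fun_prop) (by fun_prop) hmp.measurable.aemeasurable).symm
  have c3 : ∀ (a : 𝓗) (b : Obs m), cov[fun z : 𝓗 × Obs m => inner ℝ a z.1,
      fun z => inner ℝ b z.2; π.prod S.obsNoise] = 0 := fun a b =>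
    covariance_fst_snd_prod (l1 a) (l2 b)
  have c4 : ∀ (a : 𝓗) (b : Obs m), cov[fun z : 𝓗 × Obs m => inner ℝ b z.2,
      fun z => inner ℝ a z.1; π.prod S.obsNoise] = 0 := fun a b => by
    rw [covariance_comm]; exact c3 a b
  rw [e1, e2]
  change cov[(fun z : 𝓗 × Obs m => (inner ℝ a z.1 : ℝ)) + (fun z => inner ℝ b z.2),
    (fun z : 𝓗 × Obs m => (inner ℝ a' z.1 : ℝ)) - (fun z => inner ℝ w z.2); π.prod S.obsNoise] = 0
  rw [covariance_sub_right ((m1 a).add (m2 b)) (m1 a') (m2 w), covariance_add_left (m1 a) (m2 b)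
    (m1 a'), covariance_add_left (m1 a) (m2 b) (m2 w), c1, c2, c3, c4, add_zero, zero_add]
  have hgain := S.meanFieldGain_comp hπ w
  rw [ha, inner_sub_left, ContinuousLinearMap.adjoint_inner_left,
    ContinuousLinearMap.adjoint_inner_left, ContinuousLinearMap.adjoint_inner_left, sub_sub,
    ← inner_add_right, ← map_add, hgain, sub_self]

end Gaussian

end FilterModel

end MLEnKF

/-! ### Bayes' formula and the filtering distribution. -/

namespace MLEnKF

lemma continuous_lintegral_of_le {X α : Type*} [TopologicalSpace X] [FirstCountableTopology X]
    [MeasurableSpace α] {μ : Measure α} [IsFiniteMeasure μ] {F : X → α → ℝ≥0∞} {C : ℝ≥0∞}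
    (hC : C ≠ ⊤) (hm : ∀ x, Measurable (F x)) (hb : ∀ x a, F x a ≤ C)
    (hc : ∀ a, Continuous fun x => F x a) : Continuous fun x => ∫⁻ a, F x a ∂μ := by
  refine continuous_iff_continuousAt.2 fun x => ?_
  refine tendsto_lintegral_filter_of_dominated_convergence (fun _ => C)
    (Filter.Eventually.of_forall hm) (Filter.Eventually.of_forall fun x => ae_of_all _ (hb x)) ?_
    (ae_of_all _ fun a => (hc a).continuousAt)
  rw [lintegral_const]
  exact ENNReal.mul_ne_top hC (measure_ne_top _ _)

namespace FilterModel

section Bayes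

variable {𝓗 Ξ : Type*} [NormedAddCommGroup 𝓗] [InnerProductSpace ℝ 𝓗] [CompleteSpace 𝓗]
  [SecondCountableTopology 𝓗] [MeasurableSpace 𝓗] [BorelSpace 𝓗] [MeasurableSpace Ξ] {m : ℕ}
  (S : FilterModel 𝓗 Ξ m) {π : Measure 𝓗}

lemma measurable_likelihood_left (y : Obs m) :
    Measurable fun u : 𝓗 => ENNReal.ofReal (S.likelihood y u) :=
  (by unfold likelihood; fun_prop : Continuous fun u : 𝓗 => S.likelihood y u).measurable.ennreal_ofReal

lemma continuous_likelihood_right (u : 𝓗) :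
    Continuous fun y : Obs m => ENNReal.ofReal (S.likelihood y u) := by
  unfold likelihood
  exact ENNReal.continuous_ofReal.comp (by fun_prop)

lemma ofReal_likelihood_le_one (y : Obs m) (u : 𝓗) : ENNReal.ofReal (S.likelihood y u) ≤ 1 :=
  ENNReal.ofReal_le_one.2 (S.likelihood_le_one y u)

/-- Bayes' formula for the Gaussian update, tested against a bounded continuous function. -/
lemma lintegral_likelihood_mul [IsGaussian π] (f : BoundedContinuousFunction 𝓗 ℝ≥0) (y : Obs m) :
    ∫⁻ u, ENNReal.ofReal (S.likelihood y u) * f u ∂π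
      = (∫⁻ u, ENNReal.ofReal (S.likelihood y u) ∂π) * ∫⁻ x, f x ∂(S.updateLaw y π) := by
  obtain ⟨lam, hlam, hlaw⟩ := S.exists_lintegral_obs π
  have := S.isGaussian_obsNoise
  set ρ := π.prod S.obsNoise
  set K := S.meanFieldGain π
  set Y : 𝓗 × Obs m → Obs m := fun z => S.H z.1 - z.2 with hY
  have hYm : Measurable Y := by fun_prop
  have hZm := S.measurable_residual π
  have hfm : Measurable fun x : 𝓗 => (f x : ℝ≥0∞) := f.continuous.measurable.coe_nnreal_ennreal
  set p : Obs m → ℝ≥0∞ := fun y => ∫⁻ u, ENNReal.ofReal (S.likelihood y u) ∂π with hp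
  set q : Obs m → ℝ≥0∞ := fun y => ∫⁻ u, ENNReal.ofReal (S.likelihood y u) * f u ∂π with hq
  set U : Obs m → ℝ≥0∞ := fun y => ∫⁻ x, f (x + K y) ∂(ρ.map (S.residual π)) with hU
  have hprob : IsProbabilityMeasure (ρ.map (S.residual π)) :=
    Measure.isProbabilityMeasure_map hZm.aemeasurable
  have hprobY : IsProbabilityMeasure (ρ.map Y) := Measure.isProbabilityMeasure_map hYm.aemeasurable
  have hfK : ∀ y, Measurable fun x : 𝓗 => (f (x + K y) : ℝ≥0∞) := fun y =>
    hfm.comp (measurable_id.add_const (K y))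
  have hfL : ∀ y, Measurable fun u : 𝓗 => ENNReal.ofReal (S.likelihood y u) * (f u : ℝ≥0∞) :=
    fun y => (S.measurable_likelihood_left y).mul hfm
  have hUy : ∀ y, ∫⁻ x, f x ∂(S.updateLaw y π) = U y := fun y => by
    rw [updateLaw_eq]
    exact (lintegral_map hfm (hZm.add_const _)).trans (lintegral_map (hfK y) hZm).symm
  have hfb : ∀ x, (f x : ℝ≥0∞) ≤ (nndist f 0 : ℝ≥0) := fun x =>
    ENNReal.coe_le_coe.2 (BoundedContinuousFunction.NNReal.upper_bound f x)
  have hpc : Continuous p := continuous_lintegral_of_le ENNReal.one_ne_top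
    S.measurable_likelihood_left S.ofReal_likelihood_le_one S.continuous_likelihood_right
  have hqc : Continuous q := continuous_lintegral_of_le
    (C := 1 * ((nndist f 0 : ℝ≥0) : ℝ≥0∞)) (by simp)
    hfL
    (fun y u => mul_le_mul' (S.ofReal_likelihood_le_one y u) (hfb u))
    (fun u => (ENNReal.continuous_mul_const ENNReal.coe_ne_top).comp
      (S.continuous_likelihood_right u))
  have hUc : Continuous U := continuous_lintegral_of_le
    (C := ((nndist f 0 : ℝ≥0) : ℝ≥0∞)) (by simp)
    hfK (fun y x => hfb _)
    (fun x => ENNReal.continuous_coe.comp (f.continuous.comp (by fun_prop)))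
  have hptop : ∀ y, p y ≠ ⊤ := fun y => ne_top_of_le_ne_top ENNReal.one_ne_top
    ((lintegral_mono (S.ofReal_likelihood_le_one y)).trans (by simp))
  have hUtop : ∀ y, U y ≠ ⊤ := fun y => ne_top_of_le_ne_top (b := ((nndist f 0 : ℝ≥0) : ℝ≥0∞))
    ENNReal.coe_ne_top ((lintegral_mono fun x => hfb _).trans (by simp))
  have hpUc : Continuous fun y => p y * U y := continuous_iff_continuousAt.2 fun y =>
    ENNReal.Tendsto.mul hpc.continuousAt (Or.inr (hUtop y)) hUc.continuousAt (Or.inr (hptop y))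
  -- The expectation of g(Y) f(v) is computed twice: by disintegrating the joint law of v and Y, and
  -- by writing v as residual plus K Y with the residual independent of Y.
  have htest : ∀ g : Obs m → ℝ≥0∞, Measurable g →
      ∫⁻ y, g y * q y ∂lam = ∫⁻ y, g y * (p y * U y) ∂lam := by
    intro g hg
    have s1 := hlaw (fun z => g z.2 * f z.1) ((hg.comp measurable_snd).mul (hfm.comp measurable_fst))
    have s2 := hlaw (fun z => g z.2 * U z.2) ((hg.mul hUc.measurable).comp measurable_snd)
    have e1 : ∀ y, ∫⁻ u, ENNReal.ofReal (S.likelihood y u) * (g y * f u) ∂π = g y * q y := fun y => by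
      simp only [hq]
      rw [← lintegral_const_mul _ (hfL y)]
      exact lintegral_congr fun u => by ring
    have e2 : ∀ y, ∫⁻ u, ENNReal.ofReal (S.likelihood y u) * (g y * U y) ∂π
        = g y * (p y * U y) := fun y => by
      rw [lintegral_mul_const _ (S.measurable_likelihood_left y)]
      simp only [hp]
      ring
    simp only [e1] at s1
    simp only [e2] at s2
    rw [← s1, ← s2]
    have hG : Measurable fun z : 𝓗 × Obs m => g z.2 * f (z.1 + K z.2) :=
      (hg.comp measurable_snd).mul (hfm.comp (by fun_prop))
    have hmapm : Measurable fun z => (S.residual π z, Y z) := hZm.prodMk hYm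
    have hind := (indepFun_iff_map_prod_eq_prod_map_map hZm.aemeasurable hYm.aemeasurable).1
      S.indepFun_residual_obs
    calc ∫⁻ z, g (S.H z.1 - z.2) * f z.1 ∂ρ
        = ∫⁻ z, g (Y z) * f (S.residual π z + K (Y z)) ∂ρ :=
          lintegral_congr fun z => by simp [hY, residual, K]
      _ = ∫⁻ z, g z.2 * f (z.1 + K z.2) ∂(ρ.map fun z => (S.residual π z, Y z)) :=
          (lintegral_map hG hmapm).symm
      _ = ∫⁻ y, ∫⁻ x, g y * f (x + K y) ∂(ρ.map (S.residual π)) ∂(ρ.map Y) := by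
          rw [hind, lintegral_prod_symm _ hG.aemeasurable]
      _ = ∫⁻ y, g y * U y ∂(ρ.map Y) := lintegral_congr fun y => by
          exact lintegral_const_mul _ (hfK y)
      _ = ∫⁻ z, g (S.H z.1 - z.2) * U (S.H z.1 - z.2) ∂ρ :=
          lintegral_map (hg.mul hUc.measurable) hYm
  -- Testing against indicators identifies the two sides for almost every observation only. Since y
  -- is prescribed, continuity of both sides and the fact that Haar measure charges open sets are
  -- used to reach every y.
  have hae : q =ᵐ[lam] fun y => p y * U y := by
    refine ae_eq_of_forall_setLIntegral_eq_of_sigmaFinite hqc.measurable hpUc.measurable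
      fun s hs _ => ?_
    have := htest (s.indicator 1) (measurable_one.indicator hs)
    rw [← lintegral_indicator hs, ← lintegral_indicator hs]
    refine Eq.trans ?_ (this.trans ?_)
    · exact lintegral_congr fun y => by by_cases h : y ∈ s <;> simp [h]
    · exact lintegral_congr fun y => by by_cases h : y ∈ s <;> simp [h]
  have heq := (hqc.ae_eq_iff_eq lam hpUc).1 hae
  rw [hUy]
  exact congrFun heq y

/-- For a Gaussian prior the mean-field update is the Bayesian update. -/
theorem updateLaw_eq_reweight [IsGaussian π] (y : Obs m) : S.updateLaw y π
    = (∫⁻ u, ENNReal.ofReal (S.likelihood y u) ∂π)⁻¹ •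
      π.withDensity (fun u => ENNReal.ofReal (S.likelihood y u)) := by
  have hLm := S.measurable_likelihood_left y
  have := S.isGaussian_updateLaw (π := π) y
  set p := ∫⁻ u, ENNReal.ofReal (S.likelihood y u) ∂π with hp
  have hp0 : p ≠ 0 := by
    rw [hp, Ne, lintegral_eq_zero_iff hLm]
    intro h
    obtain ⟨u, hu⟩ := h.exists
    have := S.likelihood_pos y u
    simp only [Pi.zero_apply, ENNReal.ofReal_eq_zero] at hu
    linarith
  have hptop : p ≠ ⊤ := ne_top_of_le_ne_top ENNReal.one_ne_top
    ((lintegral_mono (S.ofReal_likelihood_le_one y)).trans (by simp))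
  refine ext_of_forall_lintegral_eq_of_IsFiniteMeasure fun f => ?_
  have hfm : Measurable fun x : 𝓗 => (f x : ℝ≥0∞) := f.continuous.measurable.coe_nnreal_ennreal
  rw [lintegral_smul_measure, lintegral_withDensity_eq_lintegral_mul _ hLm hfm]
  have h1 := S.lintegral_likelihood_mul (π := π) f y
  simp only [Pi.mul_apply]
  rw [h1, ← hp, smul_eq_mul, ← mul_assoc, ENNReal.inv_mul_cancel hp0 hptop, one_mul]

lemma IsLinearGaussian.isGaussian_predictLaw {S : FilterModel 𝓗 Ξ m} (h : S.IsLinearGaussian)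
    [IsGaussian π] : IsGaussian (S.predictLaw π) := by
  obtain ⟨-, A, b, hb, hΨ⟩ := h
  -- Measurability of `b` is not assumed. The image measure of a map that is not almost everywhere
  -- measurable is zero by default, which a Gaussian probability measure excludes.
  have hbm : AEMeasurable b S.ν := aemeasurable_of_map_neZero (by
    have : IsProbabilityMeasure (S.ν.map b) := inferInstance
    infer_instance)
  have hb' : HasGaussianLaw b S.ν := ⟨hb⟩
  have hA : HasGaussianLaw (fun u => A u) π :=
    (IsGaussian.hasGaussianLaw_id (μ := π)).map_fun A
  have hmp1 : MeasurePreserving Prod.fst (π.prod S.ν) π := measurePreserving_fst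
  have hmp2 : MeasurePreserving Prod.snd (π.prod S.ν) S.ν := measurePreserving_snd
  have g1 : HasGaussianLaw (fun z : 𝓗 × Ξ => A z.1) (π.prod S.ν) := by
    refine ⟨?_⟩
    have : (π.prod S.ν).map (fun z : 𝓗 × Ξ => A z.1) = π.map (fun u => A u) := by
      conv_rhs => rw [← hmp1.map_eq]
      rw [Measure.map_map A.continuous.measurable hmp1.measurable]
      rfl
    rw [this]
    exact hA.isGaussian_map
  have g2 : HasGaussianLaw (fun z : 𝓗 × Ξ => b z.2) (π.prod S.ν) := by
    refine ⟨?_⟩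
    have : (π.prod S.ν).map (fun z : 𝓗 × Ξ => b z.2) = S.ν.map b := by
      conv_rhs => rw [← hmp2.map_eq]
      rw [AEMeasurable.map_map_of_aemeasurable (by rwa [hmp2.map_eq]) hmp2.measurable.aemeasurable]
      rfl
    rw [this]
    exact hb
  have hind : IndepFun (fun z : 𝓗 × Ξ => A z.1) (fun z : 𝓗 × Ξ => b z.2) (π.prod S.ν) :=
    indepFun_prod₀ A.continuous.measurable.aemeasurable hbm
  have hsum := (hind.hasGaussianLaw g1 g2).fun_add
  -- The identity holds for each state outside a null set depending on it. Fubini's theorem requires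
  -- a measurable set, so `b` is first replaced by a measurable modification.
  have hae : (fun z : 𝓗 × Ξ => S.Ψ z.1 z.2) =ᵐ[π.prod S.ν] fun z => A z.1 + b z.2 := by
    have h1 : ∀ᵐ z ∂(π.prod S.ν), S.Ψ z.1 z.2 = A z.1 + hbm.mk b z.2 := by
      rw [Measure.ae_prod_iff_ae_ae]
      · refine ae_of_all _ fun x => ?_
        filter_upwards [hΨ x, hbm.ae_eq_mk] with ξ h1 h2
        rw [h1, h2]
      · exact measurableSet_eq_fun S.measurable_Ψ ((A.continuous.measurable.comp measurable_fst).add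
          (hbm.measurable_mk.comp measurable_snd))
    have h2 : ∀ᵐ z ∂(π.prod S.ν), b z.2 = hbm.mk b z.2 :=
      hmp2.quasiMeasurePreserving.ae hbm.ae_eq_mk
    filter_upwards [h1, h2] with z h1 h2
    rw [h1, h2]
  rw [predictLaw, Measure.map_congr hae]
  exact hsum.isGaussian_map

/-- In the linear Gaussian case the mean-field law is the filtering distribution. -/
theorem IsLinearGaussian.meanFieldLaw_eq {S : FilterModel 𝓗 Ξ m} (h : S.IsLinearGaussian) (n : ℕ) :
    IsGaussian (S.meanFieldLaw n) ∧ S.meanFieldLaw n = S.filterLaw n := by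
  induction n with
  | zero => exact ⟨h.1, rfl⟩
  | succ n ih =>
    have := ih.1
    have hpred := h.isGaussian_predictLaw (π := S.meanFieldLaw n)
    refine ⟨S.isGaussian_updateLaw _, ?_⟩
    rw [meanFieldLaw, filterLaw, ← ih.2]
    exact S.updateLaw_eq_reweight _

end Bayes

end FilterModel

end MLEnKF

theorem theorem3p1
    {𝓗 Ξ Ω : Type*}
    [NormedAddCommGroup 𝓗] [InnerProductSpace ℝ 𝓗] [CompleteSpace 𝓗] [SecondCountableTopology 𝓗]
    [MeasurableSpace 𝓗] [BorelSpace 𝓗] [MeasurableSpace Ξ]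
    [MeasurableSpace Ω] (Pr : Measure Ω) [IsProbabilityMeasure Pr]
    {m : ℕ} (S : MLEnKF.FilterModel 𝓗 Ξ m)
    (h costΨ : ℕ → ℝ) (d : ℕ) (κ β γ : ℝ)
    (hd : 0 < d) (hκ : 1 < κ) (hβ : 0 < β) (hγ : 0 < γ)
    (hSolver : S.SolverBounds Pr)
    (hRates : S.MultilevelRates Pr h costΨ d κ β γ)
    (φ : 𝓗 → ℝ) (hφ : ∃ Cφ : ℝ≥0, LipschitzWith Cφ φ)
    (W : ℕ → ℕ → Ω → MLEnKF.FilterModel.Noise 𝓗 Ξ m)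
    (hWlaw : ∀ l i, HasLaw (W l i) S.noiseLaw Pr)
    (hWindep : iIndepFun (fun q : ℕ × ℕ => W q.1 q.2) Pr) :
    -- accuracy
    (∀ n, Integrable φ (S.meanFieldLaw n)) ∧
    (∀ p : ℝ, 2 ≤ p → ∀ (n : ℕ) (ε₀ c₁ c₂ : ℝ), 0 < ε₀ → ε₀ < 1 → 0 < c₁ → 0 < c₂ →
      ∃ C : ℝ, ∀ ε : ℝ, 0 < ε → ε ≤ ε₀ → ∀ M : ℕ → ℕ,
        MLEnKF.AdmissibleSizes h d β γ c₁ c₂ (MLEnKF.finestLevel d κ β ε) M →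
        MemLp (fun ω =>
            S.mlEstimator (MLEnKF.finestLevel d κ β ε) M n φ (fun l i => W l i ω)
              - ∫ x, φ x ∂(S.meanFieldLaw n)) (ENNReal.ofReal p) Pr ∧
        eLpNorm (fun ω =>
            S.mlEstimator (MLEnKF.finestLevel d κ β ε) M n φ (fun l i => W l i ω)
              - ∫ x, φ x ∂(S.meanFieldLaw n)) (ENNReal.ofReal p) Pr
          ≤ ENNReal.ofReal (C * (|Real.log ε| ^ n * ε))) ∧
    -- the limit is the Gaussian filtering distribution in the linear Gaussian case
    (S.IsLinearGaussian → ∀ n, IsGaussian (S.meanFieldLaw n) ∧ S.meanFieldLaw n = S.filterLaw n) ∧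
    -- cost
    (1 ≤ γ → ∀ (n : ℕ) (ε₀ c₁ c₂ : ℝ), 0 < ε₀ → ε₀ < 1 → 0 < c₁ → 0 < c₂ →
      ∃ C : ℝ, ∀ ε : ℝ, 0 < ε → ε ≤ ε₀ → ∀ M : ℕ → ℕ,
        MLEnKF.AdmissibleSizes h d β γ c₁ c₂ (MLEnKF.finestLevel d κ β ε) M →
        S.mlCost costΨ (MLEnKF.finestLevel d κ β ε) M n ≤ C * MLEnKF.costRate d β γ ε) := by
  obtain ⟨Cφ, hφ⟩ := hφ
  obtain ⟨h1, h2⟩ := MLEnKF.FilterModel.accuracy hd hκ hβ hSolver hRates hφ hWlaw hWindep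
  refine ⟨h1, fun p hp n ε₀ c₁ c₂ hε₀ hε₀1 hc₁ hc₂ => ?_, fun hG n => hG.meanFieldLaw_eq n,
    fun hγ1 n ε₀ c₁ c₂ hε₀ hε₀1 _ hc₂ =>
      hRates.exists_mlCost_le_costRate hd hκ hβ hγ1 n hε₀ hε₀1 hc₂⟩
  obtain ⟨C, hC⟩ := h2 p hp n ε₀ c₁ c₂ hε₀ hε₀1 hc₁ hc₂
  exact ⟨C, fun ε hε hε' M hM => ⟨(hC ε hε hε' M hM).memLp, (hC ε hε hε' M hM).le⟩⟩
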